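/- Let $C$ be a connected smooth projective curve over $\mathbb{C}$, let $\sigma$ be a non-trivial involution of $C$ over $\mathbb{C}$, let $\pi:C\to B$ be the quotient of $C$ by $\sigma$ (so $B$ is again a smooth projective curve), and let $R\subset C$ be the set of (closed) points fixed by $\sigma$. Let $\rho$ be the line bundle on $B$ associated with the double covering $\pi$: its inverse $\rho^{-1}\subset\pi_*\mathcal{O}_C$ is the subsheaf of functions $a$ with $\sigma^*a=-a$, so that $\pi_*\mathcal{O}_C=\mathcal{O}_B\oplus\rho^{-1}$. For a subset $E\subset R$ we also write $E$ for the divisor $\sum_{p\in E}p$ on $C$, and $\pi_*E$ for its direct image on $B$; we write $\pi^*L(E)=\pi^*L\otimes\mathcal{O}_C(E)$ and $\rho^{-1}(\pi_*E)=\rho^{-1}\otimes\mathcal{O}_B(\pi_*E)$. a) Let $M$ be a line bundle on $C$ with $\sigma^*M\cong M$. Then $M\cong\pi^*L(E)$ for some line bundle $L$ on $B$ and some $E\subset R$. If also $M\cong\pi^*L'(E')$ with $L'$ a line bundle on $B$ and $E'\subset R$, then either $L'\cong L$ and $E'=E$, or $L'\cong L\otimes\rho^{-1}(\pi_*E)$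 and $E'=R\smallsetminus E$. Conversely, for every line bundle $L$ on $B$ and every $E\subset R$, the sheaf $L\otimes\rho^{-1}(\pi_*E)$ is a line bundle and $\pi^*L(E)\cong\pi^*\bigl(L\otimes\rho^{-1}(\pi_*E)\bigr)(R\smallsetminus E)$. b) For every $E\subset R$ there are $\mathbb{C}$-linear isomorphisms $$H^0(C,\pi^*L(E))\;\cong\;H^0(B,L)\oplus H^0\bigl(B,L\otimes\rho^{-1}(\pi_*E)\bigr),$$ one for each line bundle $L$ on $B$, which are natural with respect to all $\mathcal{O}_B$-linear maps $L\to L'$ between line bundles. Their inverses are given on the first summand by $s\mapsto\pi^*s\otimes 1$, where $1$ is the constant section of $\mathcal{O}_C(E)$, and on the second summand by the rule that a section whose restriction to an open set $U\subset B$ is $s\otimes(a\otimes 1)$, with $s\in L(U)$ and $a\in\rho^{-1}(U)\subset\mathcal{O}_C(\pi^{-1}(U))$, goes to a section whose restriction to $\pi^{-1}(U)$ is $a\cdot(\pi^*s\otimes 1)$. -/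

import Mathlib

open CategoryTheory AlgebraicGeometry TopologicalSpace Opposite MonoidalCategory

noncomputable section

namespace CurveInvolution

/-! ### Line bundles, tensor products, submodules of sheaves of modules -/

section Modules

variable {X : Scheme.{0}}

/-- The structure sheaf `𝒪_X`, as a sheaf of modules over itself. -/
def structureSheaf (X : Scheme.{0}) : X.Modules := SheafOfModules.unit X.ringCatSheaf

/-- A line bundle on `X` is a sheaf of `𝒪_X`-modules which is locally isomorphic to `𝒪_X`. -/
def IsLineBundle (L : X.Modules) : Prop :=
  ∀ x : X, ∃ U : X.Opens, x ∈ U ∧ Nonempty (L.restrict U.ι ≅ structureSheaf U.toScheme)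

/-- The presheaf `U ↦ L(U) ⊗ N(U)`, the tensor product being taken over `𝒪_X(U)`. -/
def presheafTensor (L N : X.Modules) : X.PresheafOfModules :=
  MonoidalCategory.tensorObj
    (C := PresheafOfModules.{0} (X.presheaf ⋙ forget₂ CommRingCat RingCat)) L.val N.val

/-- The tensor product `L ⊗ N` of two `𝒪_X`-modules: the sheaf associated with
`U ↦ L(U) ⊗ N(U)`. -/
def tensor (L N : X.Modules) : X.Modules :=
  (PresheafOfModules.sheafification (𝟙 X.ringCatSheaf.obj)).obj (presheafTensor L N)

/-- The morphism `f ⊗ N : L ⊗ N ⟶ L' ⊗ N` induced by `f : L ⟶ L'`. -/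
def tensorMap {L L' : X.Modules} (f : L ⟶ L') (N : X.Modules) : tensor L N ⟶ tensor L' N :=
  (PresheafOfModules.sheafification (𝟙 X.ringCatSheaf.obj)).map
    (MonoidalCategory.whiskerRight
      (C := PresheafOfModules.{0} (X.presheaf ⋙ forget₂ CommRingCat RingCat)) f.val N.val :
      presheafTensor L N ⟶ presheafTensor L' N)

/-- The section `s ⊗ t` of `L ⊗ N` over `U` defined by sections `s` of `L` and `t` of `N`. -/
def tmul {L N : X.Modules} {U : X.Opens} (s : Γ(L, U)) (t : Γ(N, U)) : Γ(tensor L N, U) :=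
  ((PresheafOfModules.sheafificationAdjunction (𝟙 X.ringCatSheaf.obj)).unit.app
    (presheafTensor L N)).app (op U)
    (show (presheafTensor L N).obj (op U) from
      (TensorProduct.tmul Γ(X, U) s t : TensorProduct Γ(X, U) Γ(L, U) Γ(N, U)))

/-- A submodule `P` of an `𝒪_X`-module `M` (a family of submodules of the modules of sections of
`M`, stable under restriction) is local if it contains every section of `M` which belongs to `P`
locally. -/
def IsLocalSubmodule {M : X.Modules} (P : PresheafOfModules.Submodule M.val) : Prop :=
  ∀ (U : X.Opens) (s : Γ(M, U)),
    (∀ x ∈ U, ∃ (V : X.Opens) (i : V ⟶ U), x ∈ V ∧ M.presheaf.map i.op s ∈ P.obj (op V)) →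
      s ∈ P.obj (op U)

/-- The subsheaf of modules of `M` defined by a local submodule. -/
def subsheaf (M : X.Modules) (P : PresheafOfModules.Submodule M.val) (hP : IsLocalSubmodule P) :
    X.Modules where
  val := P.toPresheafOfModules
  isSheaf := by
    refine (TopCat.Presheaf.isSheaf_iff_isSheafUniqueGluing
      (P.toPresheafOfModules.presheaf : TopCat.Presheaf Ab X)).mpr ?_
    intro ι U sf hsf
    have hM := (TopCat.Presheaf.isSheaf_iff_isSheafUniqueGluing M.presheaf).mp M.isSheaf
    obtain ⟨s, hs, hs'⟩ := hM U (fun i => (sf i).1) (fun i j => congrArg Subtype.val (hsf i j))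
    refine ⟨⟨s, hP _ s ?_⟩, ?_, ?_⟩
    · intro x hx
      obtain ⟨i, hi⟩ := Opens.mem_iSup.mp hx
      refine ⟨U i, Opens.leSupr U i, hi, ?_⟩
      rw [hs i]
      exact (sf i).2
    · intro i
      exact Subtype.ext (hs i)
    · intro t ht
      exact Subtype.ext (hs' t.1 fun i => congrArg Subtype.val (ht i))

end Modules

/-! ### Rational functions and divisors -/

section Divisors

variable (X : Scheme.{0}) [IsIntegral X]

/-- The rational functions on an open subset `U` of an integral scheme, as constant functions
on `U` with values in the function field (so there is only the function `0` if `U` is empty). -/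
def rationalFunctions (U : X.Opens) : AddSubgroup (U → X.functionField) where
  carrier := {s | ∀ x y, s x = s y}
  zero_mem' := fun _ _ => rfl
  add_mem' := fun {s t} hs ht x y => by simp only [Pi.add_apply, hs x y, ht x y]
  neg_mem' := fun {s} hs x y => by simp only [Pi.neg_apply, hs x y]

instance (U : X.Opens) : Module Γ(X, U) (rationalFunctions X U) where
  smul a s := ⟨fun x => algebraMap (X.presheaf.stalk x.1) X.functionField
      (X.presheaf.germ U x.1 x.2 a) * s.1 x, fun x y => by
    have : Nonempty U := ⟨x⟩
    beta_reduce
    rw [Scheme.algebraMap_germ_eq_germToFunctionField, s.2 x y,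
      Scheme.algebraMap_germ_eq_germToFunctionField]⟩
  one_smul s := Subtype.ext <| funext fun x => by
    change algebraMap _ _ (X.presheaf.germ U x.1 x.2 1) * s.1 x = s.1 x
    simp
  mul_smul a b s := Subtype.ext <| funext fun x => by
    change algebraMap _ _ (X.presheaf.germ U x.1 x.2 (a * b)) * s.1 x =
      algebraMap _ _ (X.presheaf.germ U x.1 x.2 a) *
        (algebraMap _ _ (X.presheaf.germ U x.1 x.2 b) * s.1 x)
    simp [mul_assoc]
  smul_zero a := Subtype.ext <| funext fun x => mul_zero _
  smul_add a s t := Subtype.ext <| funext fun x => mul_add _ _ _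
  add_smul a b s := Subtype.ext <| funext fun x => by
    change algebraMap _ _ (X.presheaf.germ U x.1 x.2 (a + b)) * s.1 x =
      algebraMap _ _ (X.presheaf.germ U x.1 x.2 a) * s.1 x +
        algebraMap _ _ (X.presheaf.germ U x.1 x.2 b) * s.1 x
    simp [add_mul]
  zero_smul s := Subtype.ext <| funext fun x => by
    change algebraMap _ _ (X.presheaf.germ U x.1 x.2 0) * s.1 x = 0
    simp

/-- Restriction of rational functions. -/
def rationalRestrict {U V : X.Opens} (i : V ≤ U) :
    rationalFunctions X U →+ rationalFunctions X V where
  toFun s := ⟨fun x => s.1 ⟨x.1, i x.2⟩, fun _ _ => s.2 _ _⟩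
  map_zero' := rfl
  map_add' _ _ := rfl

/-- The presheaf of rational functions, as a presheaf of abelian groups. -/
def rationalPresheaf : TopCat.Presheaf Ab X where
  obj U := AddCommGrpCat.of (rationalFunctions X U.unop)
  map i := AddCommGrpCat.ofHom (rationalRestrict X i.unop.le)

instance (U : X.Opensᵒᵖ) : Module (X.ringCatSheaf.obj.obj U) ((rationalPresheaf X).obj U) :=
  inferInstanceAs (Module Γ(X, U.unop) (rationalFunctions X U.unop))

/-- The sheaf `K_X` of rational functions on an integral scheme, as a sheaf of modules. -/
def rationalSheaf : X.Modules where
  val := PresheafOfModules.ofPresheaf (rationalPresheaf X) fun {U V} i a s => by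
    refine Subtype.ext <| funext fun x => ?_
    change algebraMap _ _ (X.presheaf.germ U.unop x.1 (i.unop.le x.2) a) *
        s.1 ⟨x.1, i.unop.le x.2⟩ =
      algebraMap _ _ (X.presheaf.germ V.unop x.1 x.2 (X.presheaf.map i a)) *
        s.1 ⟨x.1, i.unop.le x.2⟩
    rw [← X.presheaf.germ_res_apply i.unop x.1 x.2 a]
    rfl
  isSheaf := by
    refine (TopCat.Presheaf.isSheaf_iff_isSheafUniqueGluing (rationalPresheaf X)).mpr ?_
    intro ι U sf hsf
    have key : ∀ (i j : ι) (x : U i) (y : U j), (sf i).1 x = (sf j).1 y := by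
      intro i j x y
      obtain ⟨z, hz, hz'⟩ := nonempty_preirreducible_inter (U i).isOpen (U j).isOpen
        ⟨x.1, x.2⟩ ⟨y.1, y.2⟩
      rw [(sf i).2 x ⟨z, hz⟩, (sf j).2 y ⟨z, hz'⟩]
      exact congrFun (congrArg Subtype.val (hsf i j)) ⟨z, hz, hz'⟩
    have hmem : ∀ x : (iSup U : X.Opens), ∃ i, x.1 ∈ U i := fun x => Opens.mem_iSup.mp x.2
    choose c hc using hmem
    refine ⟨⟨fun x => (sf (c x)).1 ⟨x.1, hc x⟩, fun x y => key _ _ _ _⟩, ?_, ?_⟩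
    · intro i
      exact Subtype.ext <| funext fun x => key _ _ _ _
    · intro t ht
      refine Subtype.ext <| funext fun x => ?_
      exact congrFun (congrArg Subtype.val (ht (c x))) ⟨x.1, hc x⟩

/-- The value in the function field of a rational function on `U`, at a point of `U`. -/
def ratValue {X : Scheme.{0}} [IsIntegral X] {U : X.Opens} (s : Γ(rationalSheaf X, U)) (x : U) :
    X.functionField :=
  (show rationalFunctions X U from s).1 x

end Divisors

/-- A (connected) smooth projective curve over `ℂ`: an integral scheme, proper over `ℂ`, whose
local rings at closed points are regular of dimension `1`, that is, discrete valuation rings. -/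
structure Curve where
  /-- the underlying scheme -/
  X : Scheme.{0}
  /-- the structure morphism -/
  str : X ⟶ Spec (CommRingCat.of ℂ)
  isIntegral : IsIntegral X
  isProper : IsProper str
  isDVR : ∀ x : X, IsClosed {x} → IsDiscreteValuationRing (X.presheaf.stalk x)

namespace Curve

variable (C : Curve)

instance : IsIntegral C.X := C.isIntegral

instance : IsProper C.str := C.isProper

instance : IsLocallyNoetherian C.X := LocallyOfFiniteType.isLocallyNoetherian C.str

/-- The group of divisors on a curve `C` is the free abelian group on its closed points. A divisor
is encoded as a finitely supported function on `C`, only the values at closed points matter. For a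
finite set `E` of points this is the divisor `∑_{p ∈ E} p`. -/
def divisorOf (E : Set C.X) : C.X →₀ ℤ := ∑ᶠ p ∈ E, Finsupp.single p 1

/-- The sections of `𝒪_C(D)` on an open subset `U`: the rational functions `s` on `U` such that
`s = 0` or `ord_x(s) + D(x) ≥ 0` for all closed points `x` of `U`. -/
def divisorSubmodule (D : C.X →₀ ℤ) : PresheafOfModules.Submodule (rationalSheaf C.X).val where
  obj U :=
    { carrier := {s | ∀ x : (unop U : C.X.Opens), IsClosed {x.1} →
        ratValue s x = 0 ∨ 0 ≤ Scheme.ord (ratValue s x) x.1 + D x.1}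
      zero_mem' := fun x _ => Or.inl rfl
      add_mem' := by
        intro s t hs ht x hx
        have := C.isDVR x.1 hx
        change ratValue s x + ratValue t x = 0 ∨
          0 ≤ Scheme.ord (ratValue s x + ratValue t x) x.1 + D x.1
        by_cases h0 : ratValue s x + ratValue t x = 0
        · exact Or.inl h0
        right
        rcases hs x hx with h1 | h1
        · rw [h1, zero_add] at h0 ⊢
          exact (ht x hx).resolve_left h0
        rcases ht x hx with h2 | h2
        · rw [h2, add_zero] at h0 ⊢
          exact h1
        have := Scheme.ord_add (x := x.1) h0
        rcases min_le_iff.mp this with h | h <;> linarith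
      smul_mem' := by
        intro (a : Γ(C.X, unop U)) (s : Γ(rationalSheaf C.X, unop U)) hs x hx
        have : Nonempty (unop U : C.X.Opens) := ⟨x⟩
        change ratValue (a • s) x = 0 ∨ 0 ≤ Scheme.ord (ratValue (a • s) x) x.1 + D x.1
        have key : ratValue (a • s) x = a • ratValue s x :=
          congrArg (· * ratValue s x)
            (Scheme.algebraMap_germ_eq_germToFunctionField C.X x.2 a)
        rw [key]
        rcases hs x hx with h1 | h1
        · left
          change ratValue s x = 0 at h1
          rw [h1, smul_zero]
        by_cases ha : a = 0
        · left
          rw [ha, zero_smul]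
        right
        have := Scheme.ord_le_smul x.2 ha (ratValue s x)
        exact h1.trans (add_le_add_left this _) }
  map f s hs x hx := hs ⟨x.1, f.unop.le x.2⟩ hx

lemma isLocalSubmodule_divisorSubmodule (D : C.X →₀ ℤ) :
    IsLocalSubmodule (C.divisorSubmodule D) := by
  intro U s hs x hx
  obtain ⟨V, i, hxV, h⟩ := hs x.1 x.2
  exact h ⟨x.1, hxV⟩ hx

/-- The sheaf `𝒪_C(D)` of a divisor `D` on a curve `C`, as a subsheaf of the sheaf of rational
functions. -/
def divisorSheaf (D : C.X →₀ ℤ) : C.X.Modules :=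
  subsheaf (rationalSheaf C.X) (C.divisorSubmodule D) (C.isLocalSubmodule_divisorSubmodule D)

/-- The section `1` of `𝒪_C(D)` on `U`, for an effective divisor `D`. -/
def oneSection (D : C.X →₀ ℤ) (hD : 0 ≤ D) (U : C.X.Opens) : Γ(C.divisorSheaf D, U) :=
  show (C.divisorSubmodule D).obj (op U) from
    ⟨show rationalFunctions C.X U from ⟨fun _ => 1, fun _ _ => rfl⟩, by
      intro x _
      right
      change 0 ≤ Scheme.ord (1 : C.X.functionField) x.1 + D x.1
      have h : Scheme.ord (1 : C.X.functionField) x.1 = 0 := by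
        have : Nonempty U := ⟨x⟩
        have := Scheme.ord_of_isUnit (X := C.X) (f := (1 : Γ(C.X, U))) isUnit_one x.2
        simpa using this
      rw [h, zero_add]
      exact hD x.1⟩

lemma divisorOf_nonneg (E : Set C.X) : 0 ≤ C.divisorOf E := by
  unfold divisorOf
  refine finsum_induction (fun D : C.X →₀ ℤ => 0 ≤ D) le_rfl (fun _ _ => add_nonneg) fun p => ?_
  refine finsum_induction (fun D : C.X →₀ ℤ => 0 ≤ D) le_rfl (fun _ _ => add_nonneg) fun _ => ?_
  exact Finsupp.single_nonneg.mpr zero_le_one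

/-- The ring homomorphism `ℂ → Γ(C, 𝒪_C)`. -/
def scalars : CommRingCat.of ℂ ⟶ Γ(C.X, ⊤) :=
  (Scheme.ΓSpecIso (CommRingCat.of ℂ)).inv ≫ C.str.appTop

/-- The space of global sections `H⁰(C, M)`. -/
def H0 (M : C.X.Modules) : Type := Γ(M, ⊤)

instance (M : C.X.Modules) : AddCommGroup (C.H0 M) := inferInstanceAs (AddCommGroup Γ(M, ⊤))

instance (M : C.X.Modules) : Module Γ(C.X, ⊤) (C.H0 M) := inferInstanceAs (Module _ Γ(M, ⊤))

instance (M : C.X.Modules) : Module ℂ (C.H0 M) := Module.compHom _ C.scalars.hom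

/-- The map `H⁰(C, M) → H⁰(C, N)` defined by a morphism `M ⟶ N`. -/
def H0map {C : Curve} {M N : C.X.Modules} (f : M ⟶ N) (s : C.H0 M) : C.H0 N := f.app ⊤ s

/-- The restriction to an open subset `U` of a global section of `M`. -/
def H0.res {C : Curve} {M : C.X.Modules} (s : C.H0 M) (U : C.X.Opens) : Γ(M, U) :=
  M.presheaf.map (homOfLE le_top : U ⟶ ⊤).op s

end Curve

/-! ### Involutions, quotients, and the sheaf of anti-invariant functions -/

section Involution

variable {C B : Curve}

/-- `π : C ⟶ B` is the quotient of `C` by the involution `σ`: it is `σ`-invariant, it is a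
topological quotient map, its fibres are the orbits `{x, σ x}`, and for `U` open in `B` the
functions on `U` are the `σ`-invariant functions on `π⁻¹(U)`. -/
structure IsQuotient (σ : C.X ⟶ C.X) (π : C.X ⟶ B.X) : Prop where
  invariant : σ ≫ π = π
  isQuotientMap : Topology.IsQuotientMap π
  fibre : ∀ x y : C.X, π x = π y → y = x ∨ y = σ x
  app_injective : ∀ U : B.X.Opens, Function.Injective (π.app U)
  app_range : ∀ (U : B.X.Opens) (h : π ⁻¹ᵁ U ≤ σ ⁻¹ᵁ (π ⁻¹ᵁ U)) (a : Γ(C.X, π ⁻¹ᵁ U)),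
    σ.appLE _ _ h a = a → ∃ b : Γ(B.X, U), π.app U b = a

/-- The set of closed points of `C` fixed by `σ`. -/
def fixedLocus (σ : C.X ⟶ C.X) : Set C.X := {x | IsClosed {x} ∧ σ x = x}

lemma preimage_le {σ : C.X ⟶ C.X} {π : C.X ⟶ B.X} (h : σ ≫ π = π) (U : B.X.Opens) :
    π ⁻¹ᵁ U ≤ σ ⁻¹ᵁ (π ⁻¹ᵁ U) := by
  rw [← Scheme.Hom.comp_preimage, h]

/-- The submodule of `π_* 𝒪_C` whose sections on `U` are the functions `a` on `π⁻¹(U)` such that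
`σ^* a = -a`. -/
def antiInvariantSubmodule (σ : C.X ⟶ C.X) (π : C.X ⟶ B.X) (h : σ ≫ π = π) :
    PresheafOfModules.Submodule ((Scheme.Modules.pushforward π).obj (structureSheaf C.X)).val where
  obj U :=
    { carrier := {a : Γ(C.X, π ⁻¹ᵁ (unop U)) | σ.appLE _ _ (preimage_le h (unop U)) a = -a}
      zero_mem' := by
        change σ.appLE _ _ (preimage_le h (unop U)) 0 = -0
        simp
      add_mem' := by
        intro (a : Γ(C.X, π ⁻¹ᵁ (unop U))) (b : Γ(C.X, π ⁻¹ᵁ (unop U)))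
          (ha : σ.appLE _ _ (preimage_le h (unop U)) a = -a)
          (hb : σ.appLE _ _ (preimage_le h (unop U)) b = -b)
        change σ.appLE _ _ (preimage_le h (unop U)) (a + b) = -(a + b)
        rw [map_add, ha, hb, neg_add]
      smul_mem' := by
        intro (r : Γ(B.X, unop U)) (a : Γ(C.X, π ⁻¹ᵁ (unop U)))
          (ha : σ.appLE _ _ (preimage_le h (unop U)) a = -a)
        change σ.appLE _ _ (preimage_le h (unop U)) (π.app (unop U) r * a) =
          -(π.app (unop U) r * a)
        have hr : σ.appLE _ _ (preimage_le h (unop U)) (π.app (unop U) r) =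
            π.app (unop U) r := by
          rw [← CommRingCat.comp_apply, ← Scheme.Hom.appLE_eq_app,
            Scheme.Hom.appLE_comp_appLE]
          simp only [h]
        rw [map_mul, hr, ha, mul_neg] }
  map := by
    intro U V i (a : Γ(C.X, π ⁻¹ᵁ (unop U)))
      (ha : σ.appLE _ _ (preimage_le h (unop U)) a = -a)
    have hle : π ⁻¹ᵁ (unop V) ≤ π ⁻¹ᵁ (unop U) := π.preimage_mono i.unop.le
    change σ.appLE _ _ (preimage_le h (unop V)) (C.X.presheaf.map (homOfLE hle).op a) =
      -(C.X.presheaf.map (homOfLE hle).op a)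
    rw [← map_neg, ← ha, ← CommRingCat.comp_apply, ← CommRingCat.comp_apply,
      Scheme.Hom.appLE_map, Scheme.Hom.map_appLE]

lemma isLocalSubmodule_antiInvariantSubmodule (σ : C.X ⟶ C.X) (π : C.X ⟶ B.X)
    (h : σ ≫ π = π) : IsLocalSubmodule (antiInvariantSubmodule σ π h) := by
  intro U (a : Γ(C.X, π ⁻¹ᵁ U)) ha
  change σ.appLE _ _ (preimage_le h U) a = -a
  refine TopCat.Presheaf.section_ext C.X.sheaf (π ⁻¹ᵁ U) _ _ fun x hx => ?_
  obtain ⟨V, i, hxV, hV⟩ := ha (π x) hx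
  have hle : π ⁻¹ᵁ V ≤ π ⁻¹ᵁ U := π.preimage_mono i.le
  change σ.appLE _ _ (preimage_le h V) (C.X.presheaf.map (homOfLE hle).op a) =
      -(C.X.presheaf.map (homOfLE hle).op a) at hV
  have hx' : x ∈ π ⁻¹ᵁ V := hxV
  change C.X.presheaf.germ _ x hx _ = C.X.presheaf.germ _ x hx _
  rw [← C.X.presheaf.germ_res_apply (homOfLE hle) x hx',
    ← C.X.presheaf.germ_res_apply (homOfLE hle) x hx']
  congr 1
  rw [map_neg, ← hV, ← CommRingCat.comp_apply, ← CommRingCat.comp_apply,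
    Scheme.Hom.appLE_map, Scheme.Hom.map_appLE]

/-- The sheaf `ρ⁻¹` on `B`: the subsheaf of `π_* 𝒪_C` of functions `a` such that `σ^* a = -a`, so
that `π_* 𝒪_C = 𝒪_B ⊕ ρ⁻¹` when `π` is the quotient map. -/
def rhoInv (σ : C.X ⟶ C.X) (π : C.X ⟶ B.X) (h : σ ≫ π = π) : B.X.Modules :=
  subsheaf ((Scheme.Modules.pushforward π).obj (structureSheaf C.X))
    (antiInvariantSubmodule σ π h) (isLocalSubmodule_antiInvariantSubmodule σ π h)

/-- A section of `ρ⁻¹` on `U`, as a function on `π⁻¹(U)`. -/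
def rhoInvFun {σ : C.X ⟶ C.X} {π : C.X ⟶ B.X} {h : σ ≫ π = π} {U : B.X.Opens}
    (a : Γ(rhoInv σ π h, U)) : Γ(C.X, π ⁻¹ᵁ U) :=
  (show (antiInvariantSubmodule σ π h).obj (op U) from a).1

/-- The section `π^* s` of `π^* L` on `π⁻¹(U)` defined by a section `s` of `L` on `U`. -/
def pullbackSection (π : C.X ⟶ B.X) {L : B.X.Modules} {U : B.X.Opens} (s : Γ(L, U)) :
    Γ((Scheme.Modules.pullback π).obj L, π ⁻¹ᵁ U) :=
  ((Scheme.Modules.pullbackPushforwardAdjunction π).unit.app L).app U s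

/-- The direct image `π_* D` of a divisor `D` on `C`. -/
def pushDivisor (π : C.X ⟶ B.X) (D : C.X →₀ ℤ) : B.X →₀ ℤ := Finsupp.mapDomain π D

lemma pushDivisor_nonneg (π : C.X ⟶ B.X) (D : C.X →₀ ℤ) (hD : 0 ≤ D) :
    0 ≤ pushDivisor π D := by
  unfold pushDivisor Finsupp.mapDomain
  exact Finset.sum_nonneg fun p _ => Finsupp.single_nonneg.mpr (hD p)

/-- The sheaf `π^* L (E) = π^* L ⊗ 𝒪_C(E)`, for a finite set `E` of closed points of `C`. -/
def pullbackTwist (π : C.X ⟶ B.X) (L : B.X.Modules) (E : Set C.X) : C.X.Modules :=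
  tensor ((Scheme.Modules.pullback π).obj L) (C.divisorSheaf (C.divisorOf E))

/-- The sheaf `L ⊗ ρ⁻¹(π_* E) = L ⊗ (ρ⁻¹ ⊗ 𝒪_B(π_* E))`, for a finite set `E` of closed points
of `C`. -/
def rhoTwist (σ : C.X ⟶ C.X) (π : C.X ⟶ B.X) (h : σ ≫ π = π) (L : B.X.Modules) (E : Set C.X) :
    B.X.Modules :=
  tensor L (tensor (rhoInv σ π h) (B.divisorSheaf (pushDivisor π (C.divisorOf E))))

end Involution

end CurveInvolution

end

open CurveInvolution

/-! Everything is translated into divisors and rational functions. On a curve every line bundle is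
some 𝒪(D) (`exists_iso_divisorSheaf`), and 𝒪(D) ≅ 𝒪(D') exactly when D - D' is the divisor of a
rational function (`exists_iso_of_ord`, `exists_ord_of_iso`). Tensor products become sums
(`isIso_divisorMul`) and inverse images become inverse images of divisors (`isIso_divisorPullback`).

Let s be the involution of K(C), p : K(B) → K(C) the inclusion and a₀ ≠ 0 an anti-invariant
function. The invariants of s are p(K(B)), so K(C) = K(B) ⊕ a₀K(B). At a ramification point there is
an anti-invariant uniformizer; hence invariant functions have even order, anti-invariant ones odd
order, and the ramification index is 2. At all other closed points it is 1. So div a₀ - R = π^*D₀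
for a divisor D₀ on B, and a ↦ a / a₀ identifies ρ⁻¹ with 𝒪(D₀) (`rhoHom`). Then ρ⁻¹(π_*E) is 𝒪(D₁)
with D₁ = D₀ + π_*E and π^*D₁ = div a₀ - R + 2E, which gives the converse in a).

Existence in a): if M = 𝒪(F), then σ^*F - F = div g with g · s(g) constant. After rescaling, Hilbert
90 gives f with div g = div f - σ^*(div f), so F + div f is σ-invariant, hence of the form π^*D + E
with E the ramification points of odd multiplicity (`exists_iso_pullbackTwist`). Uniqueness: an
isomorphism of two twists is a function g with σ-invariant divisor, so s(g) = ±g (`s_eq_or_eq_neg`);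
the two signs are the two cases (`iso_or_iso`).

Part b) is the splitting of f into (f + s f)/2 and (f - s f)/2. Comparing orders at the ramification
points, where 2n + 1 ≥ 0 means n ≥ 0, shows that p(b) has poles bounded by π^*D + E iff b has poles
bounded by D, and a₀p(b) iff b has poles bounded by D + D₁ (`p_mem_iff`, `a₀_mul_p_mem_iff`). The
isomorphism is the inverse of a map defined without choosing D, which makes it natural. -/

noncomputable section

namespace CurveInvolution

/-! ### Sections and morphisms of sheaves of modules -/

section ModuleLemmas

variable {X : Scheme.{0}}

/-- Restriction of sections of a sheaf of modules. -/
def res {M : X.Modules} {U V : X.Opens} (h : V ≤ U) : Γ(M, U) →+ Γ(M, V) :=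
  (M.presheaf.map (homOfLE h).op).hom

/-- Restriction of functions. -/
def resO {U V : X.Opens} (h : V ≤ U) : Γ(X, U) →+* Γ(X, V) :=
  (X.presheaf.map (homOfLE h).op).hom

lemma res_smul {M : X.Modules} {U V : X.Opens} (h : V ≤ U) (a : Γ(X, U)) (s : Γ(M, U)) :
    res h (a • s) = resO h a • res h s :=
  Scheme.Modules.map_smul M (homOfLE h) a s

@[simp]
lemma res_res {M : X.Modules} {U V W : X.Opens} (h : V ≤ U) (h' : W ≤ V) (s : Γ(M, U)) :
    res h' (res h s) = res (h'.trans h) s := by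
  change M.presheaf.map _ (M.presheaf.map _ s) = M.presheaf.map _ s
  rw [← ConcreteCategory.comp_apply, ← Functor.map_comp]
  rfl

lemma app_res {M N : X.Modules} (f : M ⟶ N) {U V : X.Opens} (h : V ≤ U) (s : Γ(M, U)) :
    f.app V (res h s) = res h (f.app U s) :=
  congr($(f.mapPresheaf.naturality (homOfLE h).op) s)

/-- Sections which agree locally are equal. -/
lemma section_ext {M : X.Modules} {U : X.Opens} {s t : Γ(M, U)}
    (h : ∀ x ∈ U, ∃ (V : X.Opens) (i : V ≤ U), x ∈ V ∧ res i s = res i t) : s = t := by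
  choose V i hV e using h
  refine TopCat.Sheaf.eq_of_locally_eq' (⟨M.presheaf, M.isSheaf⟩ : TopCat.Sheaf Ab X)
    (fun x : U => V x.1 x.2) U (fun x => homOfLE (i x.1 x.2)) ?_ s t fun x => e x.1 x.2
  intro x hx
  exact Opens.mem_iSup.mpr ⟨⟨x, hx⟩, hV x hx⟩

/-- Compatible sections on the members of a covering can be glued. -/
lemma exists_glue {M : X.Modules} {ι : Type} {U : X.Opens} (V : ι → X.Opens)
    (hV : ∀ i, V i ≤ U) (hc : ∀ x ∈ U, ∃ i, x ∈ V i) (s : ∀ i, Γ(M, V i))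
    (h : ∀ i j (W : X.Opens) (hi : W ≤ V i) (hj : W ≤ V j), res hi (s i) = res hj (s j)) :
    ∃ t : Γ(M, U), ∀ i, res (hV i) t = s i := by
  obtain ⟨t, ht, -⟩ := TopCat.Sheaf.existsUnique_gluing' (⟨M.presheaf, M.isSheaf⟩ : TopCat.Sheaf Ab X)
    V U (fun x => homOfLE (hV x)) (fun x hx => Opens.mem_iSup.mpr (hc x hx)) s
    (fun i j => h i j _ inf_le_left inf_le_right)
  exact ⟨t, ht⟩

/-- A morphism of sheaves of modules, given by a compatible family of linear maps. -/
def homMk {M N : X.Modules} (φ : ∀ U : X.Opens, Γ(M, U) →ₗ[Γ(X, U)] Γ(N, U))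
    (h : ∀ (U V : X.Opens) (i : V ≤ U) (s : Γ(M, U)), φ V (res i s) = res i (φ U s)) : M ⟶ N :=
  SheafOfModules.Hom.mk (PresheafOfModules.homMk
    { app := fun U => AddCommGrpCat.ofHom (φ U.unop).toAddMonoidHom
      naturality := fun U V i => by
        ext s
        exact h U.unop V.unop i.unop.le s }
    fun U a s => (φ U.unop).map_smul a s)

lemma Modules.hom_ext {M N : X.Modules} {f g : M ⟶ N}
    (h : ∀ (U : X.Opens) (s : Γ(M, U)), f.app U s = g.app U s) : f = g :=
  Scheme.Modules.hom_ext f g fun U => by ext s; exact h U s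

lemma app_add {M N : X.Modules} (f : M ⟶ N) {U : X.Opens} (s t : Γ(M, U)) :
    f.app U (s + t) = f.app U s + f.app U t := map_add _ _ _

/-- A sheaf morphism which is bijective on sections is an isomorphism. -/
lemma isIso_of_bijective {M N : X.Modules} (f : M ⟶ N)
    (h : ∀ U : X.Opens, Function.Bijective (f.app U)) : IsIso f := by
  rw [Scheme.Modules.Hom.isIso_iff_isIso_app]
  intro U
  exact (ConcreteCategory.isIso_iff_bijective (f.app U)).mpr (h U)

lemma app_bijective_of_isIso {M N : X.Modules} (f : M ⟶ N) [IsIso f] (U : X.Opens) :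
    Function.Bijective (f.app U) :=
  (ConcreteCategory.isIso_iff_bijective (f.app U)).mp inferInstance

/-! ### Tensor products -/

/-- The map from the tensor product of the modules of sections to the sections of the tensor
product of sheaves. -/
def tensorUnit (L N : X.Modules) (U : X.Opens) :
    TensorProduct Γ(X, U) Γ(L, U) Γ(N, U) →ₗ[Γ(X, U)] Γ(tensor L N, U) :=
  (((PresheafOfModules.sheafificationAdjunction (𝟙 X.ringCatSheaf.obj)).unit.app
    (presheafTensor L N)).app (op U)).hom

lemma tensorUnit_tmul {L N : X.Modules} {U : X.Opens} (s : Γ(L, U)) (t : Γ(N, U)) :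
    tensorUnit L N U (TensorProduct.tmul _ s t) = tmul s t := rfl

lemma tmul_add {L N : X.Modules} {U : X.Opens} (s : Γ(L, U)) (t t' : Γ(N, U)) :
    tmul s (t + t') = tmul s t + tmul s t' := by
  simp only [← tensorUnit_tmul, TensorProduct.tmul_add, map_add]

lemma add_tmul {L N : X.Modules} {U : X.Opens} (s s' : Γ(L, U)) (t : Γ(N, U)) :
    tmul (s + s') t = tmul s t + tmul s' t := by
  simp only [← tensorUnit_tmul, TensorProduct.add_tmul, map_add]

lemma smul_tmul {L N : X.Modules} {U : X.Opens} (a : Γ(X, U)) (s : Γ(L, U)) (t : Γ(N, U)) :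
    tmul (a • s) t = a • tmul s t := by
  simp only [← tensorUnit_tmul, ← map_smul, TensorProduct.smul_tmul']

lemma tmul_smul {L N : X.Modules} {U : X.Opens} (a : Γ(X, U)) (s : Γ(L, U)) (t : Γ(N, U)) :
    tmul s (a • t) = a • tmul s t := by
  simp only [← tensorUnit_tmul, ← map_smul, TensorProduct.tmul_smul]

lemma res_tmul {L N : X.Modules} {U V : X.Opens} (h : V ≤ U) (s : Γ(L, U)) (t : Γ(N, U)) :
    res h (tmul s t) = tmul (res h s) (res h t) :=
  (PresheafOfModules.naturality_apply
    ((PresheafOfModules.sheafificationAdjunction (𝟙 X.ringCatSheaf.obj)).unit.app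
    (presheafTensor L N)) (homOfLE h).op
    (show (presheafTensor L N).obj (op U) from
      (TensorProduct.tmul Γ(X, U) s t : TensorProduct Γ(X, U) Γ(L, U) Γ(N, U)))).symm

lemma tensorMap_tmul {L L' N : X.Modules} (f : L ⟶ L') {U : X.Opens} (s : Γ(L, U)) (t : Γ(N, U)) :
    (tensorMap f N).app U (tmul s t) = tmul (f.app U s) t := by
  have := (PresheafOfModules.sheafificationAdjunction (𝟙 X.ringCatSheaf.obj)).unit.naturality
    (MonoidalCategory.whiskerRight
      (C := PresheafOfModules.{0} (X.presheaf ⋙ forget₂ CommRingCat RingCat)) f.val N.val :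
      presheafTensor L N ⟶ presheafTensor L' N)
  have h2 := congr(($this).app (op U) (show (presheafTensor L N).obj (op U) from
      (TensorProduct.tmul Γ(X, U) s t : TensorProduct Γ(X, U) Γ(L, U) Γ(N, U))))
  exact h2.symm

/-- Two morphisms from `L ⊗ N` which agree on the sections `s ⊗ t` are equal. -/
lemma tensor_hom_ext {L N P : X.Modules} {f g : tensor L N ⟶ P}
    (h : ∀ (U : X.Opens) (s : Γ(L, U)) (t : Γ(N, U)),
      f.app U (tmul s t) = g.app U (tmul s t)) : f = g := by
  apply ((PresheafOfModules.sheafificationAdjunction (𝟙 X.ringCatSheaf.obj)).homEquiv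
    (presheafTensor L N) P).injective
  ext U w
  change TensorProduct Γ(X, U.unop) Γ(L, U.unop) Γ(N, U.unop) at w
  induction w using TensorProduct.induction_on with
  | zero => exact (map_zero _).trans (map_zero _).symm
  | tmul s t => exact h U.unop s t
  | add w w' hw hw' => exact (map_add _ _ _).trans ((congr($hw + $hw')).trans (map_add _ _ _).symm)

/-- The morphism `L ⊗ N ⟶ P` defined by a compatible family of bilinear maps. -/
def tensorLift {L N P : X.Modules}
    (β : ∀ U : X.Opens, Γ(L, U) →ₗ[Γ(X, U)] Γ(N, U) →ₗ[Γ(X, U)] Γ(P, U))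
    (h : ∀ (U V : X.Opens) (i : V ≤ U) (s : Γ(L, U)) (t : Γ(N, U)),
      β V (res i s) (res i t) = res i (β U s t)) : tensor L N ⟶ P :=
  ((PresheafOfModules.sheafificationAdjunction (𝟙 X.ringCatSheaf.obj)).homEquiv
    (presheafTensor L N) P).symm
    (PresheafOfModules.homMk
      { app := fun U => AddCommGrpCat.ofHom (TensorProduct.lift (β U.unop)).toAddMonoidHom
        naturality := fun U V i => by
          ext w
          change TensorProduct Γ(X, U.unop) Γ(L, U.unop) Γ(N, U.unop) at w
          induction w using TensorProduct.induction_on with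
          | zero => exact (map_zero _).trans (map_zero _).symm
          | tmul s t => exact h U.unop V.unop i.unop.le s t
          | add w w' hw hw' =>
            exact (map_add _ _ _).trans ((congr($hw + $hw')).trans (map_add _ _ _).symm) }
      fun U a s => (TensorProduct.lift (β U.unop)).map_smul a s)

lemma tensorLift_tmul {L N P : X.Modules}
    (β : ∀ U : X.Opens, Γ(L, U) →ₗ[Γ(X, U)] Γ(N, U) →ₗ[Γ(X, U)] Γ(P, U)) (h)
    (U : X.Opens) (s : Γ(L, U)) (t : Γ(N, U)) :
    (tensorLift β h).app U (tmul s t) = β U s t := by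
  have := ((PresheafOfModules.sheafificationAdjunction (𝟙 X.ringCatSheaf.obj)).homEquiv
    (presheafTensor L N) P).apply_symm_apply (PresheafOfModules.homMk
      { app := fun U => AddCommGrpCat.ofHom (TensorProduct.lift (β U.unop)).toAddMonoidHom
        naturality := fun U V i => by
          ext w
          change TensorProduct Γ(X, U.unop) Γ(L, U.unop) Γ(N, U.unop) at w
          induction w using TensorProduct.induction_on with
          | zero => exact (map_zero _).trans (map_zero _).symm
          | tmul s t => exact h U.unop V.unop i.unop.le s t
          | add w w' hw hw' =>
            exact (map_add _ _ _).trans ((congr($hw + $hw')).trans (map_add _ _ _).symm) }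
      fun U a s => (TensorProduct.lift (β U.unop)).map_smul a s)
  have h2 := congr(($this).app (op U) (show (presheafTensor L N).obj (op U) from
      (TensorProduct.tmul Γ(X, U) s t : TensorProduct Γ(X, U) Γ(L, U) Γ(N, U))))
  exact h2

end ModuleLemmas

/-! ### Local generators and line bundles -/

section Generators

variable {X : Scheme.{0}}

/-- A section of `L` over `U` is a generator if it trivialises `L` over `U`. -/
def IsGenerator {L : X.Modules} {U : X.Opens} (g : Γ(L, U)) : Prop :=
  ∀ (V : X.Opens) (h : V ≤ U), Function.Bijective fun a : Γ(X, V) => a • res h g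

lemma IsGenerator.res {L : X.Modules} {U V : X.Opens} {g : Γ(L, U)} (hg : IsGenerator g)
    (h : V ≤ U) : IsGenerator (CurveInvolution.res h g) := by
  intro W hW
  simpa using hg W (hW.trans h)

lemma IsGenerator.exists_smul {L : X.Modules} {U V : X.Opens} {g : Γ(L, U)} (hg : IsGenerator g)
    (h : V ≤ U) (s : Γ(L, V)) : ∃ a : Γ(X, V), a • CurveInvolution.res h g = s :=
  (hg V h).2 s

lemma IsGenerator.map {L L' : X.Modules} (f : L ⟶ L') [IsIso f] {U : X.Opens} {g : Γ(L, U)}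
    (hg : IsGenerator g) : IsGenerator (f.app U g) := by
  intro V h
  have : (fun a : Γ(X, V) => a • CurveInvolution.res h (f.app U g)) =
      f.app V ∘ fun a : Γ(X, V) => a • CurveInvolution.res h g := by
    ext a
    simp only [Function.comp_apply, Scheme.Modules.Hom.app_smul, app_res]
  rw [this]
  exact (app_bijective_of_isIso f V).comp (hg V h)

lemma hom_ext_of_generators {F G : X.Modules} {φ ψ : F ⟶ G}
    (h : ∀ x : X, ∃ (U : X.Opens) (g : Γ(F, U)), x ∈ U ∧ IsGenerator g ∧
      φ.app U g = ψ.app U g) : φ = ψ := by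
  refine Modules.hom_ext fun V s => section_ext fun x hx => ?_
  obtain ⟨U, g, hxU, hg, e⟩ := h x
  refine ⟨V ⊓ U, inf_le_left, ⟨hx, hxU⟩, ?_⟩
  obtain ⟨a, ha⟩ := hg.exists_smul (inf_le_right : V ⊓ U ≤ U) (res inf_le_left s)
  rw [← app_res, ← app_res, ← ha, Scheme.Modules.Hom.app_smul, Scheme.Modules.Hom.app_smul, app_res,
    app_res, e]

/-- A morphism from a line bundle may be prescribed on generators. -/
lemma exists_hom_of_generators {F G : X.Modules} {ι : Type} (U : ι → X.Opens)
    (hc : ∀ x, ∃ i, x ∈ U i) (g : ∀ i, Γ(F, U i)) (hg : ∀ i, IsGenerator (g i))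
    (γ : ∀ i, Γ(G, U i))
    (compat : ∀ i j (W : X.Opens) (hi : W ≤ U i) (hj : W ≤ U j) (a : Γ(X, W)),
      a • res hi (g i) = res hj (g j) → a • res hi (γ i) = res hj (γ j)) :
    ∃ φ : F ⟶ G, ∀ i, φ.app _ (g i) = γ i := by
  -- The image t of s is characterised rather than constructed: every local expression s = a g_i
  -- must give t = a γ_i. Once t is known to exist and to be unique, additivity, linearity and
  -- compatibility with restriction all follow from uniqueness.
  let Rel (V : X.Opens) (s : Γ(F, V)) (t : Γ(G, V)) : Prop :=
    ∀ (i : ι) (W : X.Opens) (hV : W ≤ V) (hi : W ≤ U i) (a : Γ(X, W)),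
      a • res hi (g i) = res hV s → a • res hi (γ i) = res hV t
  have uniq (V : X.Opens) (s : Γ(F, V)) (t t' : Γ(G, V)) (h : Rel V s t) (h' : Rel V s t') :
      t = t' := by
    refine section_ext fun x hx => ?_
    obtain ⟨i, hi⟩ := hc x
    refine ⟨V ⊓ U i, inf_le_left, ⟨hx, hi⟩, ?_⟩
    obtain ⟨a, ha⟩ := (hg i).exists_smul (inf_le_right : V ⊓ U i ≤ U i) (res inf_le_left s)
    rw [← h i _ _ _ a ha, ← h' i _ _ _ a ha]
  have ex (V : X.Opens) (s : Γ(F, V)) : ∃ t, Rel V s t := by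
    choose a ha using fun i => (hg i).exists_smul (inf_le_right : V ⊓ U i ≤ U i)
      (res inf_le_left s)
    have key (i : ι) (W : X.Opens) (hV : W ≤ V) (hi : W ≤ U i) (b : Γ(X, W))
        (hb : b • res hi (g i) = res hV s) : b = resO (le_inf hV hi) (a i) := by
      apply (hg i W hi).1
      have := congrArg (res (le_inf hV hi)) (ha i)
      simp only [res_smul, res_res] at this
      exact hb.trans this.symm
    obtain ⟨t, ht⟩ := exists_glue (M := G) (fun i => V ⊓ U i) (fun i => inf_le_left)
      (fun x hx => (hc x).imp fun i hi => ⟨hx, hi⟩) (fun i => a i • res inf_le_right (γ i)) (by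
        intro i j W hi hj
        simp only [res_smul, res_res]
        have hi' := hi.trans inf_le_right
        have hj' := hj.trans inf_le_right
        -- With g_j = u g_i, the hypothesis `compat` gives γ_j = u γ_i, and it remains to see that
        -- a_i = a_j u, which holds because both are the coefficient of s with respect to g_i.
        obtain ⟨u, hu⟩ := (hg i).exists_smul hi' (res hj' (g j))
        rw [← compat i j W hi' hj' u hu, smul_smul]
        congr 1
        symm
        apply key i W (hi.trans inf_le_left) hi'
        rw [mul_smul, hu]
        have := congrArg (res hj) (ha j)
        simpa only [res_smul, res_res] using this)
    refine ⟨t, fun i W hV hi b hb => ?_⟩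
    have := congrArg (res (le_inf hV hi)) (ht i)
    simp only [res_smul, res_res] at this
    rw [this, key i W hV hi b hb]
  choose φ hφ using ex
  have hadd (V : X.Opens) (s s' : Γ(F, V)) : φ V (s + s') = φ V s + φ V s' := by
    refine uniq V _ _ _ (hφ _ _) fun i W hV hi a ha => ?_
    obtain ⟨b, hb⟩ := (hg i).exists_smul hi (res hV s)
    obtain ⟨b', hb'⟩ := (hg i).exists_smul hi (res hV s')
    have : a = b + b' := (hg i W hi).1 (by
      beta_reduce
      rw [ha, add_smul, hb, hb', map_add])
    rw [map_add, ← hφ V s i W hV hi b hb, ← hφ V s' i W hV hi b' hb', this, add_smul]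
  have hsmul (V : X.Opens) (r : Γ(X, V)) (s : Γ(F, V)) : φ V (r • s) = r • φ V s := by
    refine uniq V _ _ _ (hφ _ _) fun i W hV hi a ha => ?_
    obtain ⟨b, hb⟩ := (hg i).exists_smul hi (res hV s)
    have : a = resO hV r * b := (hg i W hi).1 (by
      beta_reduce
      rw [ha, mul_smul, hb, res_smul])
    rw [res_smul, ← hφ V s i W hV hi b hb, this, mul_smul]
  refine ⟨homMk (fun V => { toFun := φ V, map_add' := hadd V, map_smul' := hsmul V }) ?_, ?_⟩
  · intro V V' h s
    refine uniq V' _ _ _ (hφ _ _) fun i W hV hi a ha => ?_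
    change _ = res hV (res h (φ V s))
    rw [res_res] at ha ⊢
    exact hφ V s i W _ hi a ha
  · intro i
    change φ (U i) (g i) = γ i
    refine uniq _ _ _ _ (hφ _ _) fun j W hi hj a ha => compat j i W hj hi a ha

/-- A morphism which maps generators to generators is an isomorphism. -/
lemma isIso_of_isGenerator {F G : X.Modules} (φ : F ⟶ G)
    (h : ∀ x : X, ∃ (U : X.Opens) (g : Γ(F, U)), x ∈ U ∧ IsGenerator g ∧
      IsGenerator (φ.app U g)) : IsIso φ := by
  choose U g hU hg hg' using h
  -- The inverse sends each generator φ(g_x) back to g_x. This is consistent because φ preserves the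
  -- transition functions.
  obtain ⟨ψ, hψ⟩ := exists_hom_of_generators U (fun x => ⟨x, hU x⟩) (fun x => φ.app _ (g x)) hg' g
    (by
      intro x y W hx hy a ha
      obtain ⟨b, hb⟩ := (hg x).exists_smul hx (res hy (g y))
      have : a = b := (hg' x W hx).1 (by
        beta_reduce
        rw [ha, ← app_res, ← hb, Scheme.Modules.Hom.app_smul, app_res])
      rw [this, hb])
  refine ⟨ψ, hom_ext_of_generators fun x => ⟨U x, g x, hU x, hg x, ?_⟩,
    hom_ext_of_generators fun x => ⟨U x, φ.app _ (g x), hU x, hg' x, ?_⟩⟩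
  · exact hψ x
  · exact congrArg (φ.app (U x)) (hψ x)

lemma IsLineBundle.exists_generator {L : X.Modules} (hL : IsLineBundle L) (x : X) :
    ∃ (U : X.Opens) (g : Γ(L, U)), x ∈ U ∧ IsGenerator g := by
  obtain ⟨U, hxU, ⟨e⟩⟩ := hL x
  let one : Γ(structureSheaf U.toScheme, ⊤) := (1 : Γ(U.toScheme, ⊤))
  have hx : x ∈ U.ι ''ᵁ ⊤ := by simpa using hxU
  refine ⟨U.ι ''ᵁ ⊤, (e.inv.app ⊤ one : Γ(L.restrict U.ι, ⊤)), hx, ?_⟩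
  intro V hV
  obtain ⟨V', rfl⟩ : ∃ V' : U.toScheme.Opens, U.ι ''ᵁ V' = V :=
    ⟨U.ι ⁻¹ᵁ V, by
      rw [Scheme.Hom.image_preimage_eq_opensRange_inf]
      exact inf_eq_right.mpr (hV.trans (by simp))⟩
  -- The generator is the image of 1 under the trivialisation. Functions act on the restricted sheaf
  -- through `U.ι.appIso`, so multiplying the generator is a composite of two bijections.
  have key (a : Γ(X, U.ι ''ᵁ V')) : a • res hV (e.inv.app ⊤ one : Γ(L.restrict U.ι, ⊤)) =
      e.inv.app V' (show Γ(structureSheaf U.toScheme, V') from (U.ι.appIso V').hom a) := by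
    have h1 : (show Γ(structureSheaf U.toScheme, V') from (U.ι.appIso V').hom a) =
        ((U.ι.appIso V').hom a) • res (le_top : V' ≤ ⊤) one := by
      have : res (le_top : V' ≤ ⊤) one = (1 : Γ(U.toScheme, V')) :=
        map_one (U.toScheme.presheaf.map (homOfLE (le_top : V' ≤ ⊤)).op).hom
      rw [this]
      exact (mul_one (M := Γ(U.toScheme, V')) _).symm
    rw [h1, Scheme.Modules.Hom.app_smul, app_res]
    have h2 : a = (U.ι.appIso V').inv ((U.ι.appIso V').hom a) :=
      congr($((U.ι.appIso V').hom_inv_id) a).symm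
    conv_lhs => rw [h2]
    rfl
  simp only [key]
  exact (app_bijective_of_isIso e.inv V').comp
    ((ConcreteCategory.isIso_iff_bijective (U.ι.appIso V').hom).mp inferInstance)

/-- Multiplication by a generator is the required local trivialisation. -/
lemma isLineBundle_of_generators {L : X.Modules}
    (h : ∀ x : X, ∃ (U : X.Opens) (g : Γ(L, U)), x ∈ U ∧ IsGenerator g) : IsLineBundle L := by
  intro x
  obtain ⟨U, g, hxU, hg⟩ := h x
  refine ⟨U, hxU, ⟨Iso.symm ?_⟩⟩
  have hle (V : U.toScheme.Opens) : U.ι ''ᵁ V ≤ U :=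
    (U.ι.image_mono le_top).trans (by simp)
  let φ : structureSheaf U.toScheme ⟶ L.restrict U.ι := homMk
    (fun V =>
      { toFun := fun a => show Γ(L, U.ι ''ᵁ V) from
          ((U.ι.appIso V).inv (show Γ(U.toScheme, V) from a)) • res (hle V) g
        map_add' := fun a b => by
          refine Eq.trans ?_ (add_smul (R := Γ(X, U.ι ''ᵁ V)) (M := Γ(L, U.ι ''ᵁ V)) _ _ _)
          exact congrArg (fun c => c • res (hle V) g) (map_add (U.ι.appIso V).inv.hom _ _)
        map_smul' := fun a b => by
          refine Eq.trans ?_ (mul_smul (α := Γ(X, U.ι ''ᵁ V)) (β := Γ(L, U.ι ''ᵁ V)) _ _ _)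
          exact congrArg (fun c => c • res (hle V) g) (map_mul (U.ι.appIso V).inv.hom _ _) })
    (fun V W i s => by
      change ((U.ι.appIso W).inv (resO i s)) • res (hle W) g =
        res (U.ι.image_mono i) (((U.ι.appIso V).inv (show Γ(U.toScheme, V) from s)) • res (hle V) g)
      rw [res_smul, res_res]
      congr 1
      exact congr($(Scheme.Hom.appIso_inv_naturality U.ι (homOfLE i).op) s))
  have : IsIso φ := isIso_of_bijective φ fun V =>
    (hg _ (hle V)).comp ((ConcreteCategory.isIso_iff_bijective (U.ι.appIso V).inv).mp inferInstance)
  exact asIso φ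

lemma IsLineBundle.of_iso {L L' : X.Modules} (hL : IsLineBundle L) (e : L ≅ L') :
    IsLineBundle L' := by
  refine isLineBundle_of_generators fun x => ?_
  obtain ⟨U, g, hx, hg⟩ := hL.exists_generator x
  exact ⟨U, e.hom.app U g, hx, hg.map e.hom⟩

end Generators

/-! ### Sections of inverse images -/

section Pullback

variable {C B : Curve}

lemma pullbackSection_add (π : C.X ⟶ B.X) {L : B.X.Modules} {U : B.X.Opens} (s t : Γ(L, U)) :
    pullbackSection π (s + t) = pullbackSection π s + pullbackSection π t :=
  map_add _ _ _

lemma pullbackSection_smul (π : C.X ⟶ B.X) {L : B.X.Modules} {U : B.X.Opens} (a : Γ(B.X, U))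
    (s : Γ(L, U)) : pullbackSection π (a • s) = π.app U a • pullbackSection π s :=
  Scheme.Modules.Hom.app_smul ((Scheme.Modules.pullbackPushforwardAdjunction π).unit.app L) a s

lemma res_pullbackSection (π : C.X ⟶ B.X) {L : B.X.Modules} {U V : B.X.Opens} (h : V ≤ U)
    (s : Γ(L, U)) : res (π.preimage_mono h) (pullbackSection π s) = pullbackSection π (res h s) :=
  (app_res ((Scheme.Modules.pullbackPushforwardAdjunction π).unit.app L) h s).symm

lemma pullback_map_pullbackSection (π : C.X ⟶ B.X) {L L' : B.X.Modules} (f : L ⟶ L')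
    {U : B.X.Opens} (s : Γ(L, U)) :
    ((Scheme.Modules.pullback π).map f).app (π ⁻¹ᵁ U) (pullbackSection π s) =
      pullbackSection π (f.app U s) := by
  have := (Scheme.Modules.pullbackPushforwardAdjunction π).unit.naturality f
  exact congr(($this).app U s).symm

/-- The morphism `π^* L ⟶ G` adjoint to `L ⟶ π_* G`. -/
def pullbackLift (π : C.X ⟶ B.X) {L : B.X.Modules} {G : C.X.Modules}
    (α : L ⟶ (Scheme.Modules.pushforward π).obj G) : (Scheme.Modules.pullback π).obj L ⟶ G :=
  ((Scheme.Modules.pullbackPushforwardAdjunction π).homEquiv L G).symm α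

lemma pullbackLift_pullbackSection (π : C.X ⟶ B.X) {L : B.X.Modules} {G : C.X.Modules}
    (α : L ⟶ (Scheme.Modules.pushforward π).obj G) {U : B.X.Opens} (s : Γ(L, U)) :
    (pullbackLift π α).app (π ⁻¹ᵁ U) (pullbackSection π s) = α.app U s := by
  have := ((Scheme.Modules.pullbackPushforwardAdjunction π).homEquiv L G).apply_symm_apply α
  rw [Adjunction.homEquiv_unit] at this
  exact congr(($this).app U s)

/-- Sections of the form π^*s need not exhaust the sections of π^*L over π⁻¹(U), but by adjunction
they detect morphisms. -/
lemma pullback_hom_ext (π : C.X ⟶ B.X) {L : B.X.Modules} {G : C.X.Modules}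
    {f g : (Scheme.Modules.pullback π).obj L ⟶ G}
    (h : ∀ (U : B.X.Opens) (s : Γ(L, U)), f.app (π ⁻¹ᵁ U) (pullbackSection π s) =
      g.app (π ⁻¹ᵁ U) (pullbackSection π s)) : f = g := by
  apply ((Scheme.Modules.pullbackPushforwardAdjunction π).homEquiv L G).injective
  rw [Adjunction.homEquiv_unit, Adjunction.homEquiv_unit]
  exact Modules.hom_ext fun U s => h U s

end Pullback

/-! ### Orders of rational functions at closed points -/

open Scheme (ord)

namespace Curve

variable (C : Curve)

/-- The function field of a curve. -/
abbrev K : Type := C.X.functionField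

variable {C}

section Order

variable {x : C.X} (hx : IsClosed {x})

include hx

/-- The dimension of a stalk is the coheight of the point. This makes `Scheme.ord` computable by
`Ring.ordFrac` at closed points. -/
lemma coheight_eq_one : Order.coheight x = 1 := by
  have := C.isDVR x hx
  have h1 := IsDiscreteValuationRing.ringKrullDim_eq_one (C.X.presheaf.stalk x)
  rw [ringKrullDim_stalk_eq_coheight] at h1
  exact_mod_cast h1

lemma ord_eq_iff_ordFrac [IsDiscreteValuationRing (C.X.presheaf.stalk x)] {f : C.K} (hf : f ≠ 0)
    {n : ℤ} :
    ord f x = n ↔ Ring.ordFrac (C.X.presheaf.stalk x) f = Multiplicative.ofAdd n :=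
  Scheme.ord_eq_iff (coheight_eq_one hx) hf

lemma ord_uniformizer [IsDiscreteValuationRing (C.X.presheaf.stalk x)]
    {ϖ : C.X.presheaf.stalk x} (hϖ : Irreducible ϖ) :
    ord (algebraMap _ C.K ϖ) x = 1 := by
  rw [ord_eq_iff_ordFrac hx (by simpa using hϖ.ne_zero), Ring.ordFrac_irreducible hϖ]
  rfl

lemma ord_unit {u : C.X.presheaf.stalk x} (hu : IsUnit u) :
    ord (algebraMap _ C.K u) x = 0 := by
  have := C.isDVR x hx
  rw [ord_eq_iff_ordFrac hx (by simpa using hu.ne_zero), Ring.ordFrac_of_isUnit hu]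
  rfl

lemma exists_ord_eq_one : ∃ f : C.K, f ≠ 0 ∧ ord f x = 1 := by
  have := C.isDVR x hx
  obtain ⟨ϖ, hϖ⟩ := IsDiscreteValuationRing.exists_irreducible (C.X.presheaf.stalk x)
  exact ⟨_, by simpa using hϖ.ne_zero, ord_uniformizer hx hϖ⟩

omit hx in
lemma ord_one : ord (1 : C.K) x = 0 := by
  have h := Scheme.ord_mul (x := x) (one_ne_zero (α := C.K)) one_ne_zero
  rw [mul_one] at h
  linarith

omit hx in
lemma ord_pow {f : C.K} (hf : f ≠ 0) (n : ℕ) : ord (f ^ n) x = n * ord f x := by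
  induction n with
  | zero => simpa using ord_one
  | succ n ih =>
    rw [pow_succ, Scheme.ord_mul (pow_ne_zero n hf) hf, ih]
    push_cast
    ring

omit hx in
lemma ord_inv {f : C.K} (hf : f ≠ 0) : ord f⁻¹ x = - ord f x := by
  have h := Scheme.ord_mul (x := x) hf (inv_ne_zero hf)
  rw [mul_inv_cancel₀ hf, ord_one] at h
  linarith

omit hx in
lemma ord_div {f g : C.K} (hf : f ≠ 0) (hg : g ≠ 0) : ord (f / g) x = ord f x - ord g x := by
  rw [div_eq_mul_inv, Scheme.ord_mul hf (inv_ne_zero hg), ord_inv hg]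
  ring

omit hx in
lemma ord_neg (f : C.K) : ord (-f) x = ord f x := by
  by_cases hf : f = 0
  · simp [hf]
  have h := Scheme.ord_mul (x := x) (neg_ne_zero.mpr (one_ne_zero (α := C.K)))
    (neg_ne_zero.mpr one_ne_zero)
  rw [neg_mul_neg, one_mul, ord_one] at h
  rw [← neg_one_mul, Scheme.ord_mul (neg_ne_zero.mpr one_ne_zero) hf]
  linarith

lemma ord_stalk_nonneg (r : C.X.presheaf.stalk x) : 0 ≤ ord (algebraMap _ C.K r) x := by
  have := C.isDVR x hx
  by_cases hr : r = 0
  · simp [hr]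
  obtain ⟨ϖ, hϖ⟩ := IsDiscreteValuationRing.exists_irreducible (C.X.presheaf.stalk x)
  obtain ⟨n, u, rfl⟩ := IsDiscreteValuationRing.eq_unit_mul_pow_irreducible hr hϖ
  have h1 : algebraMap _ C.K ϖ ≠ 0 := by simpa using hϖ.ne_zero
  have h2 : algebraMap _ C.K (u : C.X.presheaf.stalk x) ≠ 0 := by simp
  rw [map_mul, map_pow, Scheme.ord_mul h2 (pow_ne_zero _ h1), ord_unit hx u.isUnit, ord_pow h1]
  rw [ord_uniformizer hx hϖ]
  positivity

lemma isUnit_of_ord_eq_zero {r : C.X.presheaf.stalk x} (hr : r ≠ 0)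
    (h : ord (algebraMap _ C.K r) x = 0) : IsUnit r := by
  have := C.isDVR x hx
  rw [Ring.isUnit_iff_ordFrac_one_of_isDiscreteValuationRing (K := C.K)]
  exact (ord_eq_iff_ordFrac hx (by simpa using hr)).mp h

/-- In a valuation ring f or f⁻¹ is integral. In the second case f⁻¹ has order both ≥ 0 and ≤ 0, so
it is a unit. -/
lemma exists_stalk_of_ord_nonneg {f : C.K} (h : 0 ≤ ord f x) :
    ∃ r : C.X.presheaf.stalk x, algebraMap _ C.K r = f := by
  have := C.isDVR x hx
  by_cases hf : f = 0
  · exact ⟨0, by simp [hf]⟩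
  rcases ValuationRing.isInteger_or_isInteger (C.X.presheaf.stalk x) f with ⟨r, hr⟩ | ⟨r, hr⟩
  · exact ⟨r, hr⟩
  · have h1 := ord_stalk_nonneg hx r
    rw [hr, ord_inv hf] at h1
    have h2 : ord f x = 0 := by linarith
    have hr0 : r ≠ 0 := by
      rintro rfl
      rw [map_zero] at hr
      exact inv_ne_zero hf hr.symm
    obtain ⟨u, rfl⟩ := isUnit_of_ord_eq_zero hx hr0 (by rw [hr, ord_inv hf, h2, neg_zero])
    refine ⟨(u⁻¹ : (C.X.presheaf.stalk x)ˣ), ?_⟩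
    rw [← inv_inv f, ← hr]
    exact eq_inv_of_mul_eq_one_left (by rw [← map_mul, Units.inv_mul, map_one])

/-- The ultrametric inequality applied to f = (f + g) - g gives the bound that is missing. -/
lemma ord_add_of_lt {f g : C.K} (hf : f ≠ 0) (h : ord f x < ord g x) :
    f + g ≠ 0 ∧ ord (f + g) x = ord f x := by
  have := C.isDVR x hx
  have h0 : f + g ≠ 0 := by
    intro h0
    rw [eq_neg_of_add_eq_zero_left h0, ord_neg] at h
    exact lt_irrefl _ h
  refine ⟨h0, le_antisymm ?_ ?_⟩
  · have h1 := Scheme.ord_add (x := x) (f := f + g) (g := -g) (by simpa using hf)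
    rw [add_neg_cancel_right, ord_neg] at h1
    rcases min_le_iff.mp h1 with h2 | h2
    · exact h2
    · linarith
  · have h1 := Scheme.ord_add (x := x) h0
    rwa [min_eq_left h.le] at h1

end Order

/-! ### The topology of a curve -/

/-- A point of a third kind would lie strictly between the generic point and a closed point of its
closure, which would then have coheight at least 2. -/
lemma isClosed_or_eq_genericPoint (x : C.X) : IsClosed {x} ∨ x = genericPoint C.X := by
  by_contra! h
  obtain ⟨h1, h2⟩ := h
  have : CompactSpace C.X := by
    have : QuasiCompact C.str := inferInstance
    exact (quasiCompact_iff_compactSpace C.str).mp this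
  obtain ⟨p, hp, hpc⟩ := IsClosed.exists_closed_singleton (isClosed_closure (s := {x}))
    ⟨x, subset_closure rfl⟩
  have hxp : x ⤳ p := specializes_iff_mem_closure.mpr hp
  have hne : x ≠ p := by
    rintro rfl
    exact h1 hpc
  -- In the specialization order p ≤ x means that x specializes to p, so the generic point is the
  -- largest element.
  have hlt : p < x := lt_of_le_not_ge (show p ≤ x from hxp)
    fun h : p ⤳ x => hne (hxp.antisymm h).eq
  have hlt' : x < (⊤ : C.X) := lt_of_le_not_ge le_top
    fun h : x ⤳ genericPoint C.X => h2 (h.antisymm (show genericPoint C.X ⤳ x from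
      (genericPoint_spec C.X).specializes trivial)).eq
  have h3 := Order.coheight_add_one_le hlt
  have h4 := Order.coheight_add_one_le hlt'
  rw [coheight_eq_one hpc] at h3
  have h5 : (1 : ℕ∞) ≤ Order.coheight x := le_trans (by simp) h4
  have h6 : (1 : ℕ∞) + 1 ≤ 1 := le_trans (by gcongr) h3
  exact absurd h6 (by decide)

lemma not_isClosed_genericPoint : ¬ IsClosed {genericPoint C.X} := by
  intro h
  have h1 := coheight_eq_one h
  have : Order.coheight (⊤ : C.X) = 0 := by simp
  exact absurd (h1.symm.trans this) (by simp)

lemma genericPoint_mem {U : C.X.Opens} {x : C.X} (hx : x ∈ U) : genericPoint C.X ∈ U :=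
  ((genericPoint_spec C.X).mem_open_set_iff U.isOpen).mpr ⟨x, trivial, hx⟩

/-- The curve is noetherian, so the complement is a finite union of irreducible closed sets. The
generic point of each of them is not in U, hence is a closed point, and the component is a
singleton. -/
lemma finite_compl {U : C.X.Opens} (hU : genericPoint C.X ∈ U) :
    Set.Finite (U : Set C.X)ᶜ := by
  have : CompactSpace C.X := by
    have : QuasiCompact C.str := inferInstance
    exact (quasiCompact_iff_compactSpace C.str).mp this
  have : IsNoetherian C.X := { }
  obtain ⟨S, hSf, hSc, hS, e'⟩ := NoetherianSpace.exists_finite_set_isClosed_irreducible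
    U.isOpen.isClosed_compl
  rw [Set.sUnion_eq_biUnion] at e'
  rw [e']
  refine hSf.biUnion fun Z hZ => ?_
  obtain ⟨z, hz⟩ := QuasiSober.sober (hS Z hZ) (hSc Z hZ)
  have hzZ : z ∈ Z := hz.mem
  have hzU : z ∉ U := by
    have : z ∈ (U : Set C.X)ᶜ := by
      rw [e']
      exact Set.mem_biUnion hZ hzZ
    exact this
  rcases isClosed_or_eq_genericPoint z with h | h
  · have : Z = {z} := by rw [← hz.def, h.closure_eq]
    rw [this]
    exact Set.finite_singleton z
  · exact absurd (h ▸ hU) hzU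

/-- The open complement of a finite set of closed points. -/
def complOpens (S : Set C.X) (hS : S.Finite) (h : ∀ x ∈ S, IsClosed {x}) : C.X.Opens :=
  ⟨Sᶜ, by
    rw [isOpen_compl_iff, ← Set.biUnion_of_singleton S]
    exact hS.isClosed_biUnion h⟩

/-! ### Functions -/

/-- The value in the function field of a function on a non-empty open subset. -/
def toK {U : C.X.Opens} (h : genericPoint C.X ∈ U) : Γ(C.X, U) →+* C.K :=
  (C.X.presheaf.germ U (genericPoint C.X) h).hom

lemma toK_injective {U : C.X.Opens} (h : genericPoint C.X ∈ U) : Function.Injective (toK h) :=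
  germ_injective_of_isIntegral C.X _ h

lemma toK_resO {U V : C.X.Opens} (i : V ≤ U) (h : genericPoint C.X ∈ V) (a : Γ(C.X, U)) :
    toK h (resO i a) = toK (i h) a :=
  C.X.presheaf.germ_res_apply (homOfLE i) _ h a

lemma algebraMap_germ {U : C.X.Opens} {x : C.X} (hx : x ∈ U) (a : Γ(C.X, U)) :
    algebraMap (C.X.presheaf.stalk x) C.K (C.X.presheaf.germ U x hx a) =
      toK (genericPoint_mem hx) a := by
  have : Nonempty U := ⟨x, hx⟩
  exact Scheme.algebraMap_germ_eq_germToFunctionField C.X hx a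

lemma ord_toK_nonneg {U : C.X.Opens} {x : C.X} (hx : x ∈ U) (hc : IsClosed {x}) (a : Γ(C.X, U)) :
    0 ≤ ord (toK (genericPoint_mem hx) a) x := by
  rw [← algebraMap_germ hx]
  exact ord_stalk_nonneg hc _

/-- Such an open set is empty. This settles the degenerate case wherever sections are compared
through their values at the generic point. -/
lemma subsingleton_of_genericPoint_notMem {M : C.X.Modules} {U : C.X.Opens}
    (h : genericPoint C.X ∉ U) : Subsingleton Γ(M, U) :=
  ⟨fun _ _ => section_ext fun _ hx => absurd (genericPoint_mem hx) h⟩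

/-- A rational function without poles on `U` is a function on `U`. -/
lemma exists_toK_eq {U : C.X.Opens} (h : genericPoint C.X ∈ U) (f : C.K)
    (hf : ∀ x ∈ U, IsClosed {x} → 0 ≤ ord f x) : ∃ a : Γ(C.X, U), toK h a = f := by
  have hst : ∀ x ∈ U, ∃ r : C.X.presheaf.stalk x, algebraMap _ C.K r = f := by
    intro x hx
    rcases isClosed_or_eq_genericPoint x with hc | rfl
    · exact exists_stalk_of_ord_nonneg hc (hf x hx hc)
    · obtain ⟨V, hV, a, rfl⟩ := C.X.presheaf.exists_germ_eq f
      exact ⟨C.X.presheaf.germ V _ hV a, algebraMap_germ hV a⟩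
  have hloc : ∀ x : U, ∃ (V : C.X.Opens) (hV : x.1 ∈ V) (_ : V ≤ U) (a : Γ(C.X, V)),
      toK (genericPoint_mem hV) a = f := by
    intro x
    obtain ⟨r, rfl⟩ := hst x.1 x.2
    obtain ⟨V, hV, a, rfl⟩ := C.X.presheaf.exists_germ_eq r
    refine ⟨V ⊓ U, ⟨hV, x.2⟩, inf_le_right, resO inf_le_left a, ?_⟩
    rw [toK_resO, algebraMap_germ hV]
  choose V hV hVU a ha using hloc
  -- The local representatives of f agree on overlaps because a function is determined by its germ
  -- at the generic point.
  obtain ⟨t, ht⟩ := exists_glue (M := structureSheaf C.X) V hVU (fun x hx => ⟨⟨x, hx⟩, hV _⟩)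
    (fun x => (a x : Γ(C.X, V x))) (by
      intro i j W hi hj
      by_cases hW : genericPoint C.X ∈ W
      · apply toK_injective hW
        refine (toK_resO hi hW (a i)).trans (Eq.trans ?_ (toK_resO hj hW (a j)).symm)
        exact (ha i).trans (ha j).symm
      · exact (subsingleton_of_genericPoint_notMem hW).elim _ _)
  refine ⟨(t : Γ(C.X, U)), ?_⟩
  have h1 := ht ⟨_, h⟩
  have h2 := toK_resO (hVU ⟨_, h⟩) (hV ⟨_, h⟩) t
  rw [← h2, ← ha ⟨_, h⟩]
  exact congrArg _ h1

/-- A rational function has finitely many zeros and poles. -/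
lemma finite_ord_ne_zero (f : C.K) : {x : C.X | ord f x ≠ 0}.Finite := by
  by_cases hf : f = 0
  · simp [hf]
  obtain ⟨U, -, a, hU, rfl, ha⟩ := exists_isUnit_germ_eq C.X f hf
  obtain ⟨y, hy⟩ := hU
  refine (finite_compl (genericPoint_mem hy)).subset fun x hx hxU => hx ?_
  have : Nonempty U := ⟨y, hy⟩
  exact Scheme.ord_of_isUnit ha hxU

end Curve

namespace Curve

/-! ### Constants, global functions and residue fields -/

section Constants

variable (C : Curve)

/-- The constant rational functions. -/
def const : ℂ →+* C.K := (toK (Opens.mem_top (genericPoint C.X))).comp C.scalars.hom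

/-- Global functions on a universally closed scheme are integral over those of the base; the
equation is only transported from Γ(Spec ℂ) to ℂ. -/
lemma scalars_isIntegral : C.scalars.hom.IsIntegral := by
  have h := isIntegral_appTop_of_universallyClosed C.str
  intro x
  obtain ⟨p, hp, hpx⟩ := h x
  let e := (Scheme.ΓSpecIso (CommRingCat.of ℂ)).commRingCatIsoToRingEquiv
  refine ⟨p.map e.toRingHom, hp.map _, ?_⟩
  rw [Polynomial.eval₂_map]
  convert hpx using 2
  ext a
  change C.str.appTop ((Scheme.ΓSpecIso (CommRingCat.of ℂ)).inv
    ((Scheme.ΓSpecIso (CommRingCat.of ℂ)).hom a)) = C.str.appTop a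
  congr 1
  exact congr($((Scheme.ΓSpecIso (CommRingCat.of ℂ)).hom_inv_id) a)

variable {C}

/-- A rational function without poles is constant. -/
lemma exists_const_of_ord_nonneg {f : C.K} (hf : ∀ x : C.X, IsClosed {x} → 0 ≤ ord f x) :
    ∃ c, C.const c = f := by
  obtain ⟨a, rfl⟩ := exists_toK_eq (Opens.mem_top (genericPoint C.X)) f fun x _ => hf x
  -- A domain integral over an algebraically closed field equals that field.
  obtain ⟨c, rfl⟩ := (IsAlgClosed.ringHom_bijective_of_isIntegral (k := ℂ) (K := Γ(C.X, ⊤))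
    C.scalars.hom C.scalars_isIntegral).2 a
  exact ⟨c, rfl⟩

lemma ord_const (c : ℂ) (x : C.X) : ord (C.const c) x = 0 := by
  by_cases hc : c = 0
  · simp [hc]
  have hu : IsUnit (C.scalars c) := (isUnit_iff_ne_zero.mpr hc).map C.scalars.hom
  have : Nonempty (⊤ : C.X.Opens) := ⟨x, trivial⟩
  exact Scheme.ord_of_isUnit hu (x := x) trivial

/-- A morphism to an affine scheme is determined by its effect on global functions. This form lets
`scalars` be compared with the residue fields. -/
lemma str_eq : C.str = C.X.toSpecΓ ≫ Spec.map C.scalars := by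
  have h := Scheme.toSpecΓ_naturality C.str
  rw [← SpecMap_ΓSpecIso_hom] at h
  have h2 := congrArg (· ≫ Spec.map (Scheme.ΓSpecIso (CommRingCat.of ℂ)).inv) h
  simp only [Category.assoc, ← Spec.map_comp, Iso.inv_hom_id, Spec.map_id,
    Category.comp_id] at h2
  exact h2

/-- The residue fields of closed points consist of the constants. -/
lemma exists_const_sub_mem {x : C.X} (hx : IsClosed {x}) (r : C.X.presheaf.stalk x) :
    ∃ c : ℂ, r - C.X.presheaf.germ ⊤ x (Opens.mem_top x) (C.scalars c) ∈
      IsLocalRing.maximalIdeal (C.X.presheaf.stalk x) := by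
  let e := residueFieldIsoBase C.str x hx
  -- The isomorphism between ℂ and the residue field is evaluation of constants, so the constant
  -- that corresponds to a residue class lifts it.
  have key : e.inv = C.scalars ≫ C.X.presheaf.germ ⊤ x (Opens.mem_top x) ≫ C.X.residue x := by
    apply Spec.map_injective
    rw [SpecMap_residueFieldIsoBase_inv, Scheme.fromSpecResidueField, str_eq, Category.assoc,
      Scheme.fromSpecStalk_toSpecΓ_assoc]
    simp only [Spec.map_comp, Category.assoc]
  refine ⟨e.hom (C.X.residue x r), ?_⟩
  have h1 : C.X.residue x (C.X.presheaf.germ ⊤ x (Opens.mem_top x) (C.scalars (e.hom (C.X.residue x r)))) =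
      C.X.residue x r := by
    have h2 := congr($key (e.hom (C.X.residue x r)))
    exact h2.symm.trans congr($(e.hom_inv_id) (C.X.residue x r))
  have h2 : C.X.residue x (r - C.X.presheaf.germ ⊤ x (Opens.mem_top x)
      (C.scalars (e.hom (C.X.residue x r)))) = 0 := by
    rw [map_sub, h1, sub_self]
  exact Ideal.Quotient.eq_zero_iff_mem.mp h2

lemma exists_ord_sub_const {x : C.X} (hx : IsClosed {x}) {f : C.K} (hf : 0 ≤ ord f x) :
    ∃ c : ℂ, f - C.const c = 0 ∨ 1 ≤ ord (f - C.const c) x := by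
  obtain ⟨r, rfl⟩ := exists_stalk_of_ord_nonneg hx hf
  obtain ⟨c, hc⟩ := exists_const_sub_mem hx r
  have h1 : algebraMap _ C.K r - C.const c =
      algebraMap _ C.K (r - C.X.presheaf.germ ⊤ x (Opens.mem_top x) (C.scalars c)) := by
    rw [map_sub, algebraMap_germ]
    rfl
  refine ⟨c, ?_⟩
  rw [h1]
  by_cases h0 : r - C.X.presheaf.germ ⊤ x (Opens.mem_top x) (C.scalars c) = 0
  · left
    rw [h0, map_zero]
  · right
    have h2 := ord_stalk_nonneg hx (r - C.X.presheaf.germ ⊤ x (Opens.mem_top x) (C.scalars c))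
    have h3 := mt (isUnit_of_ord_eq_zero hx h0) ((IsLocalRing.mem_maximalIdeal _).mp hc)
    omega

end Constants

/-! ### Separation of points by rational functions -/

section Separation

variable {C : Curve}

instance : C.X.IsSeparated where
  isSeparated_terminal_from := by
    rw [← Limits.terminal.comp_from C.str]
    infer_instance

/-- The inclusion of local rings 𝒪_x ⊂ 𝒪_y is a local homomorphism. It gives a second morphism Spec
𝒪_y → C, which agrees with the canonical one at the generic point; as C is separated they coincide,
and their values at the closed point are x and y. -/
lemma eq_of_stalk_le {x y : C.X} (hx : IsClosed {x}) (hy : IsClosed {y})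
    (h : ∀ f : C.K, 0 ≤ ord f x → 0 ≤ ord f y) : x = y := by
  have hinj := IsFractionRing.injective (C.X.presheaf.stalk y) C.K
  have hex (r : C.X.presheaf.stalk x) : ∃ s : C.X.presheaf.stalk y,
      algebraMap _ C.K s = algebraMap _ C.K r :=
    exists_stalk_of_ord_nonneg hy (h _ (ord_stalk_nonneg hx r))
  choose φ hφ using hex
  let Φ : C.X.presheaf.stalk x →+* C.X.presheaf.stalk y :=
    { toFun := φ
      map_one' := hinj (by simp [hφ])
      map_mul' := fun a b => hinj (by simp [hφ])
      map_zero' := hinj (by simp [hφ])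
      map_add' := fun a b => hinj (by simp [hφ]) }
  obtain ⟨t, ht0, ht⟩ := exists_ord_eq_one hx
  obtain ⟨f, hf0, hf⟩ := exists_ord_eq_one hy
  -- If t were a unit at y, then f⁻¹tⁿ with n = |ord_x f| would be regular at x and have a simple
  -- pole at y.
  have ht' : 0 < ord t y := by
    refine lt_of_le_of_ne (h t (by rw [ht]; exact zero_le_one)) fun h0 => ?_
    have h1 : 0 ≤ ord (f⁻¹ * t ^ (ord f x).natAbs) x := by
      rw [Scheme.ord_mul (inv_ne_zero hf0) (pow_ne_zero _ ht0), ord_inv hf0, ord_pow ht0, ht]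
      omega
    have h2 := h _ h1
    rw [Scheme.ord_mul (inv_ne_zero hf0) (pow_ne_zero _ ht0), ord_inv hf0, ord_pow ht0, ← h0,
      hf] at h2
    omega
  have hlocal : IsLocalHom Φ := by
    constructor
    intro r hr
    have hr0 : r ≠ 0 := by
      rintro rfl
      rw [map_zero] at hr
      exact not_isUnit_zero hr
    have hK : algebraMap _ C.K r ≠ 0 := by simpa using hr0
    refine isUnit_of_ord_eq_zero hx hr0 ?_
    by_contra hne
    have h1 := ord_stalk_nonneg hx r
    -- If r vanishes at x, then r / t is regular at x, hence at y; since t vanishes at y, so does r.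
    have h2 : 0 ≤ ord (algebraMap _ C.K r * t⁻¹) x := by
      rw [Scheme.ord_mul hK (inv_ne_zero ht0), ord_inv ht0, ht]
      omega
    have h3 := h _ h2
    have h4 : ord (algebraMap _ C.K r) y = 0 := by
      rw [← hφ r]
      exact ord_unit hy hr
    rw [Scheme.ord_mul hK (inv_ne_zero ht0), ord_inv ht0, h4] at h3
    omega
  have hsp (z : C.X) : genericPoint C.X ⤳ z := (genericPoint_spec C.X).specializes trivial
  let ι := Spec.map (C.X.presheaf.stalkSpecializes (hsp y))
  have : IsDominant ι := by
    refine ⟨?_⟩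
    refine (PrimeSpectrum.denseRange_comap_iff_ker_le_nilRadical _).mpr ?_
    intro a ha
    have : a = 0 := hinj (((RingHom.mem_ker).mp ha).trans (map_zero _).symm)
    rw [this]
    exact zero_mem _
  have heq : C.X.fromSpecStalk y = Spec.map (CommRingCat.ofHom Φ) ≫ C.X.fromSpecStalk x := by
    refine ext_of_isDominant ι ?_
    rw [Scheme.SpecMap_stalkSpecializes_fromSpecStalk, ← Category.assoc, ← Spec.map_comp]
    have : CommRingCat.ofHom Φ ≫ C.X.presheaf.stalkSpecializes (hsp y) =
        C.X.presheaf.stalkSpecializes (hsp x) := by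
      ext r
      exact hφ r
    rw [this, Scheme.SpecMap_stalkSpecializes_fromSpecStalk]
  have h1 := congr($heq (IsLocalRing.closedPoint (C.X.presheaf.stalk y)))
  have : IsLocalHom (CommRingCat.ofHom Φ).hom := hlocal
  rw [Scheme.fromSpecStalk_closedPoint] at h1
  refine (h1.trans ((Scheme.Hom.comp_apply _ _ _).trans ?_)).symm
  refine (congrArg (C.X.fromSpecStalk x) (Spec_closedPoint (f := CommRingCat.ofHom Φ))).trans ?_
  exact Scheme.fromSpecStalk_closedPoint

/-- Weak approximation for two points. -/
lemma exists_ord_eq_one_and_eq_zero {x y : C.X} (hx : IsClosed {x}) (hy : IsClosed {y})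
    (hxy : x ≠ y) : ∃ f : C.K, f ≠ 0 ∧ ord f x = 1 ∧ ord f y = 0 := by
  obtain ⟨f, hf, hf'⟩ : ∃ f : C.K, 0 ≤ ord f x ∧ ord f y < 0 := by
    by_contra! h
    exact hxy (eq_of_stalk_le hx hy h)
  obtain ⟨g, hg, hg'⟩ : ∃ g : C.K, 0 ≤ ord g y ∧ ord g x < 0 := by
    by_contra! h
    exact hxy (eq_of_stalk_le hy hx h).symm
  have hf0 : f ≠ 0 := by
    rintro rfl
    simp at hf'
  have hg0 : g ≠ 0 := by
    rintro rfl
    simp at hg'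
  obtain ⟨t, ht0, ht⟩ := exists_ord_eq_one hx
  -- Since h has a zero at x and a pole at y, k = 1/(1 + h) is a unit at x and vanishes at y, while
  -- l = h/(1 + h) vanishes at x and is a unit at y. In t kᴺ + l² the first term decides the order
  -- at x, where l² has order at least 2, and the second one decides it at y, where N exceeds a
  -- possible pole of t.
  let h := f / g
  have h0 : h ≠ 0 := div_ne_zero hf0 hg0
  have hhx : 0 < ord h x := by
    rw [ord_div hf0 hg0]
    linarith
  have hhy : ord h y < 0 := by
    rw [ord_div hf0 hg0]
    linarith
  obtain ⟨hd0, hdx⟩ := ord_add_of_lt hx (f := 1) (g := h) one_ne_zero (by rw [ord_one]; exact hhx)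
  obtain ⟨-, hdy⟩ := ord_add_of_lt hy (f := h) (g := 1) h0 (by rw [ord_one]; exact hhy)
  rw [add_comm] at hdy
  rw [ord_one] at hdx
  let k := (1 + h)⁻¹
  have hk0 : k ≠ 0 := inv_ne_zero hd0
  have hkx : ord k x = 0 := by rw [ord_inv hd0, hdx, neg_zero]
  have hky : 0 < ord k y := by rw [ord_inv hd0, hdy]; linarith
  let l := h / (1 + h)
  have hl0 : l ≠ 0 := div_ne_zero h0 hd0
  have hlx : 0 < ord l x := by rw [ord_div h0 hd0, hdx]; linarith
  have hly : ord l y = 0 := by rw [ord_div h0 hd0, hdy, sub_self]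
  let N := (ord t y).natAbs + 1
  have h1 : t * k ^ N ≠ 0 := mul_ne_zero ht0 (pow_ne_zero _ hk0)
  have h2 : l ^ 2 ≠ 0 := pow_ne_zero _ hl0
  have h1x : ord (t * k ^ N) x = 1 := by
    rw [Scheme.ord_mul ht0 (pow_ne_zero _ hk0), ord_pow hk0, ht, hkx]
    ring
  have h1y : 0 < ord (t * k ^ N) y := by
    rw [Scheme.ord_mul ht0 (pow_ne_zero _ hk0), ord_pow hk0]
    have : (N : ℤ) ≤ N * ord k y := le_mul_of_one_le_right (by positivity) hky
    omega
  have h2x : 1 < ord (l ^ 2) x := by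
    rw [ord_pow hl0]
    push_cast
    linarith
  have h2y : ord (l ^ 2) y = 0 := by rw [ord_pow hl0, hly, mul_zero]
  refine ⟨t * k ^ N + l ^ 2, ?_, ?_, ?_⟩
  · exact (ord_add_of_lt hx h1 (by rw [h1x]; exact h2x)).1
  · rw [(ord_add_of_lt hx h1 (by rw [h1x]; exact h2x)).2, h1x]
  · rw [add_comm, (ord_add_of_lt hy h2 (by rw [h2y]; exact h1y)).2, h2y]

end Separation

end Curve

/-! ### The map of function fields -/

section FunctionFieldMap

open Curve

variable {C B : Curve}

/-- The map of function fields defined by a dominant morphism. -/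
def funcMap (f : C.X ⟶ B.X) (hf : f (genericPoint C.X) = genericPoint B.X) : B.K →+* C.K :=
  (B.X.presheaf.stalkSpecializes (specializes_of_eq hf) ≫ f.stalkMap (genericPoint C.X)).hom

variable (f : C.X ⟶ B.X) (hf : f (genericPoint C.X) = genericPoint B.X)

include hf in
lemma genericPoint_mem_preimage {U : B.X.Opens} (hU : genericPoint B.X ∈ U) :
    genericPoint C.X ∈ f ⁻¹ᵁ U := by
  change f (genericPoint C.X) ∈ U
  rwa [hf]

lemma funcMap_toK {U : B.X.Opens} (hU : genericPoint B.X ∈ U) (a : Γ(B.X, U)) :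
    funcMap f hf (toK hU a) = toK (genericPoint_mem_preimage f hf hU) (f.app U a) := by
  have h1 := B.X.presheaf.germ_stalkSpecializes hU (specializes_of_eq hf)
  have h2 := f.germ_stalkMap U (genericPoint C.X) (genericPoint_mem_preimage f hf hU)
  refine Eq.trans ?_ congr($h2 a)
  exact congr(f.stalkMap (genericPoint C.X) ($h1 a))

lemma exists_toK (b : B.K) : ∃ (U : B.X.Opens) (hU : genericPoint B.X ∈ U) (a : Γ(B.X, U)),
    toK hU a = b := by
  obtain ⟨U, hU, a, ha⟩ := B.X.presheaf.exists_germ_eq b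
  exact ⟨U, hU, a, ha⟩

lemma funcMap_algebraMap (x : C.X) (r : B.X.presheaf.stalk (f x)) :
    funcMap f hf (algebraMap _ B.K r) = algebraMap _ C.K (f.stalkMap x r) := by
  obtain ⟨U, hU, a, rfl⟩ := B.X.presheaf.exists_germ_eq r
  rw [algebraMap_germ, funcMap_toK, Scheme.Hom.germ_stalkMap_apply]
  exact (algebraMap_germ (show x ∈ f ⁻¹ᵁ U from hU) _).symm

lemma funcMap_const (hstr : f ≫ B.str = C.str) (c : ℂ) :
    funcMap f hf (B.const c) = C.const c := by
  have h : C.scalars = B.scalars ≫ f.appTop := by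
    unfold Curve.scalars
    rw [← hstr, Scheme.Hom.comp_appTop, Category.assoc]
  unfold Curve.const
  rw [RingHom.comp_apply, funcMap_toK, RingHom.comp_apply, h]
  rfl

/-- The ramification index. -/
lemma exists_ramificationIndex {x : C.X} (hx : IsClosed {x}) (hy : IsClosed {f x}) :
    ∃ e : ℤ, 1 ≤ e ∧ ∀ b : B.K, ord (funcMap f hf b) x = e * ord b (f x) := by
  have := B.isDVR _ hy
  have hinj : Function.Injective (funcMap f hf) := (funcMap f hf).injective
  obtain ⟨t, ht⟩ := IsDiscreteValuationRing.exists_irreducible (B.X.presheaf.stalk (f x))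
  have ht1 := ord_uniformizer hy ht
  set t' := algebraMap _ B.K t
  have ht0 : t' ≠ 0 := by simpa [t'] using ht.ne_zero
  have hs0 : f.stalkMap x t ≠ 0 := by
    intro h
    have := funcMap_algebraMap f hf x t
    rw [h, map_zero] at this
    exact ht0 (hinj (this.trans (map_zero _).symm))
  have hu : ∀ u : B.K, u ≠ 0 → ord u (f x) = 0 → ord (funcMap f hf u) x = 0 := by
    intro u hu h
    obtain ⟨r, rfl⟩ := exists_stalk_of_ord_nonneg hy h.ge
    have hr := isUnit_of_ord_eq_zero hy (by simpa using hu) h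
    rw [funcMap_algebraMap]
    exact ord_unit hx (hr.map (f.stalkMap x).hom)
  have hne {b : B.K} (hb : b ≠ 0) : funcMap f hf b ≠ 0 := by simpa using hb
  -- A function of order n is a unit times the n-th power of the uniformizer, and units pull back to
  -- units; negative orders follow by taking inverses.
  have hpos : ∀ (b : B.K) (n : ℕ), b ≠ 0 → ord b (f x) = n →
      ord (funcMap f hf b) x = ord (funcMap f hf t') x * n := by
    intro b n hb h
    have h1 := hu (b / t' ^ n) (div_ne_zero hb (pow_ne_zero _ ht0)) (by
      rw [ord_div hb (pow_ne_zero _ ht0), ord_pow ht0, ht1, h]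
      ring)
    rw [map_div₀, ord_div (hne hb) (hne (pow_ne_zero _ ht0)), map_pow, ord_pow (hne ht0)] at h1
    linarith
  refine ⟨ord (funcMap f hf t') x, ?_, ?_⟩
  · rw [funcMap_algebraMap]
    have h1 := ord_stalk_nonneg hx (f.stalkMap x t)
    -- The map of stalks is local, so the uniformizer does not become a unit.
    have h2 : ord (algebraMap _ C.K (f.stalkMap x t)) x ≠ 0 := fun h =>
      ht.not_isUnit (isUnit_of_map_unit (f.stalkMap x).hom t (isUnit_of_ord_eq_zero hx hs0 h))
    omega
  · intro b
    by_cases hb : b = 0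
    · simp [hb]
    obtain ⟨n, hn | hn⟩ := (ord b (f x)).eq_nat_or_neg
    · rw [hpos b n hb hn, hn]
    · have h1 := hpos b⁻¹ n (inv_ne_zero hb) (by rw [ord_inv hb, hn, neg_neg])
      rw [map_inv₀, ord_inv (hne hb)] at h1
      rw [hn]
      linarith

lemma funcMap_comp {A : Curve} (g : A.X ⟶ C.X) (hg : g (genericPoint A.X) = genericPoint C.X)
    (hgf : (g ≫ f) (genericPoint A.X) = genericPoint B.X) (b : B.K) :
    funcMap (g ≫ f) hgf b = funcMap g hg (funcMap f hf b) := by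
  obtain ⟨U, hU, a, rfl⟩ := exists_toK b
  rw [funcMap_toK, funcMap_toK, funcMap_toK]
  rfl

lemma funcMap_id (h : 𝟙 C.X (genericPoint C.X) = genericPoint C.X) (a : C.K) :
    funcMap (𝟙 C.X) h a = a := by
  obtain ⟨U, hU, a, rfl⟩ := exists_toK a
  rw [funcMap_toK]
  rfl

/-- A morphism is determined by the map of function fields. -/
lemma hom_ext_of_funcMap {f g : C.X ⟶ B.X} (hf : f (genericPoint C.X) = genericPoint B.X)
    (hg : g (genericPoint C.X) = genericPoint B.X) (h : ∀ b, funcMap f hf b = funcMap g hg b) :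
    f = g := by
  have : IsDominant (C.X.fromSpecStalk (genericPoint C.X)) := by
    refine ⟨?_⟩
    have h1 : genericPoint C.X ∈ Set.range (C.X.fromSpecStalk (genericPoint C.X)) := by
      rw [Scheme.range_fromSpecStalk]
      exact specializes_rfl
    refine Dense.mono (Set.singleton_subset_iff.mpr h1) ?_
    exact dense_iff_closure_eq.mpr (genericPoint_spec C.X).def
  -- The spectrum of the function field is dense in C, so two morphisms to the separated curve B
  -- that agree there are equal.
  refine ext_of_isDominant (C.X.fromSpecStalk (genericPoint C.X)) ?_
  have key (f : C.X ⟶ B.X) (hf : f (genericPoint C.X) = genericPoint B.X) :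
      C.X.fromSpecStalk (genericPoint C.X) ≫ f =
        Spec.map (CommRingCat.ofHom (funcMap f hf)) ≫ B.X.fromSpecStalk (genericPoint B.X) := by
    rw [← Scheme.SpecMap_stalkMap_fromSpecStalk]
    unfold funcMap
    rw [CommRingCat.ofHom_hom, Spec.map_comp, Category.assoc,
      Scheme.SpecMap_stalkSpecializes_fromSpecStalk]
  rw [key f hf, key g hg, RingHom.ext h]

end FunctionFieldMap

namespace Curve

/-! ### Sheaves of divisors in terms of rational functions -/

section DivisorSheaf

variable {C : Curve}

open Classical in
/-- The value in the function field of a function on an open subset (`0` if it is empty). -/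
def fval {U : C.X.Opens} (a : Γ(C.X, U)) : C.K :=
  if h : genericPoint C.X ∈ U then toK h a else 0

lemma fval_eq {U : C.X.Opens} (h : genericPoint C.X ∈ U) (a : Γ(C.X, U)) : fval a = toK h a :=
  dif_pos h

lemma fval_mul {U : C.X.Opens} (a b : Γ(C.X, U)) : fval (a * b) = fval a * fval b := by
  by_cases h : genericPoint C.X ∈ U
  · simp [fval_eq h]
  · simp [fval, h]

lemma fval_add {U : C.X.Opens} (a b : Γ(C.X, U)) : fval (a + b) = fval a + fval b := by
  by_cases h : genericPoint C.X ∈ U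
  · simp [fval_eq h]
  · simp [fval, h]

lemma fval_resO {U V : C.X.Opens} (i : V ≤ U) (h : genericPoint C.X ∈ V) (a : Γ(C.X, U)) :
    fval (resO i a) = fval a := by
  rw [fval_eq h, fval_eq (i h), toK_resO]

lemma ord_fval_nonneg {U : C.X.Opens} {x : C.X} (hx : x ∈ U) (hc : IsClosed {x}) (a : Γ(C.X, U)) :
    0 ≤ ord (fval a) x := by
  rw [fval_eq (genericPoint_mem hx)]
  exact ord_toK_nonneg hx hc a

lemma exists_fval_eq {U : C.X.Opens} (h : genericPoint C.X ∈ U) (f : C.K)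
    (hf : ∀ x ∈ U, IsClosed {x} → 0 ≤ ord f x) : ∃ a : Γ(C.X, U), fval a = f := by
  obtain ⟨a, ha⟩ := exists_toK_eq h f hf
  exact ⟨a, by rw [fval_eq h, ha]⟩

lemma fval_injective {U : C.X.Opens} {a b : Γ(C.X, U)} (h : fval a = fval b) : a = b := by
  by_cases hU : genericPoint C.X ∈ U
  · exact toK_injective hU (by rwa [fval_eq hU, fval_eq hU] at h)
  · exact (subsingleton_of_genericPoint_notMem (M := structureSheaf C.X) hU).elim a b

lemma fval_app {B : Curve} (f : C.X ⟶ B.X) (hf : f (genericPoint C.X) = genericPoint B.X)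
    {U : B.X.Opens} (a : Γ(B.X, U)) : fval (f.app U a) = funcMap f hf (fval a) := by
  by_cases h : genericPoint B.X ∈ U
  · rw [fval_eq h, funcMap_toK, fval_eq]
  · have h' : genericPoint C.X ∉ f ⁻¹ᵁ U := by
      change f _ ∉ U
      rwa [hf]
    simp [fval, h, h']

variable {D D' D'' : C.X →₀ ℤ}

open Classical in
/-- The rational function defined by a section of `𝒪_C(D)`. -/
def val {U : C.X.Opens} (s : Γ(C.divisorSheaf D, U)) : C.K :=
  if h : genericPoint C.X ∈ U then
    ratValue (show (C.divisorSubmodule D).obj (op U) from s).1 ⟨_, h⟩ else 0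

lemma val_eq {U : C.X.Opens} (s : Γ(C.divisorSheaf D, U)) {x : C.X} (hx : x ∈ U) :
    val s = ratValue (show (C.divisorSubmodule D).obj (op U) from s).1 ⟨x, hx⟩ := by
  rw [val, dif_pos (genericPoint_mem hx)]
  exact (show rationalFunctions C.X U from
    (show (C.divisorSubmodule D).obj (op U) from s).1).2 _ _

lemma val_of_notMem {U : C.X.Opens} (h : genericPoint C.X ∉ U) (s : Γ(C.divisorSheaf D, U)) :
    val s = 0 := dif_neg h

lemma val_add {U : C.X.Opens} (s t : Γ(C.divisorSheaf D, U)) : val (s + t) = val s + val t := by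
  by_cases h : genericPoint C.X ∈ U
  · rw [val_eq _ h, val_eq _ h, val_eq _ h]
    rfl
  · simp [val_of_notMem h]

lemma val_smul {U : C.X.Opens} (a : Γ(C.X, U)) (s : Γ(C.divisorSheaf D, U)) :
    val (a • s) = fval a * val s := by
  by_cases h : genericPoint C.X ∈ U
  · rw [val_eq _ h, val_eq _ h, fval_eq h, ← algebraMap_germ h]
    rfl
  · simp [val_of_notMem h]

lemma val_res {U V : C.X.Opens} (i : V ≤ U) (h : genericPoint C.X ∈ V)
    (s : Γ(C.divisorSheaf D, U)) : val (res i s) = val s := by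
  rw [val_eq _ h, val_eq _ (i h)]
  rfl

lemma val_injective {U : C.X.Opens} {s t : Γ(C.divisorSheaf D, U)} (h : val s = val t) :
    s = t := by
  refine Subtype.ext (Subtype.ext (funext fun x => ?_))
  rw [val_eq s x.2, val_eq t x.2] at h
  exact h

lemma val_mem {U : C.X.Opens} (s : Γ(C.divisorSheaf D, U)) {x : C.X} (hx : x ∈ U)
    (hc : IsClosed {x}) : val s = 0 ∨ 0 ≤ ord (val s) x + D x := by
  rw [val_eq s hx]
  exact (show (C.divisorSubmodule D).obj (op U) from s).2 ⟨x, hx⟩ hc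

/-- The section of `𝒪_C(D)` defined by a rational function. -/
def ofVal (D : C.X →₀ ℤ) (U : C.X.Opens) (f : C.K)
    (hf : ∀ x ∈ U, IsClosed {x} → f = 0 ∨ 0 ≤ ord f x + D x) : Γ(C.divisorSheaf D, U) :=
  show (C.divisorSubmodule D).obj (op U) from
    ⟨show rationalFunctions C.X U from ⟨fun _ => f, fun _ _ => rfl⟩, fun x hx => hf x.1 x.2 hx⟩

lemma val_ofVal {U : C.X.Opens} (h : genericPoint C.X ∈ U) (f : C.K)
    (hf : ∀ x ∈ U, IsClosed {x} → f = 0 ∨ 0 ≤ ord f x + D x) : val (ofVal D U f hf) = f := by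
  rw [val_eq _ h]
  rfl

lemma val_oneSection {hD : 0 ≤ D} {U : C.X.Opens} (h : genericPoint C.X ∈ U) :
    val (C.oneSection D hD U) = 1 := by
  rw [val_eq _ h]
  rfl

/-! ### Generators of divisor sheaves -/

lemma ord_zpow {f : C.K} (hf : f ≠ 0) (n : ℤ) (x : C.X) : ord (f ^ n) x = n * ord f x := by
  obtain ⟨m, rfl | rfl⟩ := n.eq_nat_or_neg
  · rw [zpow_natCast, ord_pow hf]
  · rw [zpow_neg, zpow_natCast, ord_inv (pow_ne_zero _ hf), ord_pow hf]
    ring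

/-- For every section t of 𝒪(D) the quotient t / s has no poles, so it is a function and the
coefficient of t. -/
lemma isGenerator_of_ord {U : C.X.Opens} {s : Γ(C.divisorSheaf D, U)} (h0 : val s ≠ 0)
    (h : ∀ x ∈ U, IsClosed {x} → ord (val s) x = - D x) : IsGenerator s := by
  intro V hV
  by_cases hη : genericPoint C.X ∈ V
  · have hv : val (res hV s) ≠ 0 := by rwa [val_res hV hη]
    refine ⟨fun a b hab => ?_, fun t => ?_⟩
    · have := congrArg val hab
      simp only [val_smul] at this
      exact fval_injective (mul_right_cancel₀ hv this)
    · obtain ⟨a, ha⟩ := exists_fval_eq hη (val t / val s) (by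
        intro x hx hc
        rcases val_mem t hx hc with h1 | h1
        · simp [h1]
        · by_cases ht : val t = 0
          · simp [ht]
          rw [ord_div ht h0, h x (hV hx) hc]
          linarith)
      refine ⟨a, val_injective ?_⟩
      rw [val_smul, ha, val_res hV hη, div_mul_cancel₀ _ h0]
  · have := subsingleton_of_genericPoint_notMem (M := C.divisorSheaf D) hη
    have h2 := subsingleton_of_genericPoint_notMem (M := structureSheaf C.X) hη
    exact ⟨fun a b _ => h2.elim a b, fun t => ⟨0, this.elim _ _⟩⟩

-- A power of a uniformizer has the right order at a closed point x (at the generic point 1 will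
-- do). It has the wrong order at only finitely many closed points, and these are removed.
variable (D) in
lemma exists_local_generator (x : C.X) : ∃ (U : C.X.Opens) (s : Γ(C.divisorSheaf D, U)), x ∈ U ∧
    val s ≠ 0 ∧ ∀ y ∈ U, IsClosed {y} → ord (val s) y = - D y := by
  obtain ⟨f, hf0, hf⟩ : ∃ f : C.K, f ≠ 0 ∧ (IsClosed {x} → ord f x = - D x) := by
    by_cases hx : IsClosed {x}
    · obtain ⟨t, ht0, ht⟩ := exists_ord_eq_one hx
      exact ⟨t ^ (- D x), zpow_ne_zero _ ht0, fun _ => by rw [ord_zpow ht0, ht, mul_one]⟩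
    · exact ⟨1, one_ne_zero, fun h => absurd h hx⟩
  let S : Set C.X := {y | IsClosed {y} ∧ ord f y ≠ - D y}
  have hS : S.Finite := by
    refine ((finite_ord_ne_zero f).union D.support.finite_toSet).subset ?_
    rintro y ⟨-, hy⟩
    by_contra h
    simp only [Set.mem_union, Set.mem_ofPred_eq, SetLike.mem_coe, Finsupp.mem_support_iff,
      not_or, not_not] at h
    rw [h.1, h.2] at hy
    exact hy (by simp)
  let U : C.X.Opens := complOpens S hS fun y hy => hy.1
  have hxU : x ∈ U := fun h => h.2 (hf h.1)
  have hU (y : C.X) (hy : y ∈ U) (hc : IsClosed {y}) : ord f y = - D y := by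
    by_contra h
    exact hy ⟨hc, h⟩
  have hmem : ∀ y ∈ U, IsClosed {y} → f = 0 ∨ 0 ≤ ord f y + D y := fun y hy hc =>
    Or.inr (by rw [hU y hy hc]; simp)
  refine ⟨U, ofVal D U f hmem, hxU, ?_⟩
  rw [val_ofVal (genericPoint_mem hxU)]
  exact ⟨hf0, hU⟩

variable (D) in
lemma exists_generator_divisorSheaf (x : C.X) :
    ∃ (U : C.X.Opens) (s : Γ(C.divisorSheaf D, U)), x ∈ U ∧ IsGenerator s := by
  obtain ⟨U, s, hx, h0, h⟩ := exists_local_generator D x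
  exact ⟨U, s, hx, isGenerator_of_ord h0 h⟩

variable (D) in
lemma isLineBundle_divisorSheaf : IsLineBundle (C.divisorSheaf D) :=
  isLineBundle_of_generators (exists_generator_divisorSheaf D)

/-- Two generators of a line bundle differ by an invertible function. -/
lemma exists_smul_eq_of_isGenerator {L : C.X.Modules} {U V : C.X.Opens} {g : Γ(L, U)}
    {g' : Γ(L, V)} (hg : IsGenerator g) (hg' : IsGenerator g') {W : C.X.Opens} (hU : W ≤ U)
    (hV : W ≤ V) : ∃ a : Γ(C.X, W), a • res hU g = res hV g' ∧
      ∀ x ∈ W, fval a ≠ 0 ∧ (IsClosed {x} → ord (fval a) x = 0) := by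
  obtain ⟨a, ha⟩ := hg.exists_smul hU (res hV g')
  obtain ⟨b, hb⟩ := hg'.exists_smul hV (res hU g)
  refine ⟨a, ha, fun x hx => ?_⟩
  have h1 : b * a = 1 := (hg W hU).1 (by
    beta_reduce
    rw [mul_smul, ha, hb, one_smul])
  have h2 : fval b * fval a = 1 := by
    rw [← fval_mul, h1, fval_eq (genericPoint_mem hx), map_one]
  have ha0 : fval a ≠ 0 := right_ne_zero_of_mul_eq_one h2
  refine ⟨ha0, fun hc => ?_⟩
  have h3 := congrArg (ord · x) h2
  simp only [Scheme.ord_mul (left_ne_zero_of_mul_eq_one h2) ha0, ord_one] at h3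
  have h4 := ord_fval_nonneg hx hc a
  have h5 := ord_fval_nonneg hx hc b
  omega

/-- Converse of `isGenerator_of_ord`: near x, s differs by a unit from a generator whose orders are
known. -/
lemma ord_val_of_isGenerator {U : C.X.Opens} {s : Γ(C.divisorSheaf D, U)} (hs : IsGenerator s)
    {x : C.X} (hx : x ∈ U) : val s ≠ 0 ∧ (IsClosed {x} → ord (val s) x = - D x) := by
  obtain ⟨V, t, hxV, ht0, ht⟩ := exists_local_generator D x
  obtain ⟨a, ha, ha'⟩ := exists_smul_eq_of_isGenerator (isGenerator_of_ord ht0 ht) hs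
    (inf_le_left : V ⊓ U ≤ V) inf_le_right
  obtain ⟨ha0, ha1⟩ := ha' x ⟨hxV, hx⟩
  have hη := genericPoint_mem (show x ∈ V ⊓ U from ⟨hxV, hx⟩)
  have h1 := congrArg val ha
  rw [val_smul, val_res _ hη, val_res _ hη] at h1
  rw [← h1]
  refine ⟨mul_ne_zero ha0 ht0, fun hc => ?_⟩
  rw [Scheme.ord_mul ha0 ht0, ha1 hc, ht x hxV hc, zero_add]

/-- A morphism to a divisor sheaf, described by rational functions. -/
def homToDivisorSheaf {M : C.X.Modules} (D : C.X →₀ ℤ) (v : ∀ U : C.X.Opens, Γ(M, U) → C.K)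
    (hadd : ∀ U s t, genericPoint C.X ∈ U → v U (s + t) = v U s + v U t)
    (hsmul : ∀ U (a : Γ(C.X, U)) s, genericPoint C.X ∈ U → v U (a • s) = fval a * v U s)
    (hres : ∀ U V (i : V ≤ U) s, genericPoint C.X ∈ V → v V (res i s) = v U s)
    (hmem : ∀ U s, ∀ x ∈ U, IsClosed {x} → v U s = 0 ∨ 0 ≤ ord (v U s) x + D x) :
    M ⟶ C.divisorSheaf D :=
  homMk (fun U =>
    { toFun := fun s => ofVal D U (v U s) (hmem U s)
      map_add' := fun s t => by
        by_cases h : genericPoint C.X ∈ U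
        · apply val_injective
          simp only [val_add, val_ofVal h, hadd U s t h]
        · exact (subsingleton_of_genericPoint_notMem h).elim _ _
      map_smul' := fun a s => by
        by_cases h : genericPoint C.X ∈ U
        · apply val_injective
          simp only [RingHom.id_apply, val_smul, val_ofVal h, hsmul U a s h]
        · exact (subsingleton_of_genericPoint_notMem h).elim _ _ })
    (fun U V i s => by
      by_cases h : genericPoint C.X ∈ V
      · apply val_injective
        exact (val_ofVal h _ (hmem V _)).trans ((hres U V i s h).trans
          ((val_res i h _).trans (val_ofVal (i h) _ (hmem U s))).symm)
      · exact (subsingleton_of_genericPoint_notMem h).elim _ _)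

lemma val_homToDivisorSheaf {M : C.X.Modules} (v : ∀ U : C.X.Opens, Γ(M, U) → C.K)
    (hadd) (hsmul) (hres) (hmem) {U : C.X.Opens} (h : genericPoint C.X ∈ U) (s : Γ(M, U)) :
    val ((homToDivisorSheaf D v hadd hsmul hres hmem).app U s) = v U s :=
  val_ofVal h _ (hmem U s)

/-- Multiplication by a rational function. -/
lemma exists_iso_of_ord {f : C.K} (hf : f ≠ 0)
    (h : ∀ x : C.X, IsClosed {x} → D x = D' x + ord f x) :
    ∃ e : C.divisorSheaf D ≅ C.divisorSheaf D',
      ∀ (U : C.X.Opens) (s : Γ(C.divisorSheaf D, U)), genericPoint C.X ∈ U →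
        val (e.hom.app U s) = f * val s := by
  let φ : C.divisorSheaf D ⟶ C.divisorSheaf D' := homToDivisorSheaf D' (fun U s => f * val s)
    (fun U s t _ => by rw [val_add, mul_add])
    (fun U a s _ => by rw [val_smul, mul_left_comm])
    (fun U V i s hV => by rw [val_res i hV])
    (fun U s x hx hc => by
      by_cases h0 : val s = 0
      · simp [h0]
      right
      rw [Scheme.ord_mul hf h0]
      have h1 := (val_mem s hx hc).resolve_left h0
      have h2 := h x hc
      omega)
  have hφ (U : C.X.Opens) (s : Γ(C.divisorSheaf D, U)) (hU : genericPoint C.X ∈ U) :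
      val (φ.app U s) = f * val s := val_homToDivisorSheaf _ _ _ _ _ hU s
  have : IsIso φ := isIso_of_isGenerator φ fun x => by
    obtain ⟨U, s, hx, h0, hs⟩ := exists_local_generator D x
    refine ⟨U, s, hx, isGenerator_of_ord h0 hs, isGenerator_of_ord ?_ ?_⟩
    · rw [hφ U s (genericPoint_mem hx)]
      exact mul_ne_zero hf h0
    · intro y hy hc
      rw [hφ U s (genericPoint_mem hx), Scheme.ord_mul hf h0, hs y hy hc]
      have h2 := h y hc
      omega
  exact ⟨asIso φ, hφ⟩

/-- Divisors with isomorphic sheaves are linearly equivalent. -/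
lemma exists_ord_of_iso (e : C.divisorSheaf D ≅ C.divisorSheaf D') :
    ∃ f : C.K, f ≠ 0 ∧ ∀ x : C.X, IsClosed {x} → D x = D' x + ord f x := by
  obtain ⟨U, s, hη, hs⟩ := exists_generator_divisorSheaf D (genericPoint C.X)
  have hs0 := (ord_val_of_isGenerator hs hη).1
  have he0 := (ord_val_of_isGenerator (hs.map e.hom) hη).1
  -- By linearity the ratio e(s) / s is the same for all generators s, so at x it may be computed
  -- with a generator defined near x.
  refine ⟨val (e.hom.app U s) / val s, div_ne_zero he0 hs0, fun x hc => ?_⟩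
  obtain ⟨V, t, hxV, ht⟩ := exists_generator_divisorSheaf D x
  obtain ⟨ht0, ht1⟩ := ord_val_of_isGenerator ht hxV
  obtain ⟨et0, et1⟩ := ord_val_of_isGenerator (ht.map e.hom) hxV
  have hη' : genericPoint C.X ∈ U ⊓ V := ⟨hη, genericPoint_mem hxV⟩
  obtain ⟨a, ha, ha'⟩ := exists_smul_eq_of_isGenerator hs ht (inf_le_left : U ⊓ V ≤ U)
    inf_le_right
  obtain ⟨ha0, -⟩ := ha' _ hη'
  have h1 := congrArg val ha
  have h2 := congrArg (fun w => val (e.hom.app _ w)) ha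
  simp only [Scheme.Modules.Hom.app_smul, app_res, val_smul, val_res _ hη'] at h1 h2
  have h3 : val (e.hom.app U s) / val s = val (e.hom.app V t) / val t := by
    rw [← h1, ← h2, mul_div_mul_left _ _ ha0]
  rw [h3, ord_div et0 ht0, et1 hc, ht1 hc]
  ring

/-- Every line bundle on a curve is isomorphic to the sheaf of a divisor. -/
lemma exists_iso_divisorSheaf {L : C.X.Modules} (hL : IsLineBundle L) :
    ∃ D : C.X →₀ ℤ, Nonempty (L ≅ C.divisorSheaf D) := by
  choose U g hxU hg using hL.exists_generator
  set η := genericPoint C.X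
  have hη (x : C.X) : η ∈ U x := genericPoint_mem (hxU x)
  -- The generator g_η at the generic point η serves as a rational section of L: the value v(s) of a
  -- section s is its coefficient with respect to g_η. The divisor sought is then minus the order of
  -- v on local generators.
  have ex (V : C.X.Opens) (s : Γ(L, V)) : ∃ f : C.K, ∀ (W : C.X.Opens) (hV : W ≤ V)
      (hU : W ≤ U η) (a : Γ(C.X, W)), η ∈ W → a • res hU (g η) = res hV s → fval a = f := by
    obtain ⟨a, ha⟩ := (hg η).exists_smul (inf_le_right : V ⊓ U η ≤ U η) (res inf_le_left s)
    refine ⟨fval a, fun W hV hU b hW hb => ?_⟩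
    have h1 : b = resO (le_inf hV hU) a := (hg η W hU).1 (by
      have := congrArg (res (le_inf hV hU)) ha
      simp only [res_smul, res_res] at this
      exact hb.trans this.symm)
    rw [h1, fval_resO _ hW]
  choose v hv using ex
  have hv' (V : C.X.Opens) (s : Γ(L, V)) (hV : η ∈ V) : ∃ a : Γ(C.X, V ⊓ U η),
      a • res inf_le_right (g η) = res inf_le_left s ∧ fval a = v V s := by
    obtain ⟨a, ha⟩ := (hg η).exists_smul (inf_le_right : V ⊓ U η ≤ U η) (res inf_le_left s)
    exact ⟨a, ha, hv V s _ _ _ a ⟨hV, hη η⟩ ha⟩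
  have hadd (V : C.X.Opens) (s t : Γ(L, V)) (hV : η ∈ V) : v V (s + t) = v V s + v V t := by
    obtain ⟨a, ha, ha'⟩ := hv' V s hV
    obtain ⟨b, hb, hb'⟩ := hv' V t hV
    rw [← ha', ← hb', ← fval_add]
    refine (hv V _ _ inf_le_left inf_le_right _ ⟨hV, hη η⟩ ?_).symm
    rw [add_smul, ha, hb, map_add]
  have hsmul (V : C.X.Opens) (r : Γ(C.X, V)) (s : Γ(L, V)) (hV : η ∈ V) :
      v V (r • s) = fval r * v V s := by
    obtain ⟨a, ha, ha'⟩ := hv' V s hV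
    rw [← ha', ← fval_resO (inf_le_left : V ⊓ U η ≤ V) ⟨hV, hη η⟩, ← fval_mul]
    refine (hv V _ _ inf_le_left inf_le_right _ ⟨hV, hη η⟩ ?_).symm
    rw [mul_smul, ha, res_smul]
  have hres (V W : C.X.Opens) (i : W ≤ V) (s : Γ(L, V)) (hW : η ∈ W) :
      v W (res i s) = v V s := by
    obtain ⟨a, ha, ha'⟩ := hv' W (res i s) hW
    rw [← ha']
    refine hv V s _ (inf_le_left.trans i) inf_le_right a ⟨hW, hη η⟩ ?_
    rw [ha, res_res]
  have hgen (V : C.X.Opens) (s : Γ(L, V)) (hs : IsGenerator s) (hV : η ∈ V) : v V s ≠ 0 := by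
    obtain ⟨a, ha, ha'⟩ := exists_smul_eq_of_isGenerator (hg η) hs
      (inf_le_right : V ⊓ U η ≤ U η) inf_le_left
    rw [← hv V s _ _ _ a ⟨hV, hη η⟩ ha]
    exact (ha' η ⟨hV, hη η⟩).1
  have hord (V V' : C.X.Opens) (s : Γ(L, V)) (s' : Γ(L, V')) (hs : IsGenerator s)
      (hs' : IsGenerator s') (x : C.X) (hx : x ∈ V) (hx' : x ∈ V') (hc : IsClosed {x}) :
      ord (v V s) x = ord (v V' s') x := by
    obtain ⟨a, ha, ha'⟩ := exists_smul_eq_of_isGenerator hs hs' (inf_le_left : V ⊓ V' ≤ V)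
      inf_le_right
    obtain ⟨ha0, ha1⟩ := ha' x ⟨hx, hx'⟩
    have h : η ∈ V ⊓ V' := genericPoint_mem (show x ∈ V ⊓ V' from ⟨hx, hx'⟩)
    have h1 := congrArg (v _) ha
    rw [hsmul _ _ _ h, hres _ _ _ _ h, hres _ _ _ _ h] at h1
    rw [← h1, Scheme.ord_mul ha0 (hgen V s hs (genericPoint_mem hx)), ha1 hc, zero_add]
  have hone : v _ (g η) = 1 := by
    rw [← map_one (toK (hη η)), ← fval_eq]
    refine (hv _ _ _ le_rfl le_rfl 1 (hη η) ?_).symm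
    rw [one_smul]
  -- On the domain of g_η that generator has value 1, so only the finitely many points outside it
  -- can contribute.
  let S : Set C.X := {x | IsClosed {x} ∧ ord (v (U x) (g x)) x ≠ 0}
  have hS : S.Finite := by
    refine (finite_compl (hη η)).subset ?_
    rintro x ⟨hc, hx⟩ hxη
    refine hx ?_
    rw [hord _ _ _ _ (hg x) (hg η) x (hxU x) hxη hc, hone, ord_one]
  classical
  let D : C.X →₀ ℤ := Finsupp.onFinset hS.toFinset
    (fun x => if IsClosed {x} then - ord (v (U x) (g x)) x else 0) (by
      intro x hx
      rw [Set.Finite.mem_toFinset]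
      by_cases hc : IsClosed {x}
      · simp only [if_pos hc, ne_eq, neg_eq_zero] at hx
        exact ⟨hc, hx⟩
      · simp [hc] at hx)
  have hD (x : C.X) (hc : IsClosed {x}) : D x = - ord (v (U x) (g x)) x := by
    simp [D, hc]
  refine ⟨D, ?_⟩
  let φ : L ⟶ C.divisorSheaf D := homToDivisorSheaf D v hadd hsmul hres (by
    intro V s x hx hc
    by_cases h0 : v V s = 0
    · exact Or.inl h0
    right
    obtain ⟨a, ha⟩ := (hg x).exists_smul (inf_le_right : V ⊓ U x ≤ U x) (res inf_le_left s)
    have hη' : η ∈ V ⊓ U x := genericPoint_mem (show x ∈ V ⊓ U x from ⟨hx, hxU x⟩)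
    have h1 := congrArg (v _) ha
    rw [hsmul _ _ _ hη', hres _ _ _ _ hη', hres _ _ _ _ hη'] at h1
    rw [← h1] at h0 ⊢
    rw [hD x hc, Scheme.ord_mul (left_ne_zero_of_mul h0) (right_ne_zero_of_mul h0)]
    have h2 := ord_fval_nonneg (show x ∈ V ⊓ U x from ⟨hx, hxU x⟩) hc a
    omega)
  have : IsIso φ := isIso_of_isGenerator φ fun x => by
    refine ⟨U x, g x, hxU x, hg x, isGenerator_of_ord ?_ ?_⟩
    · rw [val_homToDivisorSheaf _ _ _ _ _ (hη x)]
      exact hgen _ _ (hg x) (hη x)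
    · intro y hy hc
      rw [val_homToDivisorSheaf _ _ _ _ _ (hη x), hD y hc, neg_neg]
      exact hord _ _ _ _ (hg x) (hg y) y hy (hxU y) hc
  exact ⟨asIso φ⟩

end DivisorSheaf

end Curve

open Curve

/-! ### Tensor products of divisor sheaves -/

section TensorDivisor

variable {C : Curve} {D D' D'' : C.X →₀ ℤ}

lemma mem_mul {U : C.X.Opens} (h : ∀ x, IsClosed {x} → D'' x = D x + D' x)
    (s : Γ(C.divisorSheaf D, U)) (t : Γ(C.divisorSheaf D', U)) (x : C.X) (hx : x ∈ U)
    (hc : IsClosed {x}) : val s * val t = 0 ∨ 0 ≤ ord (val s * val t) x + D'' x := by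
  rcases val_mem s hx hc with h1 | h1
  · simp [h1]
  rcases val_mem t hx hc with h2 | h2
  · simp [h2]
  by_cases hs : val s = 0
  · simp [hs]
  by_cases ht : val t = 0
  · simp [ht]
  right
  rw [Scheme.ord_mul hs ht, h x hc]
  linarith

/-- The multiplication `𝒪_C(D) ⊗ 𝒪_C(D') ⟶ 𝒪_C(D + D')`. -/
def divisorMul (h : ∀ x, IsClosed {x} → D'' x = D x + D' x) :
    tensor (C.divisorSheaf D) (C.divisorSheaf D') ⟶ C.divisorSheaf D'' :=
  tensorLift (fun U => LinearMap.mk₂ Γ(C.X, U)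
    (fun s t => ofVal D'' U (val s * val t) (mem_mul h s t))
    (fun s s' t => by
      by_cases hU : genericPoint C.X ∈ U
      · apply val_injective
        simp only [val_add, val_ofVal hU, add_mul]
      · exact (subsingleton_of_genericPoint_notMem hU).elim _ _)
    (fun a s t => by
      by_cases hU : genericPoint C.X ∈ U
      · apply val_injective
        simp only [val_smul, val_ofVal hU, mul_assoc]
      · exact (subsingleton_of_genericPoint_notMem hU).elim _ _)
    (fun s t t' => by
      by_cases hU : genericPoint C.X ∈ U
      · apply val_injective
        simp only [val_add, val_ofVal hU, mul_add]
      · exact (subsingleton_of_genericPoint_notMem hU).elim _ _)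
    (fun a s t => by
      by_cases hU : genericPoint C.X ∈ U
      · apply val_injective
        simp only [val_smul, val_ofVal hU, mul_left_comm]
      · exact (subsingleton_of_genericPoint_notMem hU).elim _ _))
    (fun U V i s t => by
      by_cases hV : genericPoint C.X ∈ V
      · apply val_injective
        simp only [LinearMap.mk₂_apply, val_res i hV, val_ofVal hV, val_ofVal (i hV)]
      · exact (subsingleton_of_genericPoint_notMem hV).elim _ _)

lemma val_divisorMul (h : ∀ x, IsClosed {x} → D'' x = D x + D' x) {U : C.X.Opens}
    (s : Γ(C.divisorSheaf D, U)) (t : Γ(C.divisorSheaf D', U)) :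
    val ((divisorMul h).app U (tmul s t)) = val s * val t := by
  by_cases hU : genericPoint C.X ∈ U
  · rw [divisorMul, tensorLift_tmul]
    exact val_ofVal hU _ (mem_mul h s t)
  · simp [val_of_notMem hU]

/-- Sections of the tensor product, a sheafification, are awkward to describe, so the inverse is
built from the target: it sends the generator s t back to s ⊗ t. That it is an inverse is checked on
generators of the target and on pure tensors. -/
lemma isIso_divisorMul (h : ∀ x, IsClosed {x} → D'' x = D x + D' x) : IsIso (divisorMul h) := by
  choose U₁ s hx₁ hs using exists_generator_divisorSheaf D
  choose U₂ t hx₂ ht using exists_generator_divisorSheaf D'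
  let U (x : C.X) : C.X.Opens := U₁ x ⊓ U₂ x
  have hxU (x : C.X) : x ∈ U x := ⟨hx₁ x, hx₂ x⟩
  let s' (x : C.X) : Γ(C.divisorSheaf D, U x) := res inf_le_left (s x)
  let t' (x : C.X) : Γ(C.divisorSheaf D', U x) := res inf_le_right (t x)
  have hs' (x : C.X) : IsGenerator (s' x) := (hs x).res _
  have ht' (x : C.X) : IsGenerator (t' x) := (ht x).res _
  let g (x : C.X) := (divisorMul h).app (U x) (tmul (s' x) (t' x))
  have hg (x : C.X) : IsGenerator (g x) := by
    refine isGenerator_of_ord ?_ fun y hy hc => ?_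
    · rw [val_divisorMul]
      exact mul_ne_zero (ord_val_of_isGenerator (hs' x) (hxU x)).1
        (ord_val_of_isGenerator (ht' x) (hxU x)).1
    · obtain ⟨hs0, hs1⟩ := ord_val_of_isGenerator (hs' x) hy
      obtain ⟨ht0, ht1⟩ := ord_val_of_isGenerator (ht' x) hy
      rw [val_divisorMul, Scheme.ord_mul hs0 ht0, hs1 hc, ht1 hc, h y hc]
      ring
  obtain ⟨ψ, hψ⟩ := exists_hom_of_generators U (fun x => ⟨x, hxU x⟩) g hg
    (fun x => tmul (s' x) (t' x)) (by
      intro x y W hx hy a ha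
      obtain ⟨b, hb⟩ := (hs' x).exists_smul hx (res hy (s' y))
      obtain ⟨c, hc⟩ := (ht' x).exists_smul hx (res hy (t' y))
      have : a = b * c := (hg x W hx).1 (by
        beta_reduce
        rw [ha]
        simp only [g]
        rw [← app_res, ← app_res, res_tmul, res_tmul, ← hb, ← hc, smul_tmul, tmul_smul,
          Scheme.Modules.Hom.app_smul, Scheme.Modules.Hom.app_smul, mul_smul])
      rw [this, res_tmul, res_tmul, ← hb, ← hc, smul_tmul, tmul_smul, mul_smul])
  refine ⟨ψ, tensor_hom_ext fun V a b => section_ext fun x hx => ?_,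
    hom_ext_of_generators fun x => ⟨U x, g x, hxU x, hg x, ?_⟩⟩
  · refine ⟨V ⊓ U x, inf_le_left, ⟨hx, hxU x⟩, ?_⟩
    obtain ⟨c, hc⟩ := (hs' x).exists_smul (inf_le_right : V ⊓ U x ≤ U x) (res inf_le_left a)
    obtain ⟨d, hd⟩ := (ht' x).exists_smul (inf_le_right : V ⊓ U x ≤ U x) (res inf_le_left b)
    rw [← app_res, ← app_res, res_tmul, ← hc, ← hd, smul_tmul, tmul_smul,
      Scheme.Modules.Hom.app_smul, Scheme.Modules.Hom.app_smul, Scheme.Modules.Hom.app_smul,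
      Scheme.Modules.Hom.app_smul, ← res_tmul, app_res, app_res]
    congr 3
    exact hψ x
  · exact congrArg ((divisorMul h).app (U x)) (hψ x)

end TensorDivisor

/-! ### Inverse images of divisor sheaves -/

section PullbackDivisor

variable {C B : Curve} (f : C.X ⟶ B.X) (hf : f (genericPoint C.X) = genericPoint B.X)

include hf in
lemma genericPoint_mem_preimage_iff {U : B.X.Opens} :
    genericPoint C.X ∈ f ⁻¹ᵁ U ↔ genericPoint B.X ∈ U := by
  change f _ ∈ U ↔ _
  rw [hf]

/-- A morphism to the direct image of a divisor sheaf, described by rational functions. -/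
def homToPushforward {M : B.X.Modules} (D : C.X →₀ ℤ) (v : ∀ U : B.X.Opens, Γ(M, U) → C.K)
    (hadd : ∀ U s t, genericPoint B.X ∈ U → v U (s + t) = v U s + v U t)
    (hsmul : ∀ U (a : Γ(B.X, U)) s, genericPoint B.X ∈ U →
      v U (a • s) = funcMap f hf (fval a) * v U s)
    (hres : ∀ U V (i : V ≤ U) s, genericPoint B.X ∈ V → v V (res i s) = v U s)
    (hmem : ∀ U s, ∀ x ∈ f ⁻¹ᵁ U, IsClosed {x} → v U s = 0 ∨ 0 ≤ ord (v U s) x + D x) :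
    M ⟶ (Scheme.Modules.pushforward f).obj (C.divisorSheaf D) :=
  homMk (fun U =>
    { toFun := fun s => ofVal D (f ⁻¹ᵁ U) (v U s) (hmem U s)
      map_add' := fun s t => by
        by_cases h : genericPoint C.X ∈ f ⁻¹ᵁ U
        · refine val_injective ((val_ofVal h _ (hmem U _)).trans ?_)
          refine (hadd U s t ((genericPoint_mem_preimage_iff f hf).mp h)).trans ?_
          refine Eq.trans ?_ (val_add _ _).symm
          rw [val_ofVal h, val_ofVal h]
        · exact (subsingleton_of_genericPoint_notMem (M := C.divisorSheaf D) h).elim _ _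
      map_smul' := fun a s => by
        by_cases h : genericPoint C.X ∈ f ⁻¹ᵁ U
        · refine val_injective ((val_ofVal h _ (hmem U _)).trans ?_)
          refine (hsmul U a s ((genericPoint_mem_preimage_iff f hf).mp h)).trans ?_
          refine Eq.trans ?_ (val_smul (f.app U a) _).symm
          rw [val_ofVal h, fval_app f hf]
        · exact (subsingleton_of_genericPoint_notMem (M := C.divisorSheaf D) h).elim _ _ })
    (fun U V i s => by
      by_cases h : genericPoint C.X ∈ f ⁻¹ᵁ V
      · refine val_injective ((val_ofVal h _ (hmem V _)).trans ?_)
        refine (hres U V i s ((genericPoint_mem_preimage_iff f hf).mp h)).trans ?_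
        exact ((val_res (f.preimage_mono i) h _).trans
          (val_ofVal (f.preimage_mono i h) _ (hmem U s))).symm
      · exact (subsingleton_of_genericPoint_notMem (M := C.divisorSheaf D) h).elim _ _)

lemma val_homToPushforward {M : B.X.Modules} (D : C.X →₀ ℤ) (v : ∀ U : B.X.Opens, Γ(M, U) → C.K)
    (hadd) (hsmul) (hres) (hmem) {U : B.X.Opens} (h : genericPoint B.X ∈ U) (s : Γ(M, U)) :
    val (show Γ(C.divisorSheaf D, f ⁻¹ᵁ U) from
      (homToPushforward f hf D v hadd hsmul hres hmem).app U s) = v U s :=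
  val_ofVal ((genericPoint_mem_preimage_iff f hf).mpr h) _ (hmem U s)

variable {D : B.X →₀ ℤ} {D' : C.X →₀ ℤ}

/-- `D'` is the inverse image of the divisor `D`. -/
def IsPullbackDivisor (D : B.X →₀ ℤ) (D' : C.X →₀ ℤ) : Prop :=
  ∀ x : C.X, IsClosed {x} → IsClosed {f x} ∧ ∃ e : ℤ, 0 ≤ e ∧
    (∀ b : B.K, ord (funcMap f hf b) x = e * ord b (f x)) ∧ D' x = e * D (f x)

variable (hD : IsPullbackDivisor f hf D D')

/-- The morphism `π^* 𝒪_B(D) ⟶ 𝒪_C(π^* D)`. -/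
def divisorPullback : (Scheme.Modules.pullback f).obj (B.divisorSheaf D) ⟶ C.divisorSheaf D' :=
  pullbackLift f (homToPushforward f hf D' (fun U s => funcMap f hf (val s))
    (fun U s t _ => by rw [val_add, map_add])
    (fun U a s _ => by rw [val_smul, map_mul])
    (fun U V i s hV => by rw [val_res i hV])
    (fun U s x hx hc => by
      by_cases h0 : val s = 0
      · simp [h0]
      right
      obtain ⟨hc', e, he, h1, h2⟩ := hD x hc
      rw [h1, h2, ← mul_add]
      exact mul_nonneg he ((val_mem s hx hc').resolve_left h0)))

lemma val_divisorPullback {U : B.X.Opens} (s : Γ(B.divisorSheaf D, U)) :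
    val ((divisorPullback f hf hD).app (f ⁻¹ᵁ U) (pullbackSection f s)) =
      funcMap f hf (val s) := by
  by_cases hU : genericPoint B.X ∈ U
  · rw [divisorPullback, pullbackLift_pullbackSection]
    exact val_homToPushforward f hf D' (fun U s => funcMap f hf (val s)) _ _ _ _ hU s
  · rw [val_of_notMem hU, val_of_notMem ((genericPoint_mem_preimage_iff f hf).not.mpr hU), map_zero]

/-- As in `isIso_divisorMul`, the inverse is prescribed on the generators that are pulled back from
B, whose transition functions are pulled back as well. -/
lemma isIso_divisorPullback : IsIso (divisorPullback f hf hD) := by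
  choose U s hxU hs using exists_generator_divisorSheaf D
  let g (x : C.X) := (divisorPullback f hf hD).app (f ⁻¹ᵁ (U (f x))) (pullbackSection f (s (f x)))
  have hg (x : C.X) : IsGenerator (g x) := by
    refine isGenerator_of_ord ?_ fun y hy hc => ?_
    · rw [val_divisorPullback]
      exact (map_ne_zero _).mpr (ord_val_of_isGenerator (hs (f x)) (hxU (f x))).1
    · obtain ⟨hc', e, he, h1, h2⟩ := hD y hc
      rw [val_divisorPullback, h1, h2, (ord_val_of_isGenerator (hs (f x)) hy).2 hc']
      ring
  obtain ⟨ψ, hψ⟩ := exists_hom_of_generators (fun x => f ⁻¹ᵁ (U (f x))) (fun x => ⟨x, hxU _⟩) g hg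
    (fun x => pullbackSection f (s (f x))) (by
      intro x y W hx hy a ha
      obtain ⟨b, hb⟩ := (hs (f x)).exists_smul
        (inf_le_left : U (f x) ⊓ U (f y) ≤ U (f x)) (res inf_le_right (s (f y)))
      have hW : W ≤ f ⁻¹ᵁ (U (f x) ⊓ U (f y)) := le_inf hx hy
      have key : resO hW (f.app _ b) • res hx (pullbackSection f (s (f x))) =
          res hy (pullbackSection f (s (f y))) := by
        have h1 := congrArg (fun w => res hW (pullbackSection f w)) hb
        simpa only [pullbackSection_smul, res_smul, ← res_pullbackSection, res_res] using h1
      have : a = resO hW (f.app _ b) := (hg x W hx).1 (by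
        beta_reduce
        rw [ha]
        simp only [g]
        rw [← app_res, ← app_res, ← key, Scheme.Modules.Hom.app_smul])
      rw [this, key])
  refine ⟨ψ, pullback_hom_ext f fun V a => section_ext fun x hx => ?_,
    hom_ext_of_generators fun x => ⟨f ⁻¹ᵁ (U (f x)), g x, hxU _, hg x, ?_⟩⟩
  · refine ⟨f ⁻¹ᵁ (V ⊓ U (f x)), f.preimage_mono (inf_le_left : V ⊓ U (f x) ≤ V), ⟨hx, hxU (f x)⟩, ?_⟩
    obtain ⟨c, hc⟩ := (hs (f x)).exists_smul (inf_le_right : V ⊓ U (f x) ≤ U (f x))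
      (res inf_le_left a)
    rw [← app_res, ← app_res, res_pullbackSection f (inf_le_left : V ⊓ U (f x) ≤ V), ← hc,
      pullbackSection_smul,
      Scheme.Modules.Hom.app_smul, Scheme.Modules.Hom.app_smul, ← res_pullbackSection, app_res,
      app_res]
    congr 2
    exact hψ x
  · exact congrArg ((divisorPullback f hf hD).app (f ⁻¹ᵁ (U (f x)))) (hψ x)

end PullbackDivisor

/-- The image of a dense point under a surjective map is dense. -/
lemma map_genericPoint {C B : Curve} (f : C.X ⟶ B.X) (hf : Function.Surjective f) :
    f (genericPoint C.X) = genericPoint B.X := by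
  have h := (genericPoint_spec C.X).image f.continuous
  rw [Set.image_univ, hf.range_eq, closure_univ] at h
  exact h.eq (genericPoint_spec B.X)

/-! ### The involution and the quotient on function fields -/

/-- A non-trivial involution of a curve together with its quotient. -/
structure QuotientData (C B : Curve) where
  /-- the involution -/
  σ : C.X ⟶ C.X
  σ_str : σ ≫ C.str = C.str
  σ_σ : σ ≫ σ = 𝟙 C.X
  σ_ne : σ ≠ 𝟙 C.X
  /-- the quotient map -/
  π : C.X ⟶ B.X
  π_str : π ≫ B.str = C.str
  isQuotient : IsQuotient σ π

namespace QuotientData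

variable {C B : Curve} (I : QuotientData C B)

lemma σ_apply_apply (x : C.X) : I.σ (I.σ x) = x := by
  rw [← Scheme.Hom.comp_apply, I.σ_σ]
  rfl

lemma π_σ (x : C.X) : I.π (I.σ x) = I.π x := by
  rw [← Scheme.Hom.comp_apply, I.isQuotient.invariant]

lemma π_surjective : Function.Surjective I.π := I.isQuotient.isQuotientMap.surjective

lemma σ_genericPoint : I.σ (genericPoint C.X) = genericPoint C.X :=
  map_genericPoint I.σ fun x => ⟨I.σ x, I.σ_apply_apply x⟩

lemma π_genericPoint : I.π (genericPoint C.X) = genericPoint B.X :=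
  map_genericPoint I.π I.π_surjective

/-- The involution of the function field. -/
def s : C.K →+* C.K := funcMap I.σ I.σ_genericPoint

/-- The inclusion of function fields. -/
def p : B.K →+* C.K := funcMap I.π I.π_genericPoint

lemma s_s (f : C.K) : I.s (I.s f) = f := by
  have h : (I.σ ≫ I.σ) (genericPoint C.X) = genericPoint C.X := by
    rw [I.σ_σ]
    rfl
  have h1 := funcMap_comp I.σ I.σ_genericPoint I.σ I.σ_genericPoint h f
  refine h1.symm.trans ?_
  have h2 : 𝟙 C.X (genericPoint C.X) = genericPoint C.X := rfl
  refine Eq.trans ?_ (funcMap_id h2 f)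
  congr 1
  simp only [I.σ_σ]

lemma s_p (b : B.K) : I.s (I.p b) = I.p b := by
  have h : (I.σ ≫ I.π) (genericPoint C.X) = genericPoint B.X := by
    rw [I.isQuotient.invariant]
    exact I.π_genericPoint
  refine (funcMap_comp I.π I.π_genericPoint I.σ I.σ_genericPoint h b).symm.trans ?_
  unfold p
  congr 1
  simp only [I.isQuotient.invariant]

lemma s_const (c : ℂ) : I.s (C.const c) = C.const c :=
  funcMap_const I.σ I.σ_genericPoint I.σ_str c

lemma isClosed_σ {x : C.X} (hx : IsClosed {x}) : IsClosed {I.σ x} := by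
  have h : {I.σ x} = I.σ ⁻¹' {x} := by
    ext y
    simp only [Set.mem_singleton_iff, Set.mem_preimage]
    constructor
    · rintro rfl
      exact I.σ_apply_apply x
    · rintro rfl
      exact (I.σ_apply_apply y).symm
  rw [h]
  exact hx.preimage I.σ.continuous

/-- The fibre {x, σ x} is closed and B carries the quotient topology. -/
lemma isClosed_π {x : C.X} (hx : IsClosed {x}) : IsClosed {I.π x} := by
  rw [← I.isQuotient.isQuotientMap.isClosed_preimage]
  have h : I.π ⁻¹' {I.π x} = {x} ∪ {I.σ x} := by
    ext y
    simp only [Set.mem_singleton_iff, Set.mem_preimage, Set.mem_union]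
    constructor
    · intro h
      exact I.isQuotient.fibre x y h.symm
    · rintro (rfl | rfl)
      · rfl
      · exact I.π_σ x
  rw [h]
  exact hx.union (I.isClosed_σ hx)

lemma isClosed_of_π {x : C.X} (hx : IsClosed {I.π x}) : IsClosed {x} := by
  rcases isClosed_or_eq_genericPoint x with h | rfl
  · exact h
  · rw [I.π_genericPoint] at hx
    exact absurd hx not_isClosed_genericPoint

/-- Applied to s(t), for t of order 1 at x, the index e of σ satisfies 1 = e · ord s(t), so e = 1.
-/
lemma ord_s {x : C.X} (hx : IsClosed {x}) (f : C.K) : ord (I.s f) x = ord f (I.σ x) := by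
  obtain ⟨e, he, h⟩ := exists_ramificationIndex I.σ I.σ_genericPoint hx (I.isClosed_σ hx)
  obtain ⟨e', he', h'⟩ := exists_ramificationIndex I.σ I.σ_genericPoint (I.isClosed_σ hx)
    (I.isClosed_σ (I.isClosed_σ hx))
  obtain ⟨t, -, ht⟩ := exists_ord_eq_one hx
  have h1 := h (I.s t)
  rw [show funcMap I.σ I.σ_genericPoint (I.s t) = t from I.s_s t, ht] at h1
  have h2 : 1 ≤ ord (I.s t) (I.σ x) := by nlinarith
  have h3 : e = 1 := by nlinarith
  have h4 := h f
  rwa [h3, one_mul] at h4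

lemma fval_appLE {U V : C.X.Opens} (h : V ≤ I.σ ⁻¹ᵁ U) (hV : genericPoint C.X ∈ V)
    (a : Γ(C.X, U)) : fval (I.σ.appLE U V h a) = I.s (fval a) := by
  have h1 : I.σ.appLE U V h a = resO h (I.σ.app U a) := rfl
  rw [h1, fval_resO h hV, fval_app I.σ I.σ_genericPoint]
  rfl

/-- The invariant rational functions come from the quotient. -/
lemma exists_p_eq {f : C.K} (hf : I.s f = f) : ∃ b, I.p b = f := by
  obtain ⟨V, hV, a, rfl⟩ := exists_toK f
  -- This set is σ-stable, hence the preimage of its image, which is therefore open; invariant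
  -- functions on it descend.
  let W : C.X.Opens := V ⊓ I.σ ⁻¹ᵁ V
  have hW : genericPoint C.X ∈ W :=
    ⟨hV, genericPoint_mem_preimage I.σ I.σ_genericPoint hV⟩
  have hpre : I.π ⁻¹' (I.π '' (W : Set C.X)) = W := by
    refine Set.Subset.antisymm ?_ (Set.subset_preimage_image _ _)
    rintro x ⟨y, hy, hxy⟩
    rcases I.isQuotient.fibre y x hxy with rfl | rfl
    · exact hy
    · refine ⟨hy.2, ?_⟩
      change I.σ (I.σ y) ∈ V
      rw [I.σ_apply_apply]
      exact hy.1
  let U : B.X.Opens := ⟨I.π '' (W : Set C.X), by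
    rw [← I.isQuotient.isQuotientMap.isOpen_preimage, hpre]
    exact W.isOpen⟩
  have hUW : I.π ⁻¹ᵁ U = W := Opens.ext hpre
  have hU : genericPoint C.X ∈ I.π ⁻¹ᵁ U := hUW ▸ hW
  have hle : I.π ⁻¹ᵁ U ≤ V := hUW.le.trans inf_le_left
  let a' : Γ(C.X, I.π ⁻¹ᵁ U) := resO hle a
  have ha' : fval a' = toK hV a := by rw [fval_resO hle hU, fval_eq hV]
  obtain ⟨b, hb⟩ := I.isQuotient.app_range U (preimage_le I.isQuotient.invariant U) a'
    (fval_injective (by rw [I.fval_appLE _ hU, ha', hf]))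
  refine ⟨fval b, ?_⟩
  rw [p, ← fval_app, hb, ha']

/-- There is a non-zero anti-invariant rational function. -/
lemma exists_anti : ∃ a : C.K, a ≠ 0 ∧ I.s a = - a := by
  obtain ⟨f, hf⟩ : ∃ f, I.s f ≠ f := by
    by_contra! h
    have h2 : 𝟙 C.X (genericPoint C.X) = genericPoint C.X := rfl
    refine I.σ_ne (hom_ext_of_funcMap I.σ_genericPoint h2 fun b => ?_)
    rw [funcMap_id]
    exact h b
  refine ⟨f - I.s f, sub_ne_zero.mpr hf.symm, ?_⟩
  rw [map_sub, I.s_s, neg_sub]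

/-- A fixed anti-invariant rational function. -/
def a₀ : C.K := I.exists_anti.choose

lemma a₀_ne : I.a₀ ≠ 0 := I.exists_anti.choose_spec.1

lemma s_a₀ : I.s I.a₀ = - I.a₀ := I.exists_anti.choose_spec.2

lemma two_ne : (2 : C.K) ≠ 0 := by
  have : (2 : C.K) = C.const 2 := (map_ofNat C.const 2).symm
  rw [this]
  simp

lemma ord_two (x : C.X) : ord (2 : C.K) x = 0 := by
  have : (2 : C.K) = C.const 2 := (map_ofNat C.const 2).symm
  rw [this]
  exact ord_const 2 x

/-! ### Ramification -/

section Fixed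

variable {x : C.X} (hx : IsClosed {x}) (hσ : I.σ x = x)

include hx hσ

/-- If v had order 0, its value d at the fixed point would satisfy d = -d, because s fixes the
constants. In terms of orders: v - d and its image under s both vanish at x, and their sum is -2d.
-/
lemma ord_ne_zero_of_anti {v : C.K} (hv : v ≠ 0) (h : I.s v = - v) : ord v x ≠ 0 := by
  intro h0
  have := C.isDVR x hx
  obtain ⟨d, hd⟩ := exists_ord_sub_const hx h0.ge
  have hd2 : I.s (v - C.const d) = - v - C.const d := by rw [map_sub, h, I.s_const]
  have hsum : (v - C.const d) + I.s (v - C.const d) = - (2 * C.const d) := by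
    rw [hd2]
    ring
  have hd' : I.s (v - C.const d) = 0 ∨ 1 ≤ ord (I.s (v - C.const d)) x := by
    rw [I.ord_s hx, hσ]
    exact hd.imp_left fun h => by rw [h, map_zero]
  have hd0 : d = 0 := by
    by_contra hd0
    have hc : C.const d ≠ 0 := by simpa using hd0
    have hne : (2 : C.K) * C.const d ≠ 0 := mul_ne_zero two_ne hc
    have h2 : ord ((v - C.const d) + I.s (v - C.const d)) x = 0 := by
      rw [hsum, ord_neg, Scheme.ord_mul two_ne hc, ord_two, ord_const, zero_add]
    have h3 := Scheme.ord_add (x := x) (f := v - C.const d) (g := I.s (v - C.const d))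
      (by rw [hsum]; exact neg_ne_zero.mpr hne)
    rcases hd with h4 | h4
    · rw [h4, map_zero, add_zero] at hsum
      exact neg_ne_zero.mpr hne hsum.symm
    · rcases hd' with h5 | h5
      · rw [h5, add_zero] at h2
        omega
      · rw [h2] at h3
        rcases min_le_iff.mp h3 with h6 | h6 <;> omega
  rw [hd0, map_zero, sub_zero, h0] at hd
  rcases hd with h | h
  · exact hv h
  · omega

/-- For a uniformizer t, write 2t = (t + s t) + (t - s t). If the invariant part had order 1,
dividing a₀ by one of its powers would give an anti-invariant function of order 0. So t - s t has
order 1. -/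
lemma exists_anti_uniformizer : ∃ t : C.K, t ≠ 0 ∧ I.s t = - t ∧ ord t x = 1 := by
  have := C.isDVR x hx
  obtain ⟨t, ht0, ht⟩ := exists_ord_eq_one hx
  have hst0 : I.s t ≠ 0 := by simpa using ht0
  have hst : ord (I.s t) x = 1 := by rw [I.ord_s hx, hσ, ht]
  have h1 : t + I.s t = 0 ∨ 1 ≤ ord (t + I.s t) x := by
    by_cases h : t + I.s t = 0
    · exact Or.inl h
    · have := Scheme.ord_add (x := x) h
      rw [ht, hst, min_self] at this
      exact Or.inr this
  have hplus : t + I.s t ≠ 0 → ord (t + I.s t) x ≠ 1 := by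
    intro h0 h
    refine I.ord_ne_zero_of_anti hx hσ (v := I.a₀ / (t + I.s t) ^ (ord I.a₀ x))
      (div_ne_zero I.a₀_ne (zpow_ne_zero _ h0)) ?_ ?_
    · rw [map_div₀, map_zpow₀, map_add, I.s_s, I.s_a₀, add_comm (I.s t), neg_div]
    · rw [ord_div I.a₀_ne (zpow_ne_zero _ h0), ord_zpow h0, h]
      ring
  have hsub : t - I.s t ≠ 0 ∧ ord (t - I.s t) x = 1 := by
    have he : t - I.s t = 2 * t + -(t + I.s t) := by ring
    have h2 : ord (2 * t) x = 1 := by rw [Scheme.ord_mul two_ne ht0, ord_two, ht, zero_add]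
    by_cases h0 : t + I.s t = 0
    · rw [he, h0, neg_zero, add_zero]
      exact ⟨mul_ne_zero two_ne ht0, h2⟩
    · have h3 := h1.resolve_left h0
      have h4 := hplus h0
      have := ord_add_of_lt hx (f := 2 * t) (g := -(t + I.s t)) (mul_ne_zero two_ne ht0)
        (by rw [h2, ord_neg]; omega)
      rw [he, this.2, h2]
      exact ⟨this.1, rfl⟩
  exact ⟨t - I.s t, hsub.1, by rw [map_sub, I.s_s, neg_sub], hsub.2⟩

/-- Dividing by an even power of an anti-invariant uniformizer preserves anti-invariance and would
leave order 0. -/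
lemma odd_ord {f : C.K} (hf : f ≠ 0) (h : I.s f = - f) : Odd (ord f x) := by
  obtain ⟨t, ht0, hst, ht⟩ := I.exists_anti_uniformizer hx hσ
  by_contra hodd
  rw [Int.not_odd_iff_even] at hodd
  refine I.ord_ne_zero_of_anti hx hσ (v := f / t ^ (ord f x))
    (div_ne_zero hf (zpow_ne_zero _ ht0)) ?_ ?_
  · rw [map_div₀, map_zpow₀, hst, h, hodd.neg_zpow, neg_div]
  · rw [ord_div hf (zpow_ne_zero _ ht0), ord_zpow ht0, ht]
    ring

/-- Dividing by an odd power of an anti-invariant uniformizer would make f anti-invariant of order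
0. -/
lemma even_ord {f : C.K} (hf : f ≠ 0) (h : I.s f = f) : Even (ord f x) := by
  obtain ⟨t, ht0, hst, ht⟩ := I.exists_anti_uniformizer hx hσ
  by_contra hodd
  rw [Int.not_even_iff_odd] at hodd
  refine I.ord_ne_zero_of_anti hx hσ (v := f / t ^ (ord f x))
    (div_ne_zero hf (zpow_ne_zero _ ht0)) ?_ ?_
  · rw [map_div₀, map_zpow₀, hst, h, hodd.neg_zpow, div_neg]
  · rw [ord_div hf (zpow_ne_zero _ ht0), ord_zpow ht0, ht]
    ring

/-- The square of an anti-invariant uniformizer comes from B, so the index divides 2; it is even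
because invariant functions have even order. -/
lemma ord_p_of_fixed (b : B.K) : ord (I.p b) x = 2 * ord b (I.π x) := by
  obtain ⟨e, he, h⟩ := exists_ramificationIndex I.π I.π_genericPoint hx (I.isClosed_π hx)
  obtain ⟨t, ht0, hst, ht⟩ := I.exists_anti_uniformizer hx hσ
  obtain ⟨c, hc⟩ := I.exists_p_eq (f := t ^ 2) (by rw [map_pow, hst, neg_sq])
  have h1 : ord (t ^ 2) x = 2 := by rw [ord_pow ht0, ht]; rfl
  rw [← hc, show I.p c = funcMap I.π I.π_genericPoint c from rfl, h c] at h1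
  obtain ⟨u, hu0, hu⟩ := exists_ord_eq_one (I.isClosed_π hx)
  have h2 := h u
  rw [hu, mul_one] at h2
  have h3 : Even e := by
    rw [← h2]
    exact I.even_ord hx hσ (by simpa using hu0) (I.s_p u)
  have h4 : e ≤ 2 := Int.le_of_dvd (by norm_num) ⟨_, h1.symm⟩
  obtain ⟨k, hk⟩ := h3
  have h5 : e = 2 := by omega
  rw [← h5]
  exact h b

end Fixed

/-- By weak approximation some f has order 1 at x and 0 at σ x. Its norm f · s(f) comes from B and
has order 1 at x, so the index divides 1. -/
lemma ord_p_of_ne {x : C.X} (hx : IsClosed {x}) (hσ : I.σ x ≠ x) (b : B.K) :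
    ord (I.p b) x = ord b (I.π x) := by
  obtain ⟨e, he, h⟩ := exists_ramificationIndex I.π I.π_genericPoint hx (I.isClosed_π hx)
  obtain ⟨f, hf0, hf1, hf2⟩ := exists_ord_eq_one_and_eq_zero hx (I.isClosed_σ hx) hσ.symm
  obtain ⟨c, hc⟩ := I.exists_p_eq (f := f * I.s f) (by rw [map_mul, I.s_s, mul_comm])
  have h1 : ord (f * I.s f) x = 1 := by
    rw [Scheme.ord_mul hf0 (by simpa using hf0), I.ord_s hx, hf1, hf2, add_zero]
  rw [← hc, show I.p c = funcMap I.π I.π_genericPoint c from rfl, h c] at h1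
  have h2 : e ≤ 1 := Int.le_of_dvd (by norm_num) ⟨_, h1.symm⟩
  have h3 : e = 1 := by omega
  have h4 := h b
  rwa [h3, one_mul] at h4

open Classical in
/-- The ramification index of the quotient map. -/
def e (x : C.X) : ℤ := if I.σ x = x then 2 else 1

lemma ord_p {x : C.X} (hx : IsClosed {x}) (b : B.K) :
    ord (I.p b) x = I.e x * ord b (I.π x) := by
  unfold e
  split_ifs with h
  · exact I.ord_p_of_fixed hx h b
  · rw [one_mul]
    exact I.ord_p_of_ne hx h b

lemma e_pos (x : C.X) : 0 < I.e x := by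
  unfold e
  split_ifs <;> norm_num

lemma e_σ (x : C.X) : I.e (I.σ x) = I.e x := by
  unfold e
  congr 1
  rw [I.σ_apply_apply]
  exact propext eq_comm

/-- Every fixed closed point is a zero or a pole of a₀. -/
lemma finite_fixedLocus : (fixedLocus I.σ).Finite := by
  refine (finite_ord_ne_zero I.a₀).subset ?_
  rintro x ⟨hx, hσ⟩
  exact I.ord_ne_zero_of_anti hx hσ I.a₀_ne I.s_a₀

end QuotientData

open Classical in
lemma Curve.divisorOf_apply {C : Curve} {E : Set C.X} (hE : E.Finite) (x : C.X) :
    C.divisorOf E x = if x ∈ E then 1 else 0 := by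
  rw [divisorOf, finsum_mem_eq_finite_toFinset_sum _ hE, Finsupp.finsetSum_apply]
  simp [Finsupp.single_apply]

namespace QuotientData

variable {C B : Curve} (I : QuotientData C B)

/-! ### Divisors on a curve and its quotient -/

/-- The set of ramification points. -/
abbrev R : Set C.X := fixedLocus I.σ

variable {E : Set C.X} (hE : E ⊆ I.R)

include hE in
open Classical in
lemma divisorOf_apply (x : C.X) : C.divisorOf E x = if x ∈ E then 1 else 0 :=
  Curve.divisorOf_apply (I.finite_fixedLocus.subset hE) x

-- The fibre through a fixed point is a single point, so distinct points of E have distinct images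
-- and no other point maps to them.
include hE in
lemma pushDivisor_apply (x : C.X) :
    pushDivisor I.π (C.divisorOf E) (I.π x) = C.divisorOf E x := by
  classical
  have hf := I.finite_fixedLocus.subset hE
  rw [I.divisorOf_apply hE, divisorOf, finsum_mem_eq_finite_toFinset_sum _ hf, pushDivisor,
    Finsupp.mapDomain_finsetSum, Finsupp.finsetSum_apply]
  have h (p : C.X) (hp : p ∈ hf.toFinset) :
      (Finsupp.mapDomain I.π (Finsupp.single p 1) : B.X →₀ ℤ) (I.π x) = if p = x then 1 else 0 := by
    rw [Finsupp.mapDomain_single, Finsupp.single_apply]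
    congr 1
    refine propext ⟨fun h => ?_, congrArg _⟩
    rcases I.isQuotient.fibre p x h with h | h
    · exact h.symm
    · rw [h, (hE (hf.mem_toFinset.mp hp)).2]
  rw [Finset.sum_congr rfl h]
  simp

lemma exists_divisor_of_invariant (F : C.X → ℤ) (hF : {x | IsClosed {x} ∧ F x ≠ 0}.Finite)
    (hσ : ∀ x, IsClosed {x} → F (I.σ x) = F x) :
    ∃ D : B.X →₀ ℤ, ∀ x, IsClosed {x} → D (I.π x) = F x := by
  classical
  -- The value at y is read at a chosen preimage; by invariance the choice is irrelevant. It is set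
  -- to 0 at the generic point, where F is not controlled.
  let r := Function.surjInv I.π_surjective
  have hr (y : B.X) : I.π (r y) = y := Function.surjInv_eq I.π_surjective y
  refine ⟨Finsupp.onFinset (hF.toFinset.image I.π)
    (fun y => if IsClosed {r y} then F (r y) else 0) fun y hy => ?_, fun x hx => ?_⟩
  · have h1 : IsClosed {r y} := by
      by_contra h
      simp [h] at hy
    rw [if_pos h1] at hy
    exact Finset.mem_image.mpr ⟨r y, hF.mem_toFinset.mpr ⟨h1, hy⟩, hr y⟩
  · have h1 : IsClosed {r (I.π x)} := I.isClosed_of_π (by rw [hr]; exact I.isClosed_π hx)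
    rw [Finsupp.onFinset_apply, if_pos h1]
    rcases I.isQuotient.fibre x (r (I.π x)) (hr _).symm with h | h
    · rw [h]
    · rw [h, hσ x hx]

/-- The inverse image of a divisor on the quotient. -/
def pull (D : B.X →₀ ℤ) : C.X →₀ ℤ :=
  Finsupp.ofSupportFinite (fun x => I.e x * D (I.π x)) (by
    refine Set.Finite.subset (s := I.π ⁻¹' (D.support : Set B.X)) ?_ fun x hx => ?_
    · refine D.support.finite_toSet.preimage' fun b _ => ?_
      obtain ⟨x, rfl⟩ := I.π_surjective b
      refine Set.Finite.subset (Set.toFinite {x, I.σ x}) fun y hy => ?_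
      exact I.isQuotient.fibre x y hy.symm
    · simp only [Set.mem_preimage, Finset.mem_coe, Finsupp.mem_support_iff]
      intro h
      simp [h] at hx)

lemma pull_apply (D : B.X →₀ ℤ) (x : C.X) : I.pull D x = I.e x * D (I.π x) := rfl

lemma isPullbackDivisor_pull (D : B.X →₀ ℤ) :
    IsPullbackDivisor I.π I.π_genericPoint D (I.pull D) :=
  fun x hx => ⟨I.isClosed_π hx, I.e x, (I.e_pos x).le, I.ord_p hx, rfl⟩

lemma e_of_mem {x : C.X} (hx : x ∈ I.R) : I.e x = 2 := if_pos hx.2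

lemma e_of_notMem {x : C.X} (hc : IsClosed {x}) (hx : x ∉ I.R) : I.e x = 1 :=
  if_neg fun h => hx ⟨hc, h⟩

lemma divisorOf_R_of_mem {x : C.X} (hx : x ∈ I.R) : C.divisorOf I.R x = 1 := by
  rw [I.divisorOf_apply subset_rfl, if_pos hx]

lemma divisorOf_of_notMem {x : C.X} (hE : E ⊆ I.R) (hx : x ∉ I.R) : C.divisorOf E x = 0 := by
  rw [I.divisorOf_apply hE, if_neg fun h => hx (hE h)]

lemma divisorOf_eq_or (hE : E ⊆ I.R) (x : C.X) : C.divisorOf E x = 0 ∨ C.divisorOf E x = 1 := by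
  rw [I.divisorOf_apply hE]
  split_ifs <;> simp

lemma divisorOf_diff (hE : E ⊆ I.R) (x : C.X) :
    C.divisorOf (I.R \ E) x = C.divisorOf I.R x - C.divisorOf E x := by
  rw [I.divisorOf_apply hE, I.divisorOf_apply subset_rfl, I.divisorOf_apply Set.sdiff_subset]
  by_cases h1 : x ∈ E
  · simp [h1, hE h1]
  · rw [if_neg h1, sub_zero]
    by_cases hR : x ∈ I.R
    · rw [if_pos hR, if_pos ⟨hR, h1⟩]
    · rw [if_neg hR, if_neg fun h => hR h.1]

lemma divisorOf_σ (hE : E ⊆ I.R) (x : C.X) : C.divisorOf E (I.σ x) = C.divisorOf E x := by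
  rw [I.divisorOf_apply hE, I.divisorOf_apply hE]
  congr 1
  refine propext ⟨fun h => ?_, fun h => ?_⟩
  · have := (hE h).2
    rw [I.σ_apply_apply] at this
    rwa [this]
  · rwa [(hE h).2]

lemma pull_σ (D : B.X →₀ ℤ) (x : C.X) : I.pull D (I.σ x) = I.pull D x := by
  rw [pull_apply, pull_apply, I.e_σ, I.π_σ]

/-- The divisor of a₀ is σ-invariant and odd along R, so div a₀ - R is divisible by the ramification
indices and descends to B. -/
lemma exists_divisor_anti : ∃ D : B.X →₀ ℤ, ∀ x, IsClosed {x} →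
    I.e x * D (I.π x) = ord I.a₀ x - C.divisorOf I.R x := by
  have hord (x : C.X) (hx : IsClosed {x}) : ord I.a₀ (I.σ x) = ord I.a₀ x := by
    rw [← I.ord_s hx, I.s_a₀, ord_neg]
  obtain ⟨D, hD⟩ := I.exists_divisor_of_invariant
    (fun x => (ord I.a₀ x - C.divisorOf I.R x) / I.e x) (by
      refine ((finite_ord_ne_zero I.a₀).union I.finite_fixedLocus).subset ?_
      rintro x ⟨-, h⟩
      by_contra h'
      rw [Set.mem_union, not_or] at h'
      refine h ?_
      have h1 : ord I.a₀ x = 0 := not_not.mp h'.1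
      simp [h1, I.divisorOf_of_notMem subset_rfl h'.2])
    (fun x hx => by rw [hord x hx, I.e_σ, I.divisorOf_σ subset_rfl])
  refine ⟨D, fun x hx => ?_⟩
  rw [hD x hx, Int.mul_ediv_cancel']
  by_cases hR : x ∈ I.R
  · rw [I.e_of_mem hR, I.divisorOf_R_of_mem hR]
    obtain ⟨k, hk⟩ := I.odd_ord hx hR.2 I.a₀_ne I.s_a₀
    exact ⟨k, by rw [hk]; ring⟩
  · rw [I.e_of_notMem hx hR]
    exact one_dvd _

/-- The divisor on the quotient which describes `ρ⁻¹`. -/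
def D₀ : B.X →₀ ℤ := I.exists_divisor_anti.choose

lemma e_mul_D₀ {x : C.X} (hx : IsClosed {x}) :
    I.e x * I.D₀ (I.π x) = ord I.a₀ x - C.divisorOf I.R x :=
  I.exists_divisor_anti.choose_spec x hx

/-- The divisor on the quotient which describes `ρ⁻¹(π_* E)`. -/
def D₁ (E : Set C.X) : B.X →₀ ℤ := I.D₀ + pushDivisor I.π (C.divisorOf E)

include hE in
lemma D₁_apply (x : C.X) : I.D₁ E (I.π x) = I.D₀ (I.π x) + C.divisorOf E x := by
  rw [D₁, Finsupp.add_apply, I.pushDivisor_apply hE]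

lemma p_ne_zero {b : B.K} (hb : b ≠ 0) : I.p b ≠ 0 := (map_ne_zero I.p).mpr hb

lemma p_injective : Function.Injective I.p := I.p.injective

lemma s_a₀_mul_p (b : B.K) : I.s (I.a₀ * I.p b) = - (I.a₀ * I.p b) := by
  rw [map_mul, I.s_a₀, I.s_p, neg_mul]

lemma exists_a₀_mul_p_eq {f : C.K} (hf : I.s f = - f) : ∃ b, I.a₀ * I.p b = f := by
  obtain ⟨b, hb⟩ := I.exists_p_eq (f := f / I.a₀) (by rw [map_div₀, hf, I.s_a₀, neg_div_neg_eq])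
  exact ⟨b, by rw [hb, mul_div_cancel₀ _ I.a₀_ne]⟩

-- At a ramification point, with n = ord b + D and ε ∈ {0, 1} the multiplicity of E, the condition
-- 2n + ε ≥ 0 is equivalent to n ≥ 0.
include hE in
lemma p_mem_iff (D : B.X →₀ ℤ) {x : C.X} (hx : IsClosed {x}) (b : B.K) :
    (I.p b = 0 ∨ 0 ≤ ord (I.p b) x + (I.pull D + C.divisorOf E) x) ↔
      (b = 0 ∨ 0 ≤ ord b (I.π x) + D (I.π x)) := by
  rw [map_eq_zero, I.ord_p hx, Finsupp.add_apply, pull_apply]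
  refine or_congr_right ?_
  have h := I.divisorOf_eq_or hE x
  by_cases hR : x ∈ I.R
  · rw [I.e_of_mem hR]
    omega
  · rw [I.e_of_notMem hx hR, I.divisorOf_of_notMem hE hR]
    omega

-- At a ramification point a₀ has order 2D₀ + 1. With n = ord b + D + D₀ and ε the multiplicity of
-- E, the condition 2n + 1 + ε ≥ 0 is equivalent to n + ε ≥ 0 for both values of ε.
include hE in
lemma a₀_mul_p_mem_iff (D : B.X →₀ ℤ) {x : C.X} (hx : IsClosed {x}) (b : B.K) :
    (I.a₀ * I.p b = 0 ∨ 0 ≤ ord (I.a₀ * I.p b) x + (I.pull D + C.divisorOf E) x) ↔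
      (b = 0 ∨ 0 ≤ ord b (I.π x) + (D + I.D₁ E) (I.π x)) := by
  rw [mul_eq_zero, map_eq_zero, or_iff_right I.a₀_ne]
  by_cases hb : b = 0
  · simp [hb]
  refine or_congr_right ?_
  rw [Scheme.ord_mul I.a₀_ne (I.p_ne_zero hb), I.ord_p hx, Finsupp.add_apply, pull_apply,
    Finsupp.add_apply, I.D₁_apply hE]
  have h0 := I.e_mul_D₀ hx
  have h := I.divisorOf_eq_or hE x
  by_cases hR : x ∈ I.R
  · rw [I.e_of_mem hR, I.divisorOf_R_of_mem hR] at *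
    omega
  · rw [I.e_of_notMem hx hR, I.divisorOf_of_notMem subset_rfl hR] at *
    rw [I.divisorOf_of_notMem hE hR]
    omega

/-! ### The sheaf of anti-invariant functions -/

/-- A left inverse of the inclusion of function fields. -/
def pinv : C.K → B.K := Function.invFun I.p

lemma p_pinv {f : C.K} (hf : I.s f = f) : I.p (I.pinv f) = f :=
  Function.invFun_eq (I.exists_p_eq hf)

/-- The sheaf `ρ⁻¹`. -/
abbrev ρinv : B.X.Modules := rhoInv I.σ I.π I.isQuotient.invariant

section

variable {I} {U : B.X.Opens}

lemma rhoInvFun_add (a b : Γ(I.ρinv, U)) : rhoInvFun (a + b) = rhoInvFun a + rhoInvFun b := rfl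

lemma rhoInvFun_smul (r : Γ(B.X, U)) (a : Γ(I.ρinv, U)) :
    rhoInvFun (r • a) = I.π.app U r * rhoInvFun a := rfl

lemma rhoInvFun_res {V : B.X.Opens} (i : V ≤ U) (a : Γ(I.ρinv, U)) :
    rhoInvFun (res i a) = resO (I.π.preimage_mono i) (rhoInvFun a) := rfl

lemma rhoInvFun_injective : Function.Injective (rhoInvFun : Γ(I.ρinv, U) → _) :=
  fun _ _ h => Subtype.ext h

lemma s_fval_rhoInvFun (a : Γ(I.ρinv, U)) : I.s (fval (rhoInvFun a)) = - fval (rhoInvFun a) := by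
  by_cases hU : genericPoint C.X ∈ I.π ⁻¹ᵁ U
  · have h : I.σ.appLE _ _ (preimage_le I.isQuotient.invariant U) (rhoInvFun a) =
        - rhoInvFun a := (show (antiInvariantSubmodule _ _ _).obj (op U) from a).2
    rw [← I.fval_appLE (preimage_le I.isQuotient.invariant U) hU, h, fval_eq hU, fval_eq hU,
      map_neg]
  · simp [fval, hU]

lemma p_pinv_rhoInvFun (a : Γ(I.ρinv, U)) :
    I.p (I.pinv (fval (rhoInvFun a) / I.a₀)) = fval (rhoInvFun a) / I.a₀ :=
  I.p_pinv (by rw [map_div₀, s_fval_rhoInvFun, I.s_a₀, neg_div_neg_eq])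

lemma pull_zero : I.pull 0 = 0 := by
  ext x
  simp [pull_apply]

lemma D₁_empty : I.D₁ ∅ = I.D₀ := by
  simp [D₁, divisorOf, pushDivisor]

/-- The case D = 0, E = ∅ of `a₀_mul_p_mem_iff`; b = 0 needs no exception on the left because the
order of 0 is 0. -/
lemma regular_iff {x : C.X} (hx : IsClosed {x}) (b : B.K) :
    0 ≤ ord (I.a₀ * I.p b) x ↔ b = 0 ∨ 0 ≤ ord b (I.π x) + I.D₀ (I.π x) := by
  have h := I.a₀_mul_p_mem_iff (Set.empty_subset _) 0 hx b
  rw [D₁_empty, zero_add, pull_zero] at h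
  rw [← h]
  by_cases hb : I.a₀ * I.p b = 0
  · simp [hb]
  · simp [hb, divisorOf]

end

/-- The morphism `ρ⁻¹ ⟶ 𝒪_B(D₀)`, `a ↦ a / a₀`. -/
def rhoHom : I.ρinv ⟶ B.divisorSheaf I.D₀ :=
  homToDivisorSheaf I.D₀ (fun U a => I.pinv (fval (rhoInvFun a) / I.a₀))
    (fun U a b _ => I.p_injective (by
      rw [map_add, p_pinv_rhoInvFun, p_pinv_rhoInvFun, p_pinv_rhoInvFun, rhoInvFun_add, fval_add,
        add_div]))
    (fun U r a _ => I.p_injective (by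
      rw [map_mul, p_pinv_rhoInvFun, p_pinv_rhoInvFun, rhoInvFun_smul, fval_mul,
        fval_app _ I.π_genericPoint, mul_div_assoc]
      rfl))
    (fun U V i a hV => I.p_injective (by
      rw [p_pinv_rhoInvFun, p_pinv_rhoInvFun, rhoInvFun_res, fval_resO _
        ((genericPoint_mem_preimage_iff _ I.π_genericPoint).mpr hV)]))
    (fun U a y hy hc => by
      obtain ⟨x, rfl⟩ := I.π_surjective y
      have hx := I.isClosed_of_π hc
      rw [← regular_iff hx, p_pinv_rhoInvFun, mul_div_cancel₀ _ I.a₀_ne]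
      exact ord_fval_nonneg (U := I.π ⁻¹ᵁ U) hy hx _)

lemma a₀_mul_p_val_rhoHom {U : B.X.Opens} (a : Γ(I.ρinv, U)) :
    I.a₀ * I.p (val (I.rhoHom.app U a)) = fval (rhoInvFun a) := by
  by_cases hU : genericPoint B.X ∈ U
  · rw [rhoHom, val_homToDivisorSheaf (hmem := _) (h := hU), p_pinv_rhoInvFun,
      mul_div_cancel₀ _ I.a₀_ne]
  · rw [val_of_notMem hU, map_zero, mul_zero, fval, dif_neg]
    exact (genericPoint_mem_preimage_iff _ I.π_genericPoint).not.mpr hU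

/-- For a section t of 𝒪(D₀) the function a₀p(t) is anti-invariant, and regular by `regular_iff`. -/
instance : IsIso I.rhoHom := by
  refine isIso_of_bijective _ fun U => ⟨fun a b h => ?_, fun t => ?_⟩
  · apply rhoInvFun_injective
    apply fval_injective
    rw [← a₀_mul_p_val_rhoHom, ← a₀_mul_p_val_rhoHom, h]
  · by_cases hU : genericPoint B.X ∈ U
    · have hU' := (genericPoint_mem_preimage_iff _ I.π_genericPoint).mpr hU
      obtain ⟨a, ha⟩ := exists_fval_eq hU' (I.a₀ * I.p (val t)) fun x hx hc =>
        (regular_iff hc _).mpr (val_mem t hx (I.isClosed_π hc))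
      refine ⟨show (antiInvariantSubmodule _ _ _).obj (op U) from ⟨a, ?_⟩, val_injective ?_⟩
      · apply fval_injective
        rw [I.fval_appLE _ hU', ha, I.s_a₀_mul_p, ← ha, fval_eq hU', fval_eq hU', map_neg]
      · apply I.p_injective
        apply mul_left_cancel₀ I.a₀_ne
        exact (I.a₀_mul_p_val_rhoHom _).trans ha
    · exact ⟨0, (subsingleton_of_genericPoint_notMem hU).elim _ _⟩

end QuotientData

/-! ### Functoriality of the tensor product in both factors -/

section TensorIso

variable {X : Scheme.{0}} {L L' N N' : X.Modules}

/-- The morphism `L ⊗ N ⟶ L' ⊗ N'` defined by `L ⟶ L'` and `N ⟶ N'`. -/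
def tensorMap₂ (f : L ⟶ L') (g : N ⟶ N') : tensor L N ⟶ tensor L' N' :=
  tensorLift (fun U => LinearMap.mk₂ Γ(X, U) (fun s t => tmul (f.app U s) (g.app U t))
    (fun s s' t => by rw [app_add, add_tmul])
    (fun a s t => by rw [Scheme.Modules.Hom.app_smul, smul_tmul])
    (fun s t t' => by rw [app_add, tmul_add])
    (fun a s t => by rw [Scheme.Modules.Hom.app_smul, tmul_smul]))
    (fun U V i s t => by simp only [LinearMap.mk₂_apply, app_res, res_tmul])

lemma tensorMap₂_tmul (f : L ⟶ L') (g : N ⟶ N') {U : X.Opens} (s : Γ(L, U)) (t : Γ(N, U)) :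
    (tensorMap₂ f g).app U (tmul s t) = tmul (f.app U s) (g.app U t) :=
  tensorLift_tmul _ _ _ _ _

instance (f : L ⟶ L') (g : N ⟶ N') [IsIso f] [IsIso g] : IsIso (tensorMap₂ f g) := by
  refine ⟨tensorMap₂ (inv f) (inv g), tensor_hom_ext fun U s t => ?_,
    tensor_hom_ext fun U s t => ?_⟩
  · change (tensorMap₂ (inv f) (inv g)).app U ((tensorMap₂ f g).app U (tmul s t)) = tmul s t
    rw [tensorMap₂_tmul, tensorMap₂_tmul]
    exact congrArg₂ tmul congr(($(IsIso.hom_inv_id f)).app U s)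
      congr(($(IsIso.hom_inv_id g)).app U t)
  · change (tensorMap₂ f g).app U ((tensorMap₂ (inv f) (inv g)).app U (tmul s t)) = tmul s t
    rw [tensorMap₂_tmul, tensorMap₂_tmul]
    exact congrArg₂ tmul congr(($(IsIso.inv_hom_id f)).app U s)
      congr(($(IsIso.inv_hom_id g)).app U t)

end TensorIso

lemma Curve.divisor_add_apply {C : Curve} (D D' : C.X →₀ ℤ) (x : C.X) (_ : IsClosed {x}) :
    (D + D') x = D x + D' x := rfl

instance {C : Curve} {D D' D'' : C.X →₀ ℤ} (h : ∀ x, IsClosed {x} → D'' x = D x + D' x) :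
    IsIso (divisorMul h) := isIso_divisorMul h

/-! ### The twists as divisor sheaves -/

namespace QuotientData

variable {C B : Curve} (I : QuotientData C B) (E : Set C.X)

/-- The sheaf `ρ⁻¹(π_* E)`. -/
abbrev ρinvTwist : B.X.Modules :=
  tensor I.ρinv (B.divisorSheaf (pushDivisor I.π (C.divisorOf E)))

lemma D₁_eq (y : B.X) (_ : IsClosed {y}) :
    I.D₁ E y = I.D₀ y + pushDivisor I.π (C.divisorOf E) y := rfl

/-- The isomorphism from `ρ⁻¹(π_* E)` to a divisor sheaf. -/
def rhoTwistHom : I.ρinvTwist E ⟶ B.divisorSheaf (I.D₁ E) :=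
  tensorMap₂ I.rhoHom (𝟙 _) ≫ divisorMul (I.D₁_eq E)

instance : IsIso (I.rhoTwistHom E) := by
  unfold rhoTwistHom
  infer_instance

variable {E}

lemma val_rhoTwistHom {U : B.X.Opens} (a : Γ(I.ρinv, U)) (f) :
    I.a₀ * I.p (val ((I.rhoTwistHom E).app U (tmul a f))) = fval (rhoInvFun a) * I.p (val f) := by
  have h : (I.rhoTwistHom E).app U (tmul a f) =
      (divisorMul (I.D₁_eq E)).app U ((tensorMap₂ I.rhoHom (𝟙 _)).app U (tmul a f)) :=
    rfl
  rw [h, tensorMap₂_tmul, val_divisorMul, map_mul, ← mul_assoc, a₀_mul_p_val_rhoHom]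
  rfl

variable {L : B.X.Modules} {D : B.X →₀ ℤ} (ε : L ≅ B.divisorSheaf D)

variable (E)

/-- The twist `π^* L (E)` as a divisor sheaf. -/
def pullbackTwistHom : pullbackTwist I.π L E ⟶ C.divisorSheaf (I.pull D + C.divisorOf E) :=
  tensorMap₂ ((Scheme.Modules.pullback I.π).map ε.hom ≫
    divisorPullback I.π I.π_genericPoint (I.isPullbackDivisor_pull D)) (𝟙 _) ≫
      divisorMul (divisor_add_apply (I.pull D) (C.divisorOf E))

instance : IsIso (I.pullbackTwistHom E ε) := by
  have := isIso_divisorPullback I.π I.π_genericPoint (I.isPullbackDivisor_pull D)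
  exact IsIso.comp_isIso' (f := tensorMap₂ ((Scheme.Modules.pullback I.π).map ε.hom ≫
    divisorPullback I.π I.π_genericPoint (I.isPullbackDivisor_pull D)) (𝟙 _))
    inferInstance inferInstance

/-- The twist `L ⊗ ρ⁻¹(π_* E)` as a divisor sheaf. -/
def rhoTwistDivisorHom : rhoTwist I.σ I.π I.isQuotient.invariant L E ⟶ B.divisorSheaf (D + I.D₁ E) :=
  tensorMap₂ ε.hom (I.rhoTwistHom E) ≫ divisorMul (divisor_add_apply D (I.D₁ E))

instance : IsIso (I.rhoTwistDivisorHom E ε) := by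
  exact IsIso.comp_isIso' (f := tensorMap₂ ε.hom (I.rhoTwistHom E)) inferInstance inferInstance

variable {E}

lemma val_pullbackTwistHom {U : B.X.Opens} (s : Γ(L, U)) (t) :
    val ((I.pullbackTwistHom E ε).app (I.π ⁻¹ᵁ U) (tmul (pullbackSection I.π s) t)) =
      I.p (val (ε.hom.app U s)) * val t := by
  have h : (I.pullbackTwistHom E ε).app (I.π ⁻¹ᵁ U) (tmul (pullbackSection I.π s) t) =
      (divisorMul (divisor_add_apply (I.pull D) (C.divisorOf E))).app (I.π ⁻¹ᵁ U)
        ((tensorMap₂ ((Scheme.Modules.pullback I.π).map ε.hom ≫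
          divisorPullback I.π I.π_genericPoint (I.isPullbackDivisor_pull D)) (𝟙 _)).app (I.π ⁻¹ᵁ U)
            (tmul (pullbackSection I.π s) t)) :=
    rfl
  rw [h, tensorMap₂_tmul, val_divisorMul, Scheme.Modules.Hom.comp_app]
  change val ((divisorPullback _ _ (I.isPullbackDivisor_pull D)).app _ (((Scheme.Modules.pullback I.π).map ε.hom).app _ _)) *
    val t = _
  rw [pullback_map_pullbackSection, val_divisorPullback]
  rfl

lemma val_rhoTwistDivisorHom {U : B.X.Opens} (s : Γ(L, U)) (t) :
    val ((I.rhoTwistDivisorHom E ε).app U (tmul s t)) =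
      val (ε.hom.app U s) * val ((I.rhoTwistHom E).app U t) := by
  have h : (I.rhoTwistDivisorHom E ε).app U (tmul s t) =
      (divisorMul (divisor_add_apply D (I.D₁ E))).app U
        ((tensorMap₂ ε.hom (I.rhoTwistHom E)).app U (tmul s t)) :=
    rfl
  rw [h, tensorMap₂_tmul, val_divisorMul]

/-! ### Invariant line bundles -/

lemma isLineBundle_rhoTwist (hL : IsLineBundle L) (E : Set C.X) :
    IsLineBundle (rhoTwist I.σ I.π I.isQuotient.invariant L E) := by
  obtain ⟨D, ⟨ε⟩⟩ := exists_iso_divisorSheaf hL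
  exact (isLineBundle_divisorSheaf _).of_iso (asIso (I.rhoTwistDivisorHom E ε)).symm

/-- Since π^*D₁ = div a₀ - R + 2E, the divisors π^*(D + D₁) + (R - E) and π^*D + E differ by div a₀.
-/
lemma exists_pullbackTwist_iso (hL : IsLineBundle L) (hE : E ⊆ I.R) :
    Nonempty (pullbackTwist I.π L E ≅
      pullbackTwist I.π (rhoTwist I.σ I.π I.isQuotient.invariant L E) (I.R \ E)) := by
  obtain ⟨D, ⟨ε⟩⟩ := exists_iso_divisorSheaf hL
  obtain ⟨e, -⟩ := exists_iso_of_ord (D := I.pull D + C.divisorOf E)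
    (D' := I.pull (D + I.D₁ E) + C.divisorOf (I.R \ E)) (inv_ne_zero I.a₀_ne) (fun x hx => by
      rw [ord_inv I.a₀_ne, Finsupp.add_apply, Finsupp.add_apply, pull_apply, pull_apply,
        Finsupp.add_apply, I.D₁_apply hE, I.divisorOf_diff hE, mul_add, mul_add, I.e_mul_D₀ hx]
      by_cases hR : x ∈ I.R
      · rw [I.e_of_mem hR]
        ring
      · rw [I.divisorOf_of_notMem hE hR]
        ring)
  exact ⟨asIso (I.pullbackTwistHom E ε) ≪≫ e ≪≫ (asIso (I.pullbackTwistHom (I.R \ E)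
    (asIso (I.rhoTwistDivisorHom E ε)))).symm⟩

lemma exists_const_eq_of_ord {f : C.K} (hf : ∀ x, IsClosed {x} → ord f x = 0) (hf0 : f ≠ 0) :
    ∃ c : ℂ, c ≠ 0 ∧ C.const c = f := by
  obtain ⟨c, hc⟩ := exists_const_of_ord_nonneg fun x hx => (hf x hx).ge
  refine ⟨c, fun h => hf0 ?_, hc⟩
  rw [← hc, h, map_zero]

/-- A rational function with invariant divisor is invariant or anti-invariant. -/
lemma s_eq_or_eq_neg {g : C.K} (hg : g ≠ 0) (h : ∀ x, IsClosed {x} → ord g (I.σ x) = ord g x) :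
    I.s g = g ∨ I.s g = - g := by
  have hs : I.s g ≠ 0 := (map_ne_zero I.s).mpr hg
  -- As s(g) and g have the same divisor, s(g) = c g with c constant, and s² = 1 gives c² = 1.
  obtain ⟨c, hc0, hc⟩ := exists_const_eq_of_ord (f := I.s g / g)
    (fun x hx => by rw [ord_div hs hg, I.ord_s hx, h x hx, sub_self]) (div_ne_zero hs hg)
  have h1 : I.s g = C.const c * g := by rw [hc, div_mul_cancel₀ _ hg]
  have h2 := I.s_s g
  rw [h1, map_mul, I.s_const, h1, ← mul_assoc] at h2
  have h3 : C.const c * C.const c = 1 := mul_right_cancel₀ hg (by rw [h2, one_mul])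
  rcases mul_self_eq_one_iff.mp h3 with h4 | h4
  · left
    rw [h1, h4, one_mul]
  · right
    rw [h1, h4, neg_one_mul]

lemma eq_of_divisorOf {E E' : Set C.X} (hE : E ⊆ I.R) (hE' : E' ⊆ I.R)
    (h : ∀ x ∈ I.R, C.divisorOf E x = C.divisorOf E' x) : E = E' := by
  ext x
  by_cases hR : x ∈ I.R
  · have := h x hR
    rw [I.divisorOf_apply hE, I.divisorOf_apply hE'] at this
    by_cases h1 : x ∈ E <;> by_cases h2 : x ∈ E' <;> simp_all
  · exact ⟨fun h => absurd (hE h) hR, fun h => absurd (hE' h) hR⟩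

/-- The isomorphism yields g with div g = (π^*D + E) - (π^*D' + E'), a σ-invariant divisor. If g is
invariant, its orders along R are even, so E = E' and g comes from a function on B with divisor D -
D'. If g is anti-invariant, they are odd, so E' is the complement of E, and g a₀ comes from a
function on B with divisor D + D₁ - D'. -/
lemma iso_or_iso {L' : B.X.Modules} {E' : Set C.X} (hL : IsLineBundle L) (hL' : IsLineBundle L')
    (hE : E ⊆ I.R) (hE' : E' ⊆ I.R) (i : pullbackTwist I.π L E ≅ pullbackTwist I.π L' E') :
    (Nonempty (L' ≅ L) ∧ E' = E) ∨
      (Nonempty (L' ≅ rhoTwist I.σ I.π I.isQuotient.invariant L E) ∧ E' = I.R \ E) := by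
  obtain ⟨D, ⟨ε⟩⟩ := exists_iso_divisorSheaf hL
  obtain ⟨D', ⟨ε'⟩⟩ := exists_iso_divisorSheaf hL'
  obtain ⟨g, hg0, hg⟩ := exists_ord_of_iso
    ((asIso (I.pullbackTwistHom E ε)).symm ≪≫ i ≪≫ asIso (I.pullbackTwistHom E' ε'))
  simp only [Finsupp.add_apply] at hg
  rcases I.s_eq_or_eq_neg hg0 (fun x hx => by
    have h1 := hg x hx
    have h2 := hg (I.σ x) (I.isClosed_σ hx)
    rw [I.pull_σ, I.pull_σ, I.divisorOf_σ hE, I.divisorOf_σ hE'] at h2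
    linarith) with hs | hs
  · left
    obtain ⟨b, rfl⟩ := I.exists_p_eq hs
    have hb0 : b ≠ 0 := fun h => hg0 (by rw [h, map_zero])
    have hEE : E = E' := I.eq_of_divisorOf hE hE' fun x hR => by
      have h1 := hg x hR.1
      have h2 := I.divisorOf_eq_or hE x
      have h3 := I.divisorOf_eq_or hE' x
      rw [I.ord_p hR.1, pull_apply, pull_apply, I.e_of_mem hR] at h1
      omega
    obtain ⟨e, -⟩ := exists_iso_of_ord (D := D) (D' := D') hb0 (fun y hy => by
      obtain ⟨x, rfl⟩ := I.π_surjective y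
      have hx := I.isClosed_of_π hy
      have h1 := hg x hx
      rw [I.ord_p hx, pull_apply, pull_apply, hEE] at h1
      have he := I.e_pos x
      refine mul_left_cancel₀ he.ne' ?_
      linarith)
    exact ⟨⟨ε' ≪≫ e.symm ≪≫ ε.symm⟩, hEE.symm⟩
  · right
    obtain ⟨c, hc⟩ := I.exists_p_eq (f := g * I.a₀) (by rw [map_mul, hs, I.s_a₀, neg_mul_neg])
    have hc0 : c ≠ 0 := by
      rintro rfl
      rw [map_zero] at hc
      exact mul_ne_zero hg0 I.a₀_ne hc.symm
    have hord (x : C.X) (hx : IsClosed {x}) :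
        ord g x = I.e x * ord c (I.π x) - I.e x * I.D₀ (I.π x) - C.divisorOf I.R x := by
      rw [← I.ord_p hx, hc, Scheme.ord_mul hg0 I.a₀_ne, I.e_mul_D₀ hx]
      ring
    have hEE : E' = I.R \ E := I.eq_of_divisorOf hE' Set.sdiff_subset fun x hR => by
      have h1 := hg x hR.1
      have h2 := I.divisorOf_eq_or hE x
      have h3 := I.divisorOf_eq_or hE' x
      rw [hord x hR.1, pull_apply, pull_apply, I.e_of_mem hR, I.divisorOf_R_of_mem hR] at h1
      rw [I.divisorOf_diff hE, I.divisorOf_R_of_mem hR]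
      omega
    obtain ⟨e, -⟩ := exists_iso_of_ord (D := D') (D' := D + I.D₁ E) (inv_ne_zero hc0)
      (fun y hy => by
        obtain ⟨x, rfl⟩ := I.π_surjective y
        have hx := I.isClosed_of_π hy
        have h1 := hg x hx
        rw [hord x hx, pull_apply, pull_apply, hEE, I.divisorOf_diff hE] at h1
        rw [ord_inv hc0, Finsupp.add_apply, I.D₁_apply hE]
        by_cases hR : x ∈ I.R
        · rw [I.e_of_mem hR] at h1
          omega
        · rw [I.e_of_notMem hx hR, I.divisorOf_of_notMem hE hR] at h1
          rw [I.divisorOf_of_notMem hE hR]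
          omega)
    exact ⟨⟨ε' ≪≫ e ≪≫ (asIso (I.rhoTwistDivisorHom E ε)).symm⟩, hEE⟩

/-- Hilbert's theorem 90 for the divisors of rational functions. -/
lemma exists_ord_sub_eq {g : C.K} (hg : g ≠ 0)
    (h : ∀ x, IsClosed {x} → ord g (I.σ x) = - ord g x) :
    ∃ f : C.K, f ≠ 0 ∧ ∀ x, IsClosed {x} → ord g x = ord f x - ord f (I.σ x) := by
  have hs : I.s g ≠ 0 := (map_ne_zero I.s).mpr hg
  -- The norm of g has neither zeros nor poles, so it is constant; dividing g by a square root of it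
  -- makes the norm 1 without changing the divisor.
  obtain ⟨c, hc0, hc⟩ := exists_const_eq_of_ord (f := g * I.s g)
    (fun x hx => by rw [Scheme.ord_mul hg hs, I.ord_s hx, h x hx, add_neg_cancel])
    (mul_ne_zero hg hs)
  obtain ⟨r, hr⟩ := IsAlgClosed.exists_eq_mul_self c
  have hr0 : r ≠ 0 := by
    rintro rfl
    simp [hr] at hc0
  have hcr : C.const r ≠ 0 := (map_ne_zero C.const).mpr hr0
  let g' := g / C.const r
  have hg' : g' ≠ 0 := div_ne_zero hg hcr
  have hord (x : C.X) : ord g' x = ord g x := by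
    rw [ord_div hg hcr, ord_const, sub_zero]
  have hgs : g' * I.s g' = 1 := by
    simp only [g']
    rw [map_div₀, I.s_const, div_mul_div_comm, ← hc, hr, map_mul,
      div_self (mul_ne_zero hcr hcr)]
  -- The element 1 + g' solves the equation unless it is 0; for g' = -1 an anti-invariant function
  -- does.
  obtain ⟨f, hf0, hf⟩ : ∃ f : C.K, f ≠ 0 ∧ f = g' * I.s f := by
    by_cases h1 : 1 + g' = 0
    · refine ⟨I.a₀, I.a₀_ne, ?_⟩
      rw [I.s_a₀, eq_neg_of_add_eq_zero_right h1, neg_one_mul, neg_neg]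
    · refine ⟨1 + g', h1, ?_⟩
      rw [map_add, map_one, mul_add, hgs, mul_one, add_comm]
  refine ⟨f, hf0, fun x hx => ?_⟩
  have h2 : ord f x = ord g' x + ord (I.s f) x := by
    rw [← Scheme.ord_mul hg' ((map_ne_zero I.s).mpr hf0), ← hf]
  rw [hord, I.ord_s hx] at h2
  linarith

/-- With M = 𝒪(F), the isomorphism gives σ^*F - F = div g. By `exists_ord_sub_eq`, F may be changed
by a principal divisor into a σ-invariant one. -/
lemma exists_iso_pullbackTwist {M : C.X.Modules} (hM : IsLineBundle M)
    (i : (Scheme.Modules.pullback I.σ).obj M ≅ M) :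
    ∃ (L : B.X.Modules) (E : Set C.X), IsLineBundle L ∧ E ⊆ I.R ∧
      Nonempty (M ≅ pullbackTwist I.π L E) := by
  obtain ⟨F, ⟨ε⟩⟩ := exists_iso_divisorSheaf hM
  let F' : C.X →₀ ℤ := F.comapDomain I.σ
    (Function.LeftInverse.injective I.σ_apply_apply).injOn
  have hF' (x : C.X) : F' x = F (I.σ x) := rfl
  have hpull : IsPullbackDivisor I.σ I.σ_genericPoint F F' := fun x hx =>
    ⟨I.isClosed_σ hx, 1, zero_le_one, fun b => by rw [one_mul]; exact I.ord_s hx b,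
      by rw [one_mul, hF']⟩
  have := isIso_divisorPullback I.σ I.σ_genericPoint hpull
  obtain ⟨g, hg0, hg⟩ := exists_ord_of_iso
    ((asIso (divisorPullback I.σ I.σ_genericPoint hpull)).symm ≪≫
      (Scheme.Modules.pullback I.σ).mapIso ε.symm ≪≫ i ≪≫ ε)
  simp only [hF'] at hg
  obtain ⟨f, hf0, hf⟩ := I.exists_ord_sub_eq hg0 (fun x hx => by
    have h1 := hg x hx
    have h2 := hg (I.σ x) (I.isClosed_σ hx)
    rw [I.σ_apply_apply] at h2
    linarith)
  let G (x : C.X) : ℤ := F x + ord f x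
  have hG (x : C.X) (hx : IsClosed {x}) : G (I.σ x) = G x := by
    have h1 := hg x hx
    have h2 := hf x hx
    simp only [G]
    linarith
  let E : Set C.X := {x | x ∈ I.R ∧ Odd (G x)}
  have hE : E ⊆ I.R := fun x hx => hx.1
  -- The integer quotient rounds down, also for negative G, so at a point of odd multiplicity the
  -- remainder is 1, which is what E contributes.
  obtain ⟨D, hD⟩ := I.exists_divisor_of_invariant (fun x => G x / I.e x) (by
      refine (F.hasFiniteSupport.union (finite_ord_ne_zero f)).subset ?_
      rintro x ⟨-, h⟩
      by_contra h'
      rw [Set.mem_union, not_or] at h'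
      refine h ?_
      have h1 : F x = 0 := by simpa using h'.1
      have h2 : ord f x = 0 := not_not.mp h'.2
      simp [G, h1, h2])
    (fun x hx => by rw [hG x hx, I.e_σ])
  obtain ⟨e, -⟩ := exists_iso_of_ord (D := F) (D' := I.pull D + C.divisorOf E)
    (inv_ne_zero hf0) (fun x hx => by
      rw [ord_inv hf0, Finsupp.add_apply, pull_apply, hD x hx]
      have hGx : G x = F x + ord f x := rfl
      by_cases hR : x ∈ I.R
      · rw [I.e_of_mem hR, I.divisorOf_apply hE]
        by_cases ho : Odd (G x)
        · rw [if_pos ⟨hR, ho⟩]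
          obtain ⟨k, hk⟩ := ho
          omega
        · rw [if_neg fun h => ho h.2]
          obtain ⟨k, hk⟩ := Int.not_odd_iff_even.mp ho
          omega
      · rw [I.e_of_notMem hx hR, I.divisorOf_of_notMem hE hR]
        omega)
  exact ⟨_, E, isLineBundle_divisorSheaf D, hE,
    ⟨ε ≪≫ e ≪≫ (asIso (I.pullbackTwistHom E (Iso.refl _))).symm⟩⟩

end QuotientData

/-! ### The anti-invariant summand -/

namespace QuotientData

variable {C B : Curve} (I : QuotientData C B) {E : Set C.X} (hE : E ⊆ I.R)

/-- The morphism `ρ⁻¹(π_* E) ⟶ π_* 𝒪_C(E)`, `a ⊗ f ↦ a π^* f`. -/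
def rhoTwistToPushforward :
    I.ρinvTwist E ⟶ (Scheme.Modules.pushforward I.π).obj (C.divisorSheaf (C.divisorOf E)) :=
  homToPushforward I.π I.π_genericPoint (C.divisorOf E)
    (fun U w => I.a₀ * I.p (val ((I.rhoTwistHom E).app U w)))
    (fun U w w' _ => by rw [app_add, val_add, map_add, mul_add])
    (fun U a w _ => by
      rw [Scheme.Modules.Hom.app_smul, val_smul, map_mul, mul_left_comm]
      rfl)
    (fun U V i w hV => by rw [app_res, val_res i hV])
    (fun U w x hx hc => by
      have h := (I.a₀_mul_p_mem_iff hE 0 hc (val ((I.rhoTwistHom E).app U w))).mpr (by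
        rw [zero_add]
        exact val_mem _ hx (I.isClosed_π hc))
      rwa [pull_zero, zero_add] at h)

/-- The function on sections defined by `rhoTwistToPushforward`. -/
def twistSection {U : B.X.Opens} (w : Γ(I.ρinvTwist E, U)) :
    Γ(C.divisorSheaf (C.divisorOf E), I.π ⁻¹ᵁ U) :=
  (I.rhoTwistToPushforward hE).app U w

lemma val_twistSection {U : B.X.Opens} (w : Γ(I.ρinvTwist E, U)) :
    val (I.twistSection hE w) = I.a₀ * I.p (val ((I.rhoTwistHom E).app U w)) := by
  by_cases hU : genericPoint B.X ∈ U
  · exact val_homToPushforward I.π I.π_genericPoint (C.divisorOf E)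
      (fun U w => I.a₀ * I.p (val ((I.rhoTwistHom E).app U w))) _ _ _ _ hU w
  · rw [val_of_notMem hU, map_zero, mul_zero, val_of_notMem]
    exact (genericPoint_mem_preimage_iff _ I.π_genericPoint).not.mpr hU

lemma twistSection_add {U : B.X.Opens} (w w' : Γ(I.ρinvTwist E, U)) :
    I.twistSection hE (w + w') = I.twistSection hE w + I.twistSection hE w' :=
  app_add _ _ _

lemma twistSection_smul {U : B.X.Opens} (a : Γ(B.X, U)) (w : Γ(I.ρinvTwist E, U)) :
    I.twistSection hE (a • w) = I.π.app U a • I.twistSection hE w :=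
  Scheme.Modules.Hom.app_smul (I.rhoTwistToPushforward hE) a w

lemma res_twistSection {U V : B.X.Opens} (i : V ≤ U) (w : Γ(I.ρinvTwist E, U)) :
    I.twistSection hE (res i w) = res (I.π.preimage_mono i) (I.twistSection hE w) :=
  app_res (I.rhoTwistToPushforward hE) i w

lemma twistSection_tmul_one {U : B.X.Opens} (a : Γ(I.ρinv, U)) :
    I.twistSection hE (tmul a
      (B.oneSection _ (pushDivisor_nonneg I.π _ (C.divisorOf_nonneg E)) U)) =
        rhoInvFun a • C.oneSection _ (C.divisorOf_nonneg E) (I.π ⁻¹ᵁ U) := by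
  by_cases hU : genericPoint B.X ∈ U
  · have hU' := (genericPoint_mem_preimage_iff _ I.π_genericPoint).mpr hU
    apply val_injective
    rw [val_twistSection, val_rhoTwistHom, val_smul, val_oneSection hU, val_oneSection hU', map_one]
  · exact (subsingleton_of_genericPoint_notMem
      ((genericPoint_mem_preimage_iff _ I.π_genericPoint).not.mpr hU)).elim _ _

variable (L L' : B.X.Modules)

/-- The sheaf `L ⊗ ρ⁻¹(π_* E)`. -/
abbrev ρTwist (E : Set C.X) : B.X.Modules := rhoTwist I.σ I.π I.isQuotient.invariant L E

/-- The morphism `L ⊗ ρ⁻¹(π_* E) ⟶ π_* (π^* L (E))`. -/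
def antiHom : I.ρTwist L E ⟶ (Scheme.Modules.pushforward I.π).obj (pullbackTwist I.π L E) :=
  tensorLift (fun U => LinearMap.mk₂ Γ(B.X, U)
    (fun s w => (show Γ(pullbackTwist I.π L E, I.π ⁻¹ᵁ U) from
      tmul (pullbackSection I.π s) (I.twistSection hE w)))
    (fun s s' w => by rw [pullbackSection_add, add_tmul]; rfl)
    (fun a s w => by rw [pullbackSection_smul, smul_tmul]; rfl)
    (fun s w w' => by rw [twistSection_add, tmul_add]; rfl)
    (fun a s w => by rw [twistSection_smul, tmul_smul]; rfl))
    (fun U V i s w => by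
      change (tmul (pullbackSection I.π (res i s)) (I.twistSection hE (res i w)) :
        Γ(pullbackTwist I.π L E, I.π ⁻¹ᵁ V)) = res (I.π.preimage_mono i)
          (tmul (pullbackSection I.π s) (I.twistSection hE w))
      rw [res_twistSection, ← res_pullbackSection I.π i, res_tmul])

/-- The function on sections defined by `antiHom`. -/
def antiSection {L : B.X.Modules} {U : B.X.Opens} (t : Γ(I.ρTwist L E, U)) :
    Γ(pullbackTwist I.π L E, I.π ⁻¹ᵁ U) :=
  (I.antiHom hE L).app U t

variable {L L'}

lemma antiSection_tmul {U : B.X.Opens} (s : Γ(L, U)) (w : Γ(I.ρinvTwist E, U)) :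
    I.antiSection hE (tmul s w : Γ(I.ρTwist L E, U)) =
      tmul (pullbackSection I.π s) (I.twistSection hE w) :=
  tensorLift_tmul _ _ _ _ _

lemma antiSection_add {U : B.X.Opens} (t t' : Γ(I.ρTwist L E, U)) :
    I.antiSection hE (t + t') = I.antiSection hE t + I.antiSection hE t' :=
  app_add _ _ _

lemma antiSection_smul {U : B.X.Opens} (a : Γ(B.X, U)) (t : Γ(I.ρTwist L E, U)) :
    I.antiSection hE (a • t) = I.π.app U a • I.antiSection hE t :=
  Scheme.Modules.Hom.app_smul (I.antiHom hE L) a t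

lemma res_antiSection {U V : B.X.Opens} (i : V ≤ U) (t : Γ(I.ρTwist L E, U)) :
    res (I.π.preimage_mono i) (I.antiSection hE t) = I.antiSection hE (res i t) :=
  (app_res (I.antiHom hE L) i t).symm

lemma antiSection_naturality (f : L ⟶ L') {U : B.X.Opens} (t : Γ(I.ρTwist L E, U)) :
    (tensorMap ((Scheme.Modules.pullback I.π).map f) _).app (I.π ⁻¹ᵁ U) (I.antiSection hE t) =
      I.antiSection hE ((tensorMap f _).app U t) := by
  have h : I.antiHom hE L ≫ (Scheme.Modules.pushforward I.π).map
      (tensorMap ((Scheme.Modules.pullback I.π).map f) _) =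
        tensorMap f _ ≫ I.antiHom hE L' := by
    refine tensor_hom_ext fun V s w => ?_
    change (tensorMap ((Scheme.Modules.pullback I.π).map f) _).app (I.π ⁻¹ᵁ V)
        (I.antiSection hE (tmul s w)) =
      I.antiSection hE ((tensorMap f _).app V (tmul s w))
    rw [tensorMap_tmul, antiSection_tmul, antiSection_tmul, tensorMap_tmul,
      pullback_map_pullbackSection]
  exact congr(($h).app U t)

variable {D : B.X →₀ ℤ} (ε : L ≅ B.divisorSheaf D)

/-- A general t is only locally a sum of pure tensors. The right-hand side is therefore made into a
morphism γ to a direct image, and two morphisms on a tensor product can be compared on s ⊗ w. -/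
lemma val_pullbackTwistHom_antiSection {U : B.X.Opens} (t : Γ(I.ρTwist L E, U)) :
    val ((I.pullbackTwistHom E ε).app (I.π ⁻¹ᵁ U) (I.antiSection hE t)) =
      I.a₀ * I.p (val ((I.rhoTwistDivisorHom E ε).app U t)) := by
  by_cases hU : genericPoint B.X ∈ U
  swap
  · rw [val_of_notMem hU, map_zero, mul_zero, val_of_notMem]
    exact (genericPoint_mem_preimage_iff _ I.π_genericPoint).not.mpr hU
  let v (U : B.X.Opens) (t : Γ(I.ρTwist L E, U)) : C.K :=
    I.a₀ * I.p (val ((I.rhoTwistDivisorHom E ε).app U t))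
  have hadd : ∀ U s t, genericPoint B.X ∈ U → v U (s + t) = v U s + v U t := fun U s t _ => by
    simp only [v]
    rw [app_add, val_add, map_add, mul_add]
  have hsmul : ∀ U (a : Γ(B.X, U)) s, genericPoint B.X ∈ U →
      v U (a • s) = funcMap I.π I.π_genericPoint (fval a) * v U s := fun U a s _ => by
    simp only [v]
    rw [Scheme.Modules.Hom.app_smul, val_smul, map_mul, mul_left_comm]
    rfl
  have hres : ∀ U V (i : V ≤ U) s, genericPoint B.X ∈ V → v V (res i s) = v U s :=
    fun U V i s hV => by
      simp only [v]
      rw [app_res, val_res i hV]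
  have hmem : ∀ U s, ∀ x ∈ I.π ⁻¹ᵁ U, IsClosed {x} →
      v U s = 0 ∨ 0 ≤ ord (v U s) x + (I.pull D + C.divisorOf E) x := fun U s x hx hc =>
    (I.a₀_mul_p_mem_iff hE D hc _).mpr (val_mem _ hx (I.isClosed_π hc))
  let γ := homToPushforward I.π I.π_genericPoint _ v hadd hsmul hres hmem
  have hγ {V : B.X.Opens} (hV : genericPoint B.X ∈ V) (t : Γ(I.ρTwist L E, V)) :
      val (show Γ(C.divisorSheaf (I.pull D + C.divisorOf E), I.π ⁻¹ᵁ V) from γ.app V t) = v V t :=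
    val_homToPushforward I.π I.π_genericPoint _ v hadd hsmul hres hmem hV t
  have h : I.antiHom hE L ≫ (Scheme.Modules.pushforward I.π).map (I.pullbackTwistHom E ε) = γ := by
    refine tensor_hom_ext fun V s w => ?_
    by_cases hV : genericPoint B.X ∈ V
    · refine val_injective (Eq.trans ?_ (hγ hV (tmul s w)).symm)
      change val ((I.pullbackTwistHom E ε).app (I.π ⁻¹ᵁ V) (I.antiSection hE (tmul s w))) = _
      simp only [v]
      rw [antiSection_tmul, val_pullbackTwistHom, val_rhoTwistDivisorHom, val_twistSection, map_mul,
        mul_left_comm]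
    · exact (subsingleton_of_genericPoint_notMem
        (M := C.divisorSheaf (I.pull D + C.divisorOf E))
        ((genericPoint_mem_preimage_iff _ I.π_genericPoint).not.mpr hV)).elim _ _
  refine Eq.trans ?_ (hγ hU t)
  rw [← h]
  rfl

/-! ### Global sections -/

lemma app_scalars (c : ℂ) : I.π.app ⊤ (B.scalars c) = C.scalars c := by
  have h : C.scalars = B.scalars ≫ I.π.appTop := by
    unfold Curve.scalars
    rw [← I.π_str, Scheme.Hom.comp_appTop, Category.assoc]
  rw [h]
  rfl

variable (E) in
/-- The global section `π^* s ⊗ 1` of `π^* L (E)`. -/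
def globalPullback (s : Γ(L, ⊤)) : Γ(pullbackTwist I.π L E, ⊤) :=
  tmul (U := ⊤) (pullbackSection I.π (L := L) (U := ⊤) s) (C.oneSection _ (C.divisorOf_nonneg E) ⊤)

lemma globalPullback_add (s s' : Γ(L, ⊤)) :
    I.globalPullback E (s + s') = I.globalPullback E s + I.globalPullback E s' :=
  (congrArg (fun z => tmul (U := ⊤) z _) (pullbackSection_add _ _ _)).trans (add_tmul _ _ _)

lemma globalPullback_smul (a : Γ(B.X, ⊤)) (s : Γ(L, ⊤)) :
    I.globalPullback E (a • s) = (show Γ(C.X, ⊤) from I.π.app ⊤ a) • I.globalPullback E s :=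
  (congrArg (fun z => tmul (U := ⊤) z _) (pullbackSection_smul _ _ _)).trans (smul_tmul _ _ _)

lemma globalPullback_zero : I.globalPullback E (0 : Γ(L, ⊤)) = 0 := by
  have h := I.globalPullback_add (E := E) 0 (0 : Γ(L, ⊤))
  rw [add_zero] at h
  exact left_eq_add.mp h

lemma globalPullback_naturality (f : L ⟶ L') (s : Γ(L, ⊤)) :
    (tensorMap ((Scheme.Modules.pullback I.π).map f) _).app ⊤ (I.globalPullback E s) =
      I.globalPullback E (f.app ⊤ s) :=
  (tensorMap_tmul _ _ _).trans (congrArg (fun z => tmul (U := ⊤) z _)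
    (pullback_map_pullbackSection I.π f (U := ⊤) s))

lemma val_globalPullback (s : Γ(L, ⊤)) :
    val ((I.pullbackTwistHom E ε).app ⊤ (I.globalPullback E s)) = I.p (val (ε.hom.app ⊤ s)) := by
  refine (I.val_pullbackTwistHom ε (U := ⊤) s _).trans ?_
  exact (congrArg _ (val_oneSection (U := ⊤) (Opens.mem_top _))).trans (mul_one _)

/-- The global section of `π^* L (E)` defined by a global section of `L ⊗ ρ⁻¹(π_* E)`. -/
def globalAnti (t : Γ(I.ρTwist L E, ⊤)) : Γ(pullbackTwist I.π L E, ⊤) :=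
  I.antiSection hE (U := ⊤) t

lemma globalAnti_add (t t' : Γ(I.ρTwist L E, ⊤)) :
    I.globalAnti hE (t + t') = I.globalAnti hE t + I.globalAnti hE t' := antiSection_add _ _ _ _

lemma globalAnti_smul (a : Γ(B.X, ⊤)) (t : Γ(I.ρTwist L E, ⊤)) :
    I.globalAnti hE (a • t) = (show Γ(C.X, ⊤) from I.π.app ⊤ a) • I.globalAnti hE t :=
  antiSection_smul _ _ _ _

lemma globalAnti_zero : I.globalAnti hE (0 : Γ(I.ρTwist L E, ⊤)) = 0 := by
  have h := I.globalAnti_add hE 0 (0 : Γ(I.ρTwist L E, ⊤))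
  rw [add_zero] at h
  exact left_eq_add.mp h

lemma globalAnti_naturality (f : L ⟶ L') (t : Γ(I.ρTwist L E, ⊤)) :
    (tensorMap ((Scheme.Modules.pullback I.π).map f) _).app ⊤ (I.globalAnti hE t) =
      I.globalAnti hE ((tensorMap f _).app ⊤ t) :=
  I.antiSection_naturality hE f (U := ⊤) t

lemma val_globalAnti (t : Γ(I.ρTwist L E, ⊤)) :
    val ((I.pullbackTwistHom E ε).app ⊤ (I.globalAnti hE t)) =
      I.a₀ * I.p (val ((I.rhoTwistDivisorHom E ε).app ⊤ t)) :=
  I.val_pullbackTwistHom_antiSection hE ε (U := ⊤) t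

variable (L)

/-- The map from the invariant and anti-invariant parts to the space of global sections. -/
def sumMap : (B.H0 L × B.H0 (I.ρTwist L E)) →ₗ[ℂ] C.H0 (pullbackTwist I.π L E) where
  toFun u := (I.globalPullback E u.1 + I.globalAnti hE u.2 : Γ(pullbackTwist I.π L E, ⊤))
  map_add' u v := (congrArg₂ (fun x y : Γ(pullbackTwist I.π L E, ⊤) => x + y)
    (I.globalPullback_add (L := L) u.1 v.1) (I.globalAnti_add hE (L := L) u.2 v.2)).trans
      (add_add_add_comm _ _ _ _)
  map_smul' c u := by
    refine (congrArg₂ (fun x y : Γ(pullbackTwist I.π L E, ⊤) => x + y)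
      (I.globalPullback_smul (L := L) (B.scalars c) u.1)
      (I.globalAnti_smul hE (L := L) (B.scalars c) u.2)).trans ?_
    rw [app_scalars]
    exact (smul_add (C.scalars c) (_ : Γ(pullbackTwist I.π L E, ⊤)) _).symm

lemma sumMap_apply (s : Γ(L, ⊤)) (t : Γ(I.ρTwist L E, ⊤)) :
    I.sumMap hE L (s, t) =
      (I.globalPullback E s + I.globalAnti hE t : Γ(pullbackTwist I.π L E, ⊤)) := rfl

variable {L}

lemma val_sumMap (s : Γ(L, ⊤)) (t : Γ(I.ρTwist L E, ⊤)) :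
    val ((I.pullbackTwistHom E ε).app ⊤ (I.sumMap hE L (s, t))) =
      I.p (val (ε.hom.app ⊤ s)) + I.a₀ * I.p (val ((I.rhoTwistDivisorHom E ε).app ⊤ t)) := by
  rw [sumMap_apply]
  refine (congrArg val (app_add (I.pullbackTwistHom E ε) _ _)).trans ?_
  rw [val_add]
  rw [val_globalPullback, val_globalAnti]

/-- Adding the relation to its image under s leaves 2p(b) = 0. -/
lemma eq_zero_of_add_eq_zero {b b' : B.K} (h : I.p b + I.a₀ * I.p b' = 0) : b = 0 ∧ b' = 0 := by
  have h1 := congrArg I.s h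
  rw [map_add, I.s_p, I.s_a₀_mul_p, map_zero] at h1
  have h2 : 2 * I.p b = 0 := by linear_combination h + h1
  have h3 : I.p b = 0 := (mul_eq_zero.mp h2).resolve_left two_ne
  rw [h3, zero_add] at h
  exact ⟨(map_eq_zero I.p).mp h3, (map_eq_zero I.p).mp ((mul_eq_zero.mp h).resolve_left I.a₀_ne)⟩

lemma exists_add_eq (f : C.K) : ∃ b b' : B.K, I.p b = (f + I.s f) / 2 ∧
    I.a₀ * I.p b' = (f - I.s f) / 2 := by
  obtain ⟨b, hb⟩ := I.exists_p_eq (f := (f + I.s f) / 2) (by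
    rw [map_div₀, map_add, I.s_s, map_ofNat, add_comm])
  obtain ⟨b', hb'⟩ := I.exists_a₀_mul_p_eq (f := (f - I.s f) / 2) (by
    rw [map_div₀, map_sub, I.s_s, map_ofNat, ← neg_div, neg_sub])
  exact ⟨b, b', hb, hb'⟩

lemma half_mem {f g : C.K} {x : C.X} (hx : IsClosed {x}) {n : ℤ} (hf : f = 0 ∨ 0 ≤ ord f x + n)
    (hg : g = 0 ∨ 0 ≤ ord g x + n) : (f + g) / 2 = 0 ∨ 0 ≤ ord ((f + g) / 2) x + n := by
  have := C.isDVR x hx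
  by_cases h0 : f + g = 0
  · simp [h0]
  right
  rw [ord_div h0 two_ne, ord_two, sub_zero]
  rcases hf with rfl | hf
  · rw [zero_add] at h0 ⊢
    exact hg.resolve_left h0
  rcases hg with rfl | hg
  · rw [add_zero]
    exact hf
  have := Scheme.ord_add (x := x) h0
  rcases min_le_iff.mp this with h | h <;> linarith

/-- For L = 𝒪(D) the map is (b, b') ↦ p(b) + a₀p(b'), so injectivity is the directness of K(B) ⊕
a₀K(B). The divisor π^*D + E is σ-invariant, so with f also s(f) satisfies its conditions, and so do
both halves of f; the membership criteria then bring these down to B. -/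
lemma sumMap_bijective (hL : IsLineBundle L) : Function.Bijective (I.sumMap hE L) := by
  obtain ⟨D, ⟨ε⟩⟩ := exists_iso_divisorSheaf hL
  have hB := Opens.mem_top (genericPoint B.X)
  constructor
  · rw [← LinearMap.ker_eq_bot, LinearMap.ker_eq_bot']
    rintro ⟨s, t⟩ h
    have h1 := (I.val_sumMap hE ε s t).symm.trans
      (congrArg (fun z => val ((I.pullbackTwistHom E ε).app ⊤ z)) h)
    have hz {C : Curve} {D : C.X →₀ ℤ} : val (0 : Γ(C.divisorSheaf D, ⊤)) = 0 := by
      have := val_add (0 : Γ(C.divisorSheaf D, ⊤)) 0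
      rw [add_zero] at this
      exact left_eq_add.mp this
    obtain ⟨h2, h3⟩ := I.eq_zero_of_add_eq_zero (h1.trans ((congrArg val
      (map_zero ((I.pullbackTwistHom E ε).app ⊤).hom)).trans hz))
    have h4 : s = 0 := (app_bijective_of_isIso ε.hom ⊤).1
      (val_injective
      (h2.trans ((congrArg val (map_zero (ε.hom.app ⊤).hom)).trans hz).symm))
    have h5 : t = 0 := (app_bijective_of_isIso (I.rhoTwistDivisorHom E ε) ⊤).1
      (val_injective
      (h3.trans ((congrArg val (map_zero ((I.rhoTwistDivisorHom E ε).app ⊤).hom)).trans hz).symm))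
    exact Prod.ext h4 h5
  · intro u
    let f : C.K := val ((I.pullbackTwistHom E ε).app ⊤ u)
    have hf (x : C.X) (hx : IsClosed {x}) : f = 0 ∨ 0 ≤ ord f x + (I.pull D + C.divisorOf E) x :=
      val_mem _ (Opens.mem_top x) hx
    have hsf (x : C.X) (hx : IsClosed {x}) :
        I.s f = 0 ∨ 0 ≤ ord (I.s f) x + (I.pull D + C.divisorOf E) x := by
      have h := hf (I.σ x) (I.isClosed_σ hx)
      rwa [Finsupp.add_apply, I.pull_σ, I.divisorOf_σ hE, ← I.ord_s hx, ← map_eq_zero I.s] at h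
    obtain ⟨b, b', hb, hb'⟩ := I.exists_add_eq f
    obtain ⟨s, hs⟩ := (app_bijective_of_isIso ε.hom ⊤).2 (ofVal D ⊤ b fun y _ hy => by
      obtain ⟨x, rfl⟩ := I.π_surjective y
      have hx := I.isClosed_of_π hy
      rw [← I.p_mem_iff hE D hx, hb]
      exact half_mem hx (hf x hx) (hsf x hx))
    obtain ⟨t, ht⟩ := (app_bijective_of_isIso (I.rhoTwistDivisorHom E ε) ⊤).2
      (ofVal (D + I.D₁ E) ⊤ b' fun y _ hy => by
        obtain ⟨x, rfl⟩ := I.π_surjective y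
        have hx := I.isClosed_of_π hy
        rw [← I.a₀_mul_p_mem_iff hE D hx, hb', sub_eq_add_neg]
        refine half_mem hx (hf x hx) ?_
        rw [neg_eq_zero, ord_neg]
        exact hsf x hx)
    refine ⟨(s, t), (app_bijective_of_isIso (I.pullbackTwistHom E ε) ⊤).1 (val_injective ?_)⟩
    rw [val_sumMap, hs, ht, val_ofVal hB, val_ofVal hB, hb, hb', ← add_div]
    change _ = f
    rw [add_add_sub_cancel, ← two_mul, mul_div_cancel_left₀ _ two_ne]

/-- The decomposition of the space of global sections. -/
def decomposition (hL : IsLineBundle L) :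
    C.H0 (pullbackTwist I.π L E) ≃ₗ[ℂ] B.H0 L × B.H0 (I.ρTwist L E) :=
  (LinearEquiv.ofBijective (I.sumMap hE L) (I.sumMap_bijective hE hL)).symm

/-- It suffices to check the inverse, which is given by formulas; the divisor chosen for L occurs
only in the proof of bijectivity. -/
lemma decomposition_naturality (hL : IsLineBundle L) (hL' : IsLineBundle L') (f : L ⟶ L')
    (u : C.H0 (pullbackTwist I.π L E)) :
    I.decomposition hE hL' (H0map (tensorMap ((Scheme.Modules.pullback I.π).map f) _) u) =
      (H0map f (I.decomposition hE hL u).1, H0map (tensorMap f _) (I.decomposition hE hL u).2) := by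
  obtain ⟨⟨s, t⟩, rfl⟩ := (I.decomposition hE hL).symm.surjective u
  rw [LinearEquiv.apply_symm_apply]
  refine (LinearEquiv.eq_symm_apply _).mp ?_
  refine (app_add (tensorMap ((Scheme.Modules.pullback I.π).map f) _) _ _).trans ?_
  exact congrArg₂ (· + ·) (I.globalPullback_naturality f s) (I.globalAnti_naturality hE f t)

lemma decomposition_symm_left (hL : IsLineBundle L) (s : B.H0 L) :
    (I.decomposition hE hL).symm (s, 0) =
      tmul (U := ⊤) (pullbackSection I.π (L := L) (U := ⊤) s)
        (C.oneSection _ (C.divisorOf_nonneg E) ⊤) := by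
  refine (I.sumMap_apply hE L s 0).trans ?_
  rw [globalAnti_zero, add_zero]
  rfl

/-- The inverse comes from the sheaf morphism `antiHom`, so it commutes with restriction to U and
can be evaluated there on a pure tensor. -/
lemma decomposition_symm_right (hL : IsLineBundle L) (t : B.H0 (I.ρTwist L E)) (U : B.X.Opens)
    (s : Γ(L, U)) (a : Γ(I.ρinv, U))
    (h : H0.res t U = tmul s (tmul a
      (B.oneSection _ (pushDivisor_nonneg I.π _ (C.divisorOf_nonneg E)) U))) :
    H0.res ((I.decomposition hE hL).symm (0, t)) (I.π ⁻¹ᵁ U) =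
      rhoInvFun a • tmul (pullbackSection I.π s)
        (C.oneSection _ (C.divisorOf_nonneg E) (I.π ⁻¹ᵁ U)) := by
  have h0 : (I.decomposition hE hL).symm (0, t) = I.antiSection hE (U := ⊤) t := by
    refine (I.sumMap_apply hE L 0 t).trans ?_
    rw [globalPullback_zero, zero_add]
    rfl
  rw [h0]
  refine (I.res_antiSection hE (le_top : U ≤ ⊤) t).trans ?_
  refine (congrArg (I.antiSection hE) h).trans ?_
  rw [antiSection_tmul, twistSection_tmul_one, tmul_smul]

end QuotientData

end CurveInvolution

end

theorem proposition1 (C B : Curve)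
    (σ : C.X ⟶ C.X) (hσ_str : σ ≫ C.str = C.str) (hσ_invol : σ ≫ σ = 𝟙 C.X) (hσ_ne : σ ≠ 𝟙 C.X)
    (π : C.X ⟶ B.X) (hπ_str : π ≫ B.str = C.str) (hπ : IsQuotient σ π) :
    -- every `σ`-invariant line bundle is of the form `π^* L (E)`
    (∀ M : C.X.Modules, IsLineBundle M →
      Nonempty ((Scheme.Modules.pullback σ).obj M ≅ M) →
      (∃ (L : B.X.Modules) (E : Set C.X), IsLineBundle L ∧ E ⊆ fixedLocus σ ∧
        Nonempty (M ≅ pullbackTwist π L E)) ∧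
      -- uniqueness of the pair up to the replacement
      (∀ (L L' : B.X.Modules) (E E' : Set C.X), IsLineBundle L → IsLineBundle L' →
        E ⊆ fixedLocus σ → E' ⊆ fixedLocus σ →
        Nonempty (M ≅ pullbackTwist π L E) → Nonempty (M ≅ pullbackTwist π L' E') →
        (Nonempty (L' ≅ L) ∧ E' = E) ∨
        (Nonempty (L' ≅ rhoTwist σ π hπ.invariant L E) ∧ E' = fixedLocus σ \ E))) ∧
    -- the replacement gives a pair defining the same line bundle
    (∀ (L : B.X.Modules) (E : Set C.X), IsLineBundle L → E ⊆ fixedLocus σ →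
      IsLineBundle (rhoTwist σ π hπ.invariant L E) ∧
      Nonempty (pullbackTwist π L E ≅
        pullbackTwist π (rhoTwist σ π hπ.invariant L E) (fixedLocus σ \ E))) ∧
    -- the natural decomposition of the global sections
    (∀ E : Set C.X, E ⊆ fixedLocus σ →
      ∃ Φ : ∀ L : B.X.Modules, IsLineBundle L →
          (C.H0 (pullbackTwist π L E) ≃ₗ[ℂ]
            B.H0 L × B.H0 (rhoTwist σ π hπ.invariant L E)),
        -- it is natural with respect to morphisms of line bundles
        (∀ (L L' : B.X.Modules) (hL : IsLineBundle L) (hL' : IsLineBundle L') (f : L ⟶ L')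
          (u : C.H0 (pullbackTwist π L E)),
          Φ L' hL' (Curve.H0map (tensorMap ((Scheme.Modules.pullback π).map f) _) u) =
            (Curve.H0map f (Φ L hL u).1, Curve.H0map (tensorMap f _) (Φ L hL u).2)) ∧
        -- on the first factor its inverse is `s ↦ π^* s ⊗ 1`
        (∀ (L : B.X.Modules) (hL : IsLineBundle L) (s : B.H0 L),
          (Φ L hL).symm (s, 0) =
            tmul (U := ⊤) (pullbackSection π (L := L) (U := ⊤) s)
              (C.oneSection _ (C.divisorOf_nonneg E) ⊤)) ∧
        -- on the second factor its inverse is given by `s ⊗ (a ⊗ 1) ↦ a • (π^* s ⊗ 1)`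
        (∀ (L : B.X.Modules) (hL : IsLineBundle L) (t : B.H0 (rhoTwist σ π hπ.invariant L E))
          (U : B.X.Opens) (s : Γ(L, U)) (a : Γ(rhoInv σ π hπ.invariant, U)),
          Curve.H0.res t U = tmul s (tmul a
            (B.oneSection _ (pushDivisor_nonneg π _ (C.divisorOf_nonneg E)) U)) →
          Curve.H0.res ((Φ L hL).symm (0, t)) (π ⁻¹ᵁ U) =
            rhoInvFun a • tmul (pullbackSection π s)
              (C.oneSection _ (C.divisorOf_nonneg E) (π ⁻¹ᵁ U)))) := by
  let I : QuotientData C B := ⟨σ, hσ_str, hσ_invol, hσ_ne, π, hπ_str, hπ⟩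
  refine ⟨fun M hM hi => ⟨?_, ?_⟩, fun L E hL hE =>
    ⟨I.isLineBundle_rhoTwist hL E, I.exists_pullbackTwist_iso hL hE⟩, fun E hE =>
    ⟨fun L hL => I.decomposition hE hL,
      fun L L' hL hL' f u => I.decomposition_naturality hE hL hL' f u,
      fun L hL s => I.decomposition_symm_left hE hL s,
      fun L hL t U s a h => I.decomposition_symm_right hE hL t U s a h⟩⟩
  · obtain ⟨i⟩ := hi
    exact I.exists_iso_pullbackTwist hM i
  · rintro L L' E E' hL hL' hE hE' ⟨i⟩ ⟨i'⟩
    exact I.iso_or_iso hL hL' hE hE' (i.symm ≪≫ i')
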